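/- Let $h\ge 1$, $n,k\ge 0$ and let $C$ be a finite set of colors. A configuration assigns to each bin $b$ of a set $B$ of $n+k$ bins a sequence $S(b)\in C^{\le h}$, written from bottom to top; $\alpha[i]$ is the $i$-th element of $\alpha$. In an initial configuration $S_0$, $n$ bins are full ($|S_0(b)|=h$) and $k$ bins are empty. A ball-move takes the top unit (of color $c$) of a bin and puts it on a bin that has fewer than $h$ units and is empty or has top color $c$. A water-move does the same with $m\ge 1$ units of color $c$ at once and must continue until the source bin no longer has top color $c$ or the target bin is full. BSP (resp. WSP) asks whether some sequence of ball-moves (resp. water-moves) turns $S_0$ into a configuration in which every bin is empty or contains $h$ units of one color. Instances are written over a finite alphabet with $\Theta(nh(1+\log|C|)+\log k)$ symbols: $k$ in binary, then the full bins, unit by unit, each color with $\lceil\log_2|C|\rceil$ bits. *Borders.* A border of a sequence $\alpha$ is $0$ or an index $1\le i<|\alpha|$ with $\alpha[i]\ne\alpha[i+1]$; $\mathcal D(\alpha)$ is the set of borders, and $D(S_0)=\sum_b|\mathcal D(S_0(b))\setminus\{0\}|$. The top-border table of $S_0$ is $\tau_0(b)=\max\mathcal D(S_0(b))$. For a table $\tau$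 with $\tau(b)\in\mathcal D(S_0(b))$ for all $b$, put $$B_\varepsilon(\tau)=\{b:\tau(b)=0\},\qquad B_c(\tau)=\{b:\tau(b)\neq0,\ S_0(b)[\tau(b)+1]=c\},$$ $$F_c(\tau)=\sum_b|\{i:\tau(b)<i\le h,\ S_0(b)[i]=c\}|,\qquad G_c(\tau)=\sum_{a\in B_c(\tau)}(h-\tau(a)),\qquad G_c^{b}(\tau)=\sum_{a\in B_c(\tau)\setminus\{b\}}(h-\tau(a)),$$ $$M_c(\tau)=\max\{0,\lceil (F_c(\tau)-G_c(\tau))/h\rceil\},\qquad M_c^{b}(\tau)=\max\{0,\lceil (F_c(\tau)-G_c^{b}(\tau))/h\rceil\}.$$ Write $\tau\to_b\tau'$ if $\tau'(a)=\tau(a)$ for $a\ne b$, $\tau(b)>0$, $\tau'(b)=\max\{i\in\mathcal D(S_0(b)): i<\tau(b)\}$, and $\sum_c M_c^{b}(\tau)\le|B_\varepsilon(\tau)|$. A *removal order* for $S_0$ is a bin sequence $(b_1,\dots,b_m)$ with $m=D(S_0)$ for which there are tables $\tau_1,\dots,\tau_m$ with $\tau_{i-1}\to_{b_i}\tau_i$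 for all $1\le i\le m$. **Statement.** 1. BSP and WSP belong to NP. 2. The certificate can be taken to be a removal order (each bin being written as its index in unary). More precisely, the relation "$x$ encodes an initial configuration $S_0$ in which the number of units of every color is a multiple of $h$, and $y$ encodes a removal order for $S_0$" between words $x,y$ is decidable by a Turing machine in time polynomial in $|x|+|y|$, and there is a polynomial $p$ such that a word $x$ encodes a yes-instance of BSP if and only if it is related to some $y$ with $|y|\le p(|x|)$; the same holds for WSP. 3. For every initial configuration $S_0$, the following are equivalent: $S_0$ is a yes-instance of BSP; $S_0$ is a yes-instance of WSP; the number of units of every color in $S_0$ is a multiple of $h$ and there is a removal order for $S_0$. 4. Each transition can be checked and performed in constant time. There are a random access machine program (unit-cost addition, truncated subtraction, multiplication, integer division, indirect addressing and conditional jumps on natural numbers) and an absolute constant $t$ such that the following holds for every initial configuration and every table $\tau$ with $\tau(b)\in\mathcal D(S_0(b))$ for all $b$. Suppose that the memory holds, at fixed places, $h$, $n$, $|C|$, the entries $\tau(b)$ for the full bins, the maintained counts $F_c(\tau)$ and $G_c(\tau)$, the totals $\sum_c M_c(\tau)$ and $|B_\varepsilon(\tau)|$, and two tables precomputed from $S_0$,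 giving for every position $0\le i<h$ of every full bin $b$ the color $S_0(b)[i+1]$ and the largest border of $S_0(b)$ below $i$ (0 if $i=0$). Given the index of a bin $b$, the program halts after at most $t$ steps. If $\tau\to_b\tau'$ for some $\tau'$, it answers 1 and the memory then holds the same data for $\tau'$. Otherwise it answers 0. -/

import Mathlib

namespace SortPuzzle

/-! ### Configurations, moves, goal configurations -/

/-- A configuration: every bin `b` holds a sequence of at most `h` colors, listed from the bottom
of the bin to its top. -/
abbrev Config (B C : Type) (h : ℕ) : Type := B → {α : List C // α.length ≤ h}

/-- `S → S'`: the top unit of a bin `b₁`, of color `c`, is moved on top of a bin `b₂` that is empty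
or has top color `c`. The equations force `b₁ ≠ b₂`. -/
def BallMove {B C : Type} {h : ℕ} (S S' : Config B C h) : Prop :=
  ∃ (b₁ b₂ : B) (c : C),
    (S b₁).1 = (S' b₁).1 ++ [c] ∧
    ((S b₂).1 = [] ∨ (S b₂).1.getLast? = some c) ∧
    (S' b₂).1 = (S b₂).1 ++ [c] ∧
    ∀ b, b ≠ b₁ → b ≠ b₂ → S b = S' b

/-- `S ⇒ S'`: `m ≥ 1` units of color `c` are poured from `b₁` onto `b₂`; the pouring stops only
when the top of `b₁` no longer has color `c` or when `b₂` is full. -/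
def WaterMove {B C : Type} {h : ℕ} (S S' : Config B C h) : Prop :=
  ∃ (m : ℕ) (b₁ b₂ : B) (c : C), 1 ≤ m ∧
    (S b₁).1 = (S' b₁).1 ++ List.replicate m c ∧
    ((S b₂).1 = [] ∨ (S b₂).1.getLast? = some c) ∧
    (S' b₂).1 = (S b₂).1 ++ List.replicate m c ∧
    ((S' b₁).1.getLast? ≠ some c ∨ (S' b₂).1.length = h) ∧
    ∀ b, b ≠ b₁ → b ≠ b₂ → S b = S' b

/-- Every bin is empty or is filled with `h` units of one color. -/
def Sorted {B C : Type} {h : ℕ} (S : Config B C h) : Prop :=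
  ∀ b, (S b).1 = [] ∨ ∃ c, (S b).1 = List.replicate h c

/-! ### Borders and top-border tables -/

/-- The set of borders of a sequence: `0`, and all `1 ≤ i < |α|` such that the `i`-th and the
`(i+1)`-st element (counted from one) differ. -/
def borders {C : Type} [DecidableEq C] (α : List C) : Finset ℕ :=
  insert 0 ((Finset.range α.length).filter fun i => 1 ≤ i ∧ α[i - 1]? ≠ α[i]?)

/-- The largest border of `α` below `i` (used only when there is one, i.e. when `0 < i`). -/
def prevBorder {C : Type} [DecidableEq C] (α : List C) (i : ℕ) : ℕ :=
  ((borders α).filter (· < i)).sup id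

section Tables

variable {B C : Type} [Fintype B] [DecidableEq B] [Fintype C] [DecidableEq C] {h : ℕ}

/-- The number of non-trivial borders of a configuration. -/
def borderCount (S : Config B C h) : ℕ := ∑ b, ((borders (S b).1).erase 0).card

/-- The top-border table of a configuration: the largest border of each bin. -/
def topBorder (S : Config B C h) (b : B) : ℕ := (borders (S b).1).sup id

/-- `F_c(τ)`: the number of units of color `c` that lie above the border `τ b` in a bin `b`
of `S₀`. -/
def countF (S₀ : Config B C h) (τ : B → ℕ) (c : C) : ℕ :=
  ∑ b, ((Finset.Ioc (τ b) h).filter fun i => (S₀ b).1[i - 1]? = some c).card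

/-- `B_ε(τ)`: the monochrome bins. -/
def monoBins (τ : B → ℕ) : Finset B := Finset.univ.filter fun b => τ b = 0

/-- `B_c(τ)`: the non-monochrome bins whose unit just above the top border has color `c`. -/
def colorBins (S₀ : Config B C h) (τ : B → ℕ) (c : C) : Finset B :=
  Finset.univ.filter fun b => τ b ≠ 0 ∧ (S₀ b).1[τ b]? = some c

/-- `G_c(τ)`: the room for units of color `c` above the top borders of the bins of `B_c(τ)`. -/
def countG (S₀ : Config B C h) (τ : B → ℕ) (c : C) : ℕ :=
  ∑ b ∈ colorBins S₀ τ c, (h - τ b)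

/-- The same room when the bin `b` is not available. -/
def countGWithout (S₀ : Config B C h) (τ : B → ℕ) (b : B) (c : C) : ℕ :=
  ∑ a ∈ (colorBins S₀ τ c).erase b, (h - τ a)

/-- `M_c(τ) = max {0, ⌈(F_c(τ) - G_c(τ)) / h⌉}`: the number of monochrome bins that have to
contain units of color `c`. -/
def countM (S₀ : Config B C h) (τ : B → ℕ) (c : C) : ℤ :=
  max 0 ⌈((countF S₀ τ c : ℚ) - (countG S₀ τ c : ℚ)) / (h : ℚ)⌉

/-- The same number when no unit may be placed above the top border of `b`. -/
def countMWithout (S₀ : Config B C h) (τ : B → ℕ) (b : B) (c : C) : ℤ :=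
  max 0 ⌈((countF S₀ τ c : ℚ) - (countGWithout S₀ τ b c : ℚ)) / (h : ℚ)⌉

/-- The transition `τ → τ'` of top-border tables that removes the top border of the bin `b`. -/
def TableMove (S₀ : Config B C h) (b : B) (τ τ' : B → ℕ) : Prop :=
  (∀ a, a ≠ b → τ a = τ' a) ∧
  0 < τ b ∧ τ' b = prevBorder (S₀ b).1 (τ b) ∧
  ∑ c, countMWithout S₀ τ b c ≤ ((monoBins τ).card : ℤ)

/-- The bin sequence `bs` is an order in which all non-trivial borders of `S₀` can be removed:
it has one entry for each of them, and it carries a sequence of transitions of top-border tables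
which starts at the table of `S₀`. -/
def IsRemovalOrder (S₀ : Config B C h) (bs : List B) : Prop :=
  bs.length = borderCount S₀ ∧
  ∃ τ : ℕ → B → ℕ, τ 0 = topBorder S₀ ∧
    ∀ (i : ℕ) (hi : i < bs.length), TableMove S₀ bs[i] (τ i) (τ (i + 1))

end Tables

/-! ### Instances and their encoding -/

/-- An initial configuration: `n` full bins and `k` empty bins of capacity `h ≥ 1`, with colors
from a set of `m` colors. `content b i` is the color of the `(i+1)`-st unit of the full bin `b`,
counted from the bottom. -/
structure Puzzle where
  h : ℕ
  h_pos : 0 < h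
  n : ℕ
  k : ℕ
  m : ℕ
  content : Fin n → Fin h → Fin m

namespace Puzzle

/-- The bins of an instance: first the full ones, then the empty ones. -/
abbrev Bin (I : Puzzle) : Type := Fin I.n ⊕ Fin I.k

/-- The initial configuration. -/
def init (I : Puzzle) : Config I.Bin (Fin I.m) I.h
  | Sum.inl b => ⟨List.ofFn (I.content b), by simp⟩
  | Sum.inr _ => ⟨[], by simp⟩

/-- Yes-instances of the ball sort puzzle. -/
def BallSolvable (I : Puzzle) : Prop :=
  ∃ T, Relation.ReflTransGen BallMove I.init T ∧ Sorted T

/-- Yes-instances of the water sort puzzle. -/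
def WaterSolvable (I : Puzzle) : Prop :=
  ∃ T, Relation.ReflTransGen WaterMove I.init T ∧ Sorted T

/-- The number of units of each color is a multiple of the capacity. -/
def Balanced (I : Puzzle) : Prop :=
  ∀ c, ∃ j : ℕ, ∑ b, (I.init b).1.count c = I.h * j

/-- The index of a bin, counted from zero. -/
def binIndex (I : Puzzle) : I.Bin → ℕ
  | Sum.inl b => b
  | Sum.inr b => I.n + b

end Puzzle

/-- The alphabet in which instances are written: two binary digits and three end markers. -/
inductive Sym : Type
  | bit (b : Bool)
  | endNumber
  | endUnit
  | endBin

/-- A unit of color `c` among `m` colors: `⌈log₂ m⌉` binary digits (least significant first) and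
an end marker. -/
def encodeColor (m c : ℕ) : List Sym :=
  List.ofFn (fun i : Fin (Nat.clog 2 m) => Sym.bit (c.testBit i)) ++ [Sym.endUnit]

/-- An instance is written as the number `k` in binary, followed by the contents of the full bins,
unit by unit. This takes `Θ(n h (1 + log m) + log k)` symbols. -/
def Puzzle.encode (I : Puzzle) : List Sym :=
  (Nat.bits I.k).map Sym.bit ++ [Sym.endNumber] ++
  (List.ofFn fun b : Fin I.n =>
    (List.ofFn fun i : Fin I.h => encodeColor I.m (I.content b i)).flatten ++
      [Sym.endBin]).flatten

/-- A sequence of bins, written as the sequence of their indices in unary. -/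
def Puzzle.encodeOrder (I : Puzzle) (bs : List I.Bin) : List Bool :=
  (bs.map fun b => List.replicate (I.binIndex b) true ++ [false]).flatten

/-- The ball sort puzzle as a language. -/
def BSP : Language Sym := {x | ∃ I : Puzzle, x = I.encode ∧ I.BallSolvable}

/-- The water sort puzzle as a language. -/
def WSP : Language Sym := {x | ∃ I : Puzzle, x = I.encode ∧ I.WaterSolvable}

/-- `x` encodes an instance with balanced colors, and `y` encodes an order in which the borders of
its initial configuration can be removed. -/
def OrderCertificate (x : List Sym) (y : List Bool) : Prop :=
  ∃ (I : Puzzle) (bs : List I.Bin),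
    x = I.encode ∧ y = I.encodeOrder bs ∧ I.Balanced ∧ IsRemovalOrder I.init bs

/-! ### The class NP, over Turing machines -/

/-- The input word for the pair of words `x`, `y`. -/
def pairWord {Γ Δ : Type} (p : List Γ × List Δ) : List (Γ ⊕ Δ) :=
  p.1.map Sum.inl ++ p.2.map Sum.inr

open Classical in
/-- The relation `R` between words is decided by a Turing machine in polynomial time. -/
def PolyTimeRelation {Γ Δ : Type} (R : List Γ → List Δ → Prop) : Prop :=
  Nonempty (Turing.TM2ComputableInPolyTime (pairWord (Γ := Γ) (Δ := Δ)) Computability.encodeBool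
    (fun p => decide (R p.1 p.2)))

/-- `R` is a polynomial-time verifier for `L`, with certificates of polynomial length. -/
def IsNPVerifier {Γ Δ : Type} (R : List Γ → List Δ → Prop) (L : Language Γ) : Prop :=
  PolyTimeRelation R ∧
  ∃ p : Polynomial ℕ, ∀ x : List Γ, x ∈ L ↔ ∃ y : List Δ, y.length ≤ p.eval x.length ∧ R x y

/-- The language `L` belongs to NP. -/
def InNP {Γ : Type} (L : Language Γ) : Prop :=
  ∃ R : List Γ → List Bool → Prop, IsNPVerifier R L

/-! ### Random access machines -/

/-- Instructions of a random access machine with memory cells containing natural numbers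
(`[a]` is the content of cell `a`). -/
inductive Instr : Type
  /-- `[d] := v` -/
  | const (d v : ℕ)
  /-- `[d] := [a] + [b]` -/
  | add (d a b : ℕ)
  /-- `[d] := max {0, [a] - [b]}` -/
  | sub (d a b : ℕ)
  /-- `[d] := [a] * [b]` -/
  | mul (d a b : ℕ)
  /-- `[d] := ⌊[a] / [b]⌋` -/
  | div (d a b : ℕ)
  /-- `[d] := [[a]]` -/
  | load (d a : ℕ)
  /-- `[[a]] := [s]` -/
  | store (a s : ℕ)
  /-- go to instruction `t` if `[a] > 0` -/
  | jump (a t : ℕ)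

/-- A state: the number of the next instruction, and the memory. -/
structure RamState where
  pc : ℕ
  mem : ℕ → ℕ

/-- The execution of one instruction. -/
def Instr.exec (s : RamState) : Instr → RamState
  | const d v => ⟨s.pc + 1, Function.update s.mem d v⟩
  | add d a b => ⟨s.pc + 1, Function.update s.mem d (s.mem a + s.mem b)⟩
  | sub d a b => ⟨s.pc + 1, Function.update s.mem d (s.mem a - s.mem b)⟩
  | mul d a b => ⟨s.pc + 1, Function.update s.mem d (s.mem a * s.mem b)⟩
  | div d a b => ⟨s.pc + 1, Function.update s.mem d (s.mem a / s.mem b)⟩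
  | load d a => ⟨s.pc + 1, Function.update s.mem d (s.mem (s.mem a))⟩
  | store a t => ⟨s.pc + 1, Function.update s.mem (s.mem a) (s.mem t)⟩
  | jump a t => ⟨if 0 < s.mem a then t else s.pc + 1, s.mem⟩

/-- One step of a program; the machine has halted when there is no instruction with the current
number. -/
def ramStep (P : List Instr) (s : RamState) : RamState :=
  match P[s.pc]? with
  | none => s
  | some i => i.exec s

/-- Started at its first instruction on the memory `M`, the program halts after at most `t` steps
and leaves the memory `M'`. -/
def HaltsWithin (P : List Instr) (t : ℕ) (M M' : ℕ → ℕ) : Prop :=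
  ∃ pc : ℕ, P[pc]? = none ∧ (ramStep P)^[t] ⟨0, M⟩ = ⟨pc, M'⟩

/-- The memory `M` holds the data that are kept for the top-border table `τ` of an instance: the
parameters, the table, the counts `F_c` and `G_c`, the totals of the `M_c` and of the monochrome
bins, and, precomputed from the initial configuration, the color just above each position of each
full bin and the next border below it. The cells with numbers below 32 are working space, and
nothing is assumed about the cells that are not mentioned. -/
structure Represents (I : Puzzle) (τ : I.Bin → ℕ) (M : ℕ → ℕ) : Prop where
  capacity : M 32 = I.h
  fullBins : M 33 = I.n
  colors : M 34 = I.m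
  totalM : (M 35 : ℤ) = ∑ c, countM I.init τ c
  totalMono : M 36 = (monoBins τ).card
  table : ∀ b : Fin I.n, M (40 + b) = τ (Sum.inl b)
  tableF : ∀ c : Fin I.m, M (40 + I.n + c) = countF I.init τ c
  tableG : ∀ c : Fin I.m, M (40 + I.n + I.m + c) = countG I.init τ c
  colorAbove : ∀ (b : Fin I.n) (i : Fin I.h),
    M (40 + I.n + 2 * I.m + (b * I.h + i)) = I.content b i
  borderBelow : ∀ (b : Fin I.n) (i : Fin I.h),
    M (40 + I.n + 2 * I.m + I.n * I.h + (b * I.h + i)) = prevBorder (I.init (Sum.inl b)).1 i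

/-- The program `P` checks and performs every transition of top-border tables in at most `t`
steps: started with the data for a table `τ` (whose entries are borders) and with the index of a
bin `b` in cell 0, it halts with answer 1 in cell 0 and the data for the new table if the top
border of `b` can be removed, and with answer 0 otherwise. -/
def ChecksTransitions (P : List Instr) (t : ℕ) : Prop :=
  ∀ (I : Puzzle) (τ : I.Bin → ℕ) (b : I.Bin) (M : ℕ → ℕ),
    (∀ a, τ a ∈ borders (I.init a).1) → Represents I τ M → M 0 = I.binIndex b →
    ∃ M' : ℕ → ℕ, HaltsWithin P t M M' ∧
      (∀ τ', TableMove I.init b τ τ' → M' 0 = 1 ∧ Represents I τ' M') ∧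
      ((¬ ∃ τ', TableMove I.init b τ τ') → M' 0 = 0)

end SortPuzzle

/-!
A configuration that is reached from `S₀` is described by a table `τ` of borders: below `τ b` the
bin `b` still is as in `S₀`, and above `τ b` it is monochrome, in the color that `S₀` has there
(`Fits`, `Compat`). A ball-move either keeps the table or empties one bin `b` down to its border,
which then ceases to be one. At this moment all units counted by `F_c(τ)` lie above the borders of
the bins of `B_c(τ) \ {b}` or in monochrome bins, and no monochrome bin holds two colors; this is
the inequality `∑ M_c^b(τ) ≤ |B_ε(τ)|` (`Compat.ballMove`). Hence a solution yields a removal order.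

Conversely, a legal transition of tables is realized by water-moves (`Compat.exists_waterMoves`).
The bins get weights, and units are poured from heavier to lighter bins as long as possible: `b` is
the heaviest, the monochrome bins have distinct weights, and the other bins with a border have
weight zero. In the final configuration, if `b` still had a unit above its border, then no
monochrome bin would be empty, and for each color all bins but the heaviest one would be filled, so
that the nonempty monochrome bins and `b` together would number at most `∑ M_c^b(τ)`, which is too
few. When all borders are gone, the same process sorts the units (`Fits.exists_sorted`). Water-moves
are sequences of ball-moves, so that both puzzles are equivalent to the existence of a removal order.

A transition changes the counts for two colors only, that above and that below the removed border.
The program `transitionProgram` therefore is a straight line but for the jumps to and from the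
rejecting instructions, and it is verified segment by segment.

For the membership in NP, polynomial time is obtained from a small language of terms with truncated
subtraction and bounded sums over positions of the input word (`WordTerm`). The value of a term and
the time for its evaluation in unary are bounded by polynomials, and terms are compiled to programs
over counters, which a Turing machine with several stacks executes (`WordTerm.polyTimeRelation`). The
conditions on a certificate are then written as such a term (`Layout`, `arithPred_exists_layout`). The
numbers that determine where the units stand in the input word are guessed, which is possible since
they are bounded by its length. Two units have the same color if their digits agree; a color is
represented by its first unit; the table before a transition is found by counting how often each bin
occurs among the earlier entries, since the removals in one bin proceed from top to bottom. The
number `k` of empty bins may be exponentially large; but it is only compared with numbers that are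
bounded by a polynomial, and so it suffices to evaluate its digits of small weight and to know
whether there is a nonzero digit of large weight. These conditions are equivalent to those of
`OrderCertificate` (`Puzzle.isOrder_iff`, `Puzzle.isBalanced_iff`), and the certificates are short
because a removal order has at most `n h` entries, all of which are indices of full bins.
-/

set_option linter.unusedSectionVars false
set_option linter.unusedSimpArgs false

namespace SortPuzzle

/-! ### Borders of a sequence -/

section Borders

variable {C : Type} [DecidableEq C]

theorem mem_borders {α : List C} {i : ℕ} :
    i ∈ borders α ↔ i = 0 ∨ (1 ≤ i ∧ i < α.length ∧ α[i - 1]? ≠ α[i]?) := by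
  simp only [borders, Finset.mem_insert, Finset.mem_filter, Finset.mem_range]
  tauto

theorem zero_mem_borders (α : List C) : 0 ∈ borders α := mem_borders.2 (Or.inl rfl)

theorem le_length_of_mem_borders {α : List C} {i : ℕ} (hi : i ∈ borders α) : i ≤ α.length := by
  rcases mem_borders.1 hi with h | h <;> omega

theorem lt_length_of_mem_borders {α : List C} {i : ℕ} (hi : i ∈ borders α) (h0 : i ≠ 0) :
    i < α.length := by
  rcases mem_borders.1 hi with h | h <;> omega

theorem getElem?_ne_of_mem_borders {α : List C} {i : ℕ} (hi : i ∈ borders α) (h0 : i ≠ 0) :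
    α[i - 1]? ≠ α[i]? := by
  rcases mem_borders.1 hi with h | h
  · exact absurd h h0
  · exact h.2.2

theorem sup_id_mem {s : Finset ℕ} (hs : s.Nonempty) : s.sup id ∈ s := by
  obtain ⟨i, hi, h⟩ := Finset.exists_mem_eq_sup s hs id
  rw [h]; exact hi

theorem prevBorder_mem_filter {α : List C} {i : ℕ} (hi : 0 < i) :
    prevBorder α i ∈ (borders α).filter (· < i) :=
  sup_id_mem ⟨0, by simp [zero_mem_borders, hi]⟩

theorem prevBorder_mem {α : List C} {i : ℕ} (hi : 0 < i) : prevBorder α i ∈ borders α :=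
  (Finset.mem_filter.1 (prevBorder_mem_filter hi)).1

theorem prevBorder_lt {α : List C} {i : ℕ} (hi : 0 < i) : prevBorder α i < i :=
  (Finset.mem_filter.1 (prevBorder_mem_filter hi)).2

theorem le_prevBorder {α : List C} {i j : ℕ} (hj : j ∈ borders α) (hji : j < i) :
    j ≤ prevBorder α i :=
  Finset.le_sup (f := id) (Finset.mem_filter.2 ⟨hj, hji⟩)

/-- Between two consecutive borders a sequence is constant. -/
theorem getElem?_eq_of_no_border {α : List C} {t s : ℕ} (hs : s ≤ α.length)
    (hno : ∀ j ∈ borders α, j < s → j ≤ t) {i : ℕ} (hti : t ≤ i) (his : i < s) :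
    α[i]? = α[t]? := by
  induction i, hti using Nat.le_induction with
  | base => rfl
  | succ i hti ih =>
    rw [← ih (by omega)]
    by_contra hne
    have := hno (i + 1) (mem_borders.2 (Or.inr ⟨by omega, by omega, by simpa using Ne.symm hne⟩)) his
    omega

/-- The number of positive borders up to `t`. -/
def bordersUpTo (α : List C) (t : ℕ) : ℕ := ((borders α).filter fun i => 0 < i ∧ i ≤ t).card

theorem bordersUpTo_prevBorder {α : List C} {t : ℕ} (ht : t ∈ borders α) (h0 : 0 < t) :
    bordersUpTo α t = bordersUpTo α (prevBorder α t) + 1 := by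
  unfold bordersUpTo
  have : ((borders α).filter fun i => 0 < i ∧ i ≤ t) =
      insert t ((borders α).filter fun i => 0 < i ∧ i ≤ prevBorder α t) := by
    ext i
    simp only [Finset.mem_filter, Finset.mem_insert]
    have h1 := prevBorder_lt (α := α) h0
    constructor
    · rintro ⟨hi, hi0, hit⟩
      rcases hit.eq_or_lt with rfl | hlt
      · exact Or.inl rfl
      · exact Or.inr ⟨hi, hi0, le_prevBorder hi hlt⟩
    · rintro (rfl | ⟨hi, hi0, hit⟩)
      · exact ⟨ht, h0, le_rfl⟩
      · exact ⟨hi, hi0, by omega⟩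
  rw [this, Finset.card_insert_of_notMem]
  simp only [Finset.mem_filter, not_and, not_le]
  intro _ _
  exact prevBorder_lt h0

theorem bordersUpTo_top (α : List C) :
    bordersUpTo α ((borders α).sup id) = ((borders α).erase 0).card := by
  unfold bordersUpTo
  congr 1
  ext i
  simp only [Finset.mem_filter, Finset.mem_erase]
  constructor
  · rintro ⟨h, h', _⟩; exact ⟨by omega, h⟩
  · rintro ⟨h, h'⟩; exact ⟨h', by omega, Finset.le_sup (f := id) h'⟩

theorem bordersUpTo_zero (α : List C) : bordersUpTo α 0 = 0 := by
  unfold bordersUpTo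
  rw [Finset.card_eq_zero, Finset.filter_eq_empty_iff]
  intro i _; omega

theorem bordersUpTo_pos {α : List C} {t : ℕ} (ht : t ∈ borders α) (h0 : 0 < t) :
    0 < bordersUpTo α t := by
  rw [bordersUpTo_prevBorder ht h0]; omega

/-- Counting occurrences by positions. -/
theorem card_filter_Ioc_eq_count_drop {α : List C} {h : ℕ} (hα : α.length ≤ h) (c : C) (t : ℕ) :
    ((Finset.Ioc t h).filter fun i => α[i - 1]? = some c).card = (α.drop t).count c := by
  rcases le_or_gt h t with ht | ht
  · rw [Finset.Ioc_eq_empty (by omega), List.drop_eq_nil_of_le (by omega)]; simp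
  · induction hk : h - t generalizing t with
    | zero => omega
    | succ k ih =>
      rw [← Finset.insert_Ioc_succ_left_eq_Ioc ht, Finset.filter_insert]
      have ih' : ((Finset.Ioc (t + 1) h).filter fun i => α[i - 1]? = some c).card =
          (α.drop (t + 1)).count c := by
        rcases le_or_gt h (t + 1) with h1 | h1
        · rw [Finset.Ioc_eq_empty (by omega), List.drop_eq_nil_of_le (by omega)]; simp
        · exact ih (t + 1) h1 (by omega)
      rcases lt_or_ge t α.length with hl | hl
      · rw [List.drop_eq_getElem_cons hl, List.count_cons]
        have e : α[t + 1 - 1]? = some α[t] := by simp [hl]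
        simp only [Order.succ_eq_add_one] at *
        rw [e]
        by_cases hc : α[t] = c
        · rw [if_pos (by rw [hc]), Finset.card_insert_of_notMem (by simp), ih']; simp [hc]
        · rw [if_neg (by simpa using hc), ih']; simp [hc]
      · have e : α[t + 1 - 1]? = none := by simp [hl]
        simp only [Order.succ_eq_add_one] at *
        rw [e, if_neg (by simp), ih', List.drop_eq_nil_of_le hl, List.drop_eq_nil_of_le (by omega)]

end Borders

/-! ### Configurations that respect a table of borders -/

section Core

variable {B C : Type} [Fintype B] [DecidableEq B] [Fintype C] [DecidableEq C] {h : ℕ}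

/-- The units of the bin `b` above the level `τ b`. -/
def upper (S : Config B C h) (τ : B → ℕ) (b : B) : List C := (S b).1.drop (τ b)

/-- `S` arises from `S₀` by a redistribution of units in which the units up to the borders `τ`
stay in place; above its border every bin is monochrome, in the color of `S₀`. -/
structure Fits (S₀ S : Config B C h) (τ : B → ℕ) : Prop where
  border : ∀ b, τ b ∈ borders (S₀ b).1
  low : ∀ b, (S b).1.take (τ b) = (S₀ b).1.take (τ b)
  mono : ∀ b, ∀ x ∈ upper S τ b, ∀ y ∈ upper S τ b, x = y
  color : ∀ b, τ b ≠ 0 → ∀ x ∈ upper S τ b, (S₀ b).1[τ b]? = some x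
  count : ∀ c, ∑ b, (S b).1.count c = ∑ b, (S₀ b).1.count c

variable {S₀ S S' : Config B C h} {τ τ' : B → ℕ}

theorem length_upper (S : Config B C h) (τ : B → ℕ) (b : B) :
    (upper S τ b).length = (S b).1.length - τ b := by simp [upper]

theorem length_upper_le (S : Config B C h) (τ : B → ℕ) (b : B) :
    (upper S τ b).length ≤ h - τ b := by
  rw [length_upper]; have := (S b).2; omega

namespace Fits

theorem le_length (hS : Fits S₀ S τ) (b : B) : τ b ≤ (S b).1.length := by
  have h1 := congrArg List.length (hS.low b)
  have h2 := le_length_of_mem_borders (hS.border b)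
  simp only [List.length_take] at h1
  omega

theorem take_append_upper (_ : Fits S₀ S τ) (b : B) :
    (S b).1 = (S b).1.take (τ b) ++ upper S τ b := (List.take_append_drop _ _).symm

theorem upper_eq_replicate (hS : Fits S₀ S τ) {b : B} {c : C} (hc : c ∈ upper S τ b) :
    upper S τ b = List.replicate (upper S τ b).length c :=
  List.eq_replicate_of_mem fun _ hx => hS.mono b _ hx _ hc

theorem count_upper (hS : Fits S₀ S τ) {b : B} {c : C} (hc : c ∈ upper S τ b) :
    (upper S τ b).count c = (upper S τ b).length := by
  conv_lhs => rw [hS.upper_eq_replicate hc]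
  simp

/-- The numbers `F_c(τ)` can be read off from every configuration that respects `τ`. -/
theorem countF_eq (hS : Fits S₀ S τ) (c : C) :
    countF S₀ τ c = ∑ b, (upper S τ b).count c := by
  have h1 : countF S₀ τ c = ∑ b, ((S₀ b).1.drop (τ b)).count c :=
    Finset.sum_congr rfl fun b _ => card_filter_Ioc_eq_count_drop (S₀ b).2 c (τ b)
  have h2 := hS.count c
  have e : ∀ T : Config B C h, ∑ b, (T b).1.count c =
      ∑ b, ((T b).1.take (τ b)).count c + ∑ b, ((T b).1.drop (τ b)).count c := by
    intro T
    rw [← Finset.sum_add_distrib]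
    refine Finset.sum_congr rfl fun b _ => ?_
    rw [← List.count_append, List.take_append_drop]
  rw [e S, e S₀] at h2
  have h3 : ∑ b, ((S b).1.take (τ b)).count c = ∑ b, ((S₀ b).1.take (τ b)).count c :=
    Finset.sum_congr rfl fun b _ => by rw [hS.low b]
  rw [h1]
  simp only [upper]
  omega

/-- Moving units of one color, all of them from above the border of `b₁`. -/
theorem move (hS : Fits S₀ S τ) {m : ℕ} {b₁ b₂ : B} {c : C} (hne : b₁ ≠ b₂)
    (h1 : (S b₁).1 = (S' b₁).1 ++ List.replicate m c)
    (h2 : (S' b₂).1 = (S b₂).1 ++ List.replicate m c)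
    (hlow : τ b₁ ≤ (S' b₁).1.length) (htgt : (S b₂).1 = [] ∨ c ∈ upper S τ b₂)
    (hrest : ∀ b, b ≠ b₁ → b ≠ b₂ → S b = S' b) : Fits S₀ S' τ := by
  have hl2 := hS.le_length b₂
  have hu1 : upper S τ b₁ = upper S' τ b₁ ++ List.replicate m c := by
    unfold upper; rw [h1, List.drop_append_of_le_length hlow]
  have hu2 : upper S' τ b₂ = upper S τ b₂ ++ List.replicate m c := by
    unfold upper; rw [h2, List.drop_append_of_le_length hl2]
  have hup : ∀ b, b ≠ b₁ → b ≠ b₂ → upper S' τ b = upper S τ b := by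
    intro b hb1 hb2; unfold upper; rw [hrest b hb1 hb2]
  have hmem2 : ∀ x ∈ upper S' τ b₂, (S b₂).1 = [] ∧ x = c ∨ c ∈ upper S τ b₂ ∧ x = c := by
    intro x hx
    rw [hu2, List.mem_append] at hx
    rcases htgt with he | hc
    · refine Or.inl ⟨he, ?_⟩
      rcases hx with hx | hx
      · simp [upper, he] at hx
      · exact List.eq_of_mem_replicate hx
    · refine Or.inr ⟨hc, ?_⟩
      rcases hx with hx | hx
      · exact hS.mono b₂ _ hx _ hc
      · exact List.eq_of_mem_replicate hx
  refine ⟨hS.border, fun b => ?_, fun b => ?_, fun b hb => ?_, fun c' => ?_⟩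
  · by_cases hb1 : b = b₁
    · subst hb1
      rw [← hS.low b, h1, List.take_append_of_le_length hlow]
    by_cases hb2 : b = b₂
    · subst hb2
      rw [h2, List.take_append_of_le_length hl2, hS.low]
    rw [← hrest b hb1 hb2, hS.low]
  · by_cases hb1 : b = b₁
    · subst hb1
      intro x hx y hy
      exact hS.mono b x (by rw [hu1]; simp [hx]) y (by rw [hu1]; simp [hy])
    by_cases hb2 : b = b₂
    · subst hb2
      intro x hx y hy
      rcases hmem2 x hx with h | h <;> rcases hmem2 y hy with h' | h' <;> rw [h.2, h'.2]
    rw [hup b hb1 hb2]; exact hS.mono b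
  · by_cases hb1 : b = b₁
    · subst hb1
      intro x hx
      exact hS.color b hb x (by rw [hu1]; simp [hx])
    by_cases hb2 : b = b₂
    · subst hb2
      intro x hx
      rcases hmem2 x hx with ⟨h, rfl⟩ | ⟨h, rfl⟩
      · rw [h] at hl2; simp at hl2; omega
      · exact hS.color b hb x h
    rw [hup b hb1 hb2]; exact hS.color b hb
  · rw [← hS.count c']
    have key : ∀ b, (S' b).1.count c' + (if b = b₁ then (List.replicate m c).count c' else 0) =
        (S b).1.count c' + (if b = b₂ then (List.replicate m c).count c' else 0) := by
      intro b
      by_cases hb1 : b = b₁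
      · subst hb1; rw [h1, List.count_append, if_pos rfl, if_neg hne]; rfl
      by_cases hb2 : b = b₂
      · subst hb2; rw [h2, List.count_append, if_neg hb1, if_pos rfl]; rfl
      rw [hrest b hb1 hb2, if_neg hb1, if_neg hb2]
    have := Finset.sum_congr (rfl : (Finset.univ : Finset B) = _) fun b _ => key b
    simpa [Finset.sum_add_distrib] using this

/-- When a bin has been emptied down to its border, the border can be forgotten. -/
theorem tableMove (hS : Fits S₀ S τ) {b : B} (h0 : 0 < τ b) (hb : (S b).1.length = τ b)
    (heq : ∀ a, a ≠ b → τ a = τ' a) (hb' : τ' b = prevBorder (S₀ b).1 (τ b)) :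
    Fits S₀ S τ' ∧ τ' b < (S b).1.length := by
  have hlt : τ' b < τ b := by rw [hb']; exact prevBorder_lt h0
  have hSb : (S b).1 = (S₀ b).1.take (τ b) := by
    rw [← hS.low b, List.take_of_length_le hb.le]
  have hconst : ∀ x ∈ upper S τ' b, (S₀ b).1[τ' b]? = some x := by
    intro x hx
    obtain ⟨i, hi⟩ := List.mem_iff_getElem?.1 hx
    rw [upper, List.getElem?_drop, hSb, List.getElem?_take] at hi
    split_ifs at hi with hlt'
    rw [← hi]
    refine (getElem?_eq_of_no_border (s := τ b) (le_length_of_mem_borders (hS.border b)) ?_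
      (by omega) hlt').symm
    intro j hj hjl
    rw [hb']; exact le_prevBorder hj hjl
  refine ⟨⟨fun a => ?_, fun a => ?_, fun a => ?_, fun a ha => ?_, hS.count⟩, by omega⟩
  · by_cases hab : a = b
    · subst hab; rw [hb']; exact prevBorder_mem h0
    · rw [← heq a hab]; exact hS.border a
  · by_cases hab : a = b
    · subst hab
      rw [hSb, List.take_take, min_eq_left hlt.le]
    · rw [← heq a hab]; exact hS.low a
  · by_cases hab : a = b
    · subst hab
      intro x hx y hy
      exact Option.some_injective _ ((hconst x hx).symm.trans (hconst y hy))
    · have : upper S τ' a = upper S τ a := by unfold upper; rw [heq a hab]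
      rw [this]; exact hS.mono a
  · by_cases hab : a = b
    · subst hab; exact hconst
    · have : upper S τ' a = upper S τ a := by unfold upper; rw [heq a hab]
      rw [this, ← heq a hab]; exact hS.color a (by rw [heq a hab]; exact ha)

end Fits

/-- `S` respects `τ`, and each positive border of `τ` is really present in `S`. -/
structure Compat (S₀ S : Config B C h) (τ : B → ℕ) : Prop extends Fits S₀ S τ where
  top : ∀ b, τ b ≠ 0 → τ b < (S b).1.length

theorem compat_topBorder (S₀ : Config B C h) : Compat S₀ S₀ (topBorder S₀) := by
  have hmem : ∀ b, topBorder S₀ b ∈ borders (S₀ b).1 := fun b => sup_id_mem ⟨0, zero_mem_borders _⟩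
  have hconst : ∀ b, ∀ x ∈ upper S₀ (topBorder S₀) b, (S₀ b).1[topBorder S₀ b]? = some x := by
    intro b x hx
    obtain ⟨i, hi⟩ := List.mem_iff_getElem?.1 hx
    rw [upper, List.getElem?_drop] at hi
    rw [← hi]
    obtain ⟨hlt, _⟩ := List.getElem?_eq_some_iff.1 hi
    exact (getElem?_eq_of_no_border (s := (S₀ b).1.length) le_rfl
      (fun j hj _ => Finset.le_sup (f := id) hj) (Nat.le_add_right _ _) hlt).symm
  exact ⟨⟨hmem, fun _ => rfl,
    fun b x hx y hy => Option.some_injective _ ((hconst b x hx).symm.trans (hconst b y hy)),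
    fun b _ => hconst b, fun _ => rfl⟩, fun b hb => lt_length_of_mem_borders (hmem b) hb⟩

/-! ### Necessity of a removal order -/

theorem colorBins_iff {c : C} {a : B} :
    a ∈ colorBins S₀ τ c ↔ τ a ≠ 0 ∧ (S₀ a).1[τ a]? = some c := by
  simp [colorBins]

/-- When the bin `b` has been emptied down to its border, the remaining units witness the
inequality that allows to remove this border. -/
theorem Fits.sum_countMWithout_le (hS : Fits S₀ S τ) {b : B} (hb : upper S τ b = []) :
    ∑ c, countMWithout S₀ τ b c ≤ ((monoBins τ).card : ℤ) := by
  classical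
  let X : C → Finset B := fun c => (monoBins τ).filter fun a => c ∈ upper S τ a
  have hM : ∀ c, countMWithout S₀ τ b c ≤ ((X c).card : ℤ) := by
    intro c
    refine max_le (by positivity) (Int.ceil_le.2 ?_)
    have hF : countF S₀ τ c ≤ countGWithout S₀ τ b c + h * (X c).card := by
      rw [hS.countF_eq]
      have hle : ∀ a, (upper S τ a).count c ≤
          (if a ∈ (colorBins S₀ τ c).erase b then h - τ a else 0) + (if a ∈ X c then h else 0) := by
        intro a
        by_cases hc : c ∈ upper S τ a
        · have hcnt : (upper S τ a).count c ≤ h - τ a :=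
            List.count_le_length.trans (length_upper_le S τ a)
          by_cases h0 : τ a = 0
          · have : a ∈ X c := Finset.mem_filter.2 ⟨by simp [monoBins, h0], hc⟩
            rw [if_pos this]; omega
          · have : a ∈ (colorBins S₀ τ c).erase b := by
              refine Finset.mem_erase.2 ⟨?_, colorBins_iff.2 ⟨h0, hS.color a h0 c hc⟩⟩
              rintro rfl
              simp [hb] at hc
            rw [if_pos this]; omega
        · rw [List.count_eq_zero_of_not_mem hc]; omega
      refine (Finset.sum_le_sum fun a _ => hle a).trans ?_
      rw [Finset.sum_add_distrib, countGWithout, Finset.sum_ite_mem, Finset.sum_ite_mem,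
        Finset.univ_inter, Finset.univ_inter, Finset.sum_const, smul_eq_mul, Nat.mul_comm h]
    rcases Nat.eq_zero_or_pos h with rfl | hpos
    · simp
    · rw [div_le_iff₀ (by exact_mod_cast hpos)]
      have : (countF S₀ τ c : ℚ) ≤ countGWithout S₀ τ b c + h * (X c).card := by exact_mod_cast hF
      push_cast
      linarith
  refine (Finset.sum_le_sum fun c _ => hM c).trans ?_
  have hdisj : ∑ c, (X c).card = (Finset.univ.biUnion X).card := by
    refine (Finset.card_biUnion fun c _ c' _ hcc' => ?_).symm
    refine Finset.disjoint_left.2 fun a ha ha' => ?_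
    exact hcc' (hS.mono a _ (Finset.mem_filter.1 ha).2 _ (Finset.mem_filter.1 ha').2)
  have hsub : (Finset.univ.biUnion X).card ≤ (monoBins τ).card :=
    Finset.card_le_card (Finset.biUnion_subset.2 fun c _ => Finset.filter_subset _ _)
  exact_mod_cast hdisj.le.trans hsub

theorem mem_upper_of_getLast? {b : B} {c : C} (hlt : τ b < (S b).1.length)
    (hlast : (S b).1.getLast? = some c) : c ∈ upper S τ b := by
  have : (upper S τ b).getLast? = some c := by
    rw [upper, List.getLast?_drop, if_neg (by omega), hlast]
  exact List.mem_of_getLast? this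

/-- A ball-move preserves the borders, or it removes one of them by a legal transition. -/
theorem Compat.ballMove (hS : Compat S₀ S τ) (hmove : BallMove S S') :
    Compat S₀ S' τ ∨ ∃ b τ', TableMove S₀ b τ τ' ∧ Compat S₀ S' τ' := by
  obtain ⟨b₁, b₂, c, h1, h2, h3, hrest⟩ := hmove
  have hne : b₁ ≠ b₂ := by
    rintro rfl
    have e1 := congrArg List.length h1
    have e2 := congrArg List.length h3
    simp at e1 e2; omega
  have hl1 : (S b₁).1.length = (S' b₁).1.length + 1 := by rw [h1]; simp
  have hl2 : (S' b₂).1.length = (S b₂).1.length + 1 := by rw [h3]; simp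
  have htgt : (S b₂).1 = [] ∨ c ∈ upper S τ b₂ := by
    rcases h2 with h | h
    · exact Or.inl h
    · refine Or.inr (mem_upper_of_getLast? ?_ h)
      by_cases h0 : τ b₂ = 0
      · rw [h0]; refine List.length_pos_iff.2 ?_; rintro he; simp [he] at h
      · exact hS.top _ h0
  have hle : τ b₁ ≤ (S' b₁).1.length := by
    by_cases h0 : τ b₁ = 0
    · omega
    · have := hS.top _ h0; omega
  have hfit : Fits S₀ S' τ :=
    hS.toFits.move (m := 1) hne (by simpa using h1) (by simpa using h3) hle htgt hrest
  have htop : ∀ a, a ≠ b₁ → τ a ≠ 0 → τ a < (S' a).1.length := by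
    intro a ha h0
    have := hS.top a h0
    by_cases ha2 : a = b₂
    · subst ha2; omega
    · rw [← hrest a ha ha2]; exact this
  by_cases hcase : τ b₁ ≠ 0 ∧ (S' b₁).1.length = τ b₁
  · right
    let τ' := Function.update τ b₁ (prevBorder (S₀ b₁).1 (τ b₁))
    have hτ' : ∀ a, a ≠ b₁ → τ a = τ' a := fun a ha => by simp [τ', ha]
    have hb' : τ' b₁ = prevBorder (S₀ b₁).1 (τ b₁) := by simp [τ']
    obtain ⟨hf, hlt⟩ := hfit.tableMove (Nat.pos_of_ne_zero hcase.1) hcase.2 hτ' hb'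
    refine ⟨b₁, τ', ⟨hτ', Nat.pos_of_ne_zero hcase.1, hb', hfit.sum_countMWithout_le ?_⟩, hf, ?_⟩
    · rw [upper, List.drop_eq_nil_of_le hcase.2.le]
    · intro a ha
      by_cases hab : a = b₁
      · subst hab; exact hlt
      · rw [← hτ' a hab] at ha ⊢; exact htop a hab ha
  · left
    refine ⟨hfit, fun a ha => ?_⟩
    by_cases hab : a = b₁
    · subst hab
      have : (S' a).1.length ≠ τ a := fun h => hcase ⟨ha, h⟩
      omega
    · exact htop a hab ha

/-- In a goal configuration no positive border is left. -/
theorem Compat.eq_zero_of_sorted (hS : Compat S₀ S τ) (hsort : Sorted S) (b : B) : τ b = 0 := by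
  by_contra h0
  have hlt := hS.top b h0
  have hborder := getElem?_ne_of_mem_borders (hS.border b) h0
  have hlow : (S b).1[τ b - 1]? = (S₀ b).1[τ b - 1]? := by
    have := congrArg (fun l => l[τ b - 1]?) (hS.low b)
    simpa [List.getElem?_take, show τ b - 1 < τ b by omega] using this
  have hup : (S₀ b).1[τ b]? = (S b).1[τ b]? := by
    have hx : (S b).1[τ b] ∈ upper S τ b :=
      List.mem_iff_getElem?.2 ⟨0, by simp [upper, hlt]⟩
    rw [hS.color b h0 _ hx]; simp [hlt]
  rw [← hlow, hup] at hborder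
  rcases hsort b with he | ⟨c, hc⟩
  · simp [he] at hlt
  · rw [hc] at hborder hlt
    simp only [List.length_replicate] at hlt
    exact hborder (by rw [List.getElem?_replicate, List.getElem?_replicate, if_pos hlt,
      if_pos (by omega)])

/-- The number of positive borders that a table has not yet removed. -/
def pending (S₀ : Config B C h) (τ : B → ℕ) : ℕ := ∑ b, bordersUpTo (S₀ b).1 (τ b)

theorem TableMove.pending {b : B} (hm : TableMove S₀ b τ τ') (hb : τ b ∈ borders (S₀ b).1) :
    pending S₀ τ = pending S₀ τ' + 1 := by
  have key : ∀ a, bordersUpTo (S₀ a).1 (τ a) =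
      bordersUpTo (S₀ a).1 (τ' a) + if a = b then 1 else 0 := by
    intro a
    by_cases hab : a = b
    · subst hab
      rw [if_pos rfl, hm.2.2.1]
      exact bordersUpTo_prevBorder hb hm.2.1
    · rw [if_neg hab, hm.1 a hab]; rfl
  unfold SortPuzzle.pending
  rw [Finset.sum_congr rfl fun a _ => key a, Finset.sum_add_distrib]
  simp

theorem pending_topBorder (S₀ : Config B C h) : pending S₀ (topBorder S₀) = borderCount S₀ :=
  Finset.sum_congr rfl fun b _ => bordersUpTo_top (S₀ b).1

/-- The borders that disappear in the course of ball-moves are removed by legal transitions. -/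
theorem exists_tableMoves_of_ballMoves {T : Config B C h}
    (hT : Relation.ReflTransGen BallMove S₀ T) :
    ∃ (bs : List B) (σ : ℕ → B → ℕ), σ 0 = topBorder S₀ ∧
      (∀ (i : ℕ) (hi : i < bs.length), TableMove S₀ bs[i] (σ i) (σ (i + 1))) ∧
      pending S₀ (topBorder S₀) = bs.length + pending S₀ (σ bs.length) ∧
      Compat S₀ T (σ bs.length) := by
  induction hT with
  | refl => exact ⟨[], fun _ => topBorder S₀, rfl, by simp, by simp, compat_topBorder S₀⟩
  | tail _ hm ih =>
    obtain ⟨bs, σ, h0, hmoves, hpend, hc⟩ := ih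
    rcases hc.ballMove hm with hc' | ⟨b, τ', hm', hc'⟩
    · exact ⟨bs, σ, h0, hmoves, hpend, hc'⟩
    · refine ⟨bs ++ [b], Function.update σ (bs.length + 1) τ', ?_, ?_, ?_, ?_⟩
      · rw [Function.update_of_ne (by omega), h0]
      · intro i hi
        simp only [List.length_append, List.length_singleton] at hi
        rw [Function.update_of_ne (by omega)]
        rcases Nat.lt_succ_iff_lt_or_eq.1 hi with hlt | rfl
        · rw [List.getElem_append_left hlt, Function.update_of_ne (by omega)]
          exact hmoves i hlt
        · simpa using hm'
      · rw [hpend, hm'.pending (hc.border b)]; simp; omega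
      · simpa using hc'

theorem exists_removalOrder_of_ballMoves {T : Config B C h}
    (hT : Relation.ReflTransGen BallMove S₀ T) (hsort : Sorted T) :
    ∃ bs : List B, IsRemovalOrder S₀ bs := by
  obtain ⟨bs, σ, h0, hmoves, hpend, hc⟩ := exists_tableMoves_of_ballMoves hT
  refine ⟨bs, ?_, σ, h0, hmoves⟩
  have : pending S₀ (σ bs.length) = 0 :=
    Finset.sum_eq_zero fun b _ => by rw [hc.eq_zero_of_sorted hsort b, bordersUpTo_zero]
  rw [← pending_topBorder]; omega

theorem count_eq_of_ballMoves {T : Config B C h}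
    (hT : Relation.ReflTransGen BallMove S₀ T) (c : C) :
    ∑ b, (S₀ b).1.count c = ∑ b, (T b).1.count c := by
  obtain ⟨bs, σ, -, -, -, hc⟩ := exists_tableMoves_of_ballMoves hT
  exact (hc.count c).symm

end Core

section Sufficiency

variable {B C : Type} [Fintype B] [DecidableEq B] [Fintype C] [DecidableEq C] {h : ℕ}
variable {S₀ S S' : Config B C h} {τ τ' : B → ℕ}

/-! ### Sufficiency of a removal order -/

/-- Pouring the units above the border of `b₁` onto `b₂`, as many as fit. -/
theorem Fits.exists_pour (hS : Fits S₀ S τ) {b₁ b₂ : B} {c : C} (hne : b₁ ≠ b₂)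
    (hc : c ∈ upper S τ b₁) (htgt : (S b₂).1 = [] ∨ c ∈ upper S τ b₂)
    (hroom : (S b₂).1.length < h) :
    ∃ (S' : Config B C h) (m : ℕ), 0 < m ∧ WaterMove S S' ∧ Fits S₀ S' τ ∧
      (S b₁).1.length = (S' b₁).1.length + m ∧ (S' b₂).1.length = (S b₂).1.length + m ∧
      ∀ b, b ≠ b₁ → b ≠ b₂ → S b = S' b := by
  set u := (upper S τ b₁).length with hu
  have hu0 : 0 < u := List.length_pos_of_mem hc
  set m := min u (h - (S b₂).1.length) with hm
  have hm0 : 0 < m := by omega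
  have hmu : m ≤ u := min_le_left _ _
  have hlow := hS.le_length b₁
  set A := (S b₁).1.take (τ b₁) with hA
  have hAlen : A.length = τ b₁ := by rw [hA, List.length_take]; omega
  have hSb1 : (S b₁).1 = A ++ List.replicate u c := by
    rw [hu, ← hS.upper_eq_replicate hc]; exact (List.take_append_drop _ _).symm
  have hlen1 : (S b₁).1.length = τ b₁ + u := by rw [hSb1, List.length_append, hAlen]; simp
  let S' : Config B C h := Function.update
    (Function.update S b₁ ⟨A ++ List.replicate (u - m) c, by
      have := (S b₁).2
      simp only [List.length_append, List.length_replicate]; omega⟩)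
    b₂ ⟨(S b₂).1 ++ List.replicate m c, by
      simp only [List.length_append, List.length_replicate]; omega⟩
  have e1 : (S' b₁).1 = A ++ List.replicate (u - m) c := by simp [S', hne]
  have e2 : (S' b₂).1 = (S b₂).1 ++ List.replicate m c := by simp [S']
  have e3 : ∀ b, b ≠ b₁ → b ≠ b₂ → S b = S' b := fun b hb1 hb2 => by simp [S', hb1, hb2]
  have h1 : (S b₁).1 = (S' b₁).1 ++ List.replicate m c := by
    rw [e1, hSb1, List.append_assoc, List.replicate_append_replicate, Nat.sub_add_cancel hmu]
  have hfit : Fits S₀ S' τ := hS.move hne h1 e2 (by rw [e1]; simp [hAlen]) htgt e3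
  refine ⟨S', m, hm0, ⟨m, b₁, b₂, c, hm0, h1, ?_, e2, ?_, e3⟩, hfit, ?_, ?_, e3⟩
  · refine htgt.imp_right fun hc2 => ?_
    have hS2 : (S b₂).1 = (S b₂).1.take (τ b₂) ++ List.replicate (upper S τ b₂).length c := by
      conv_lhs => rw [hS.take_append_upper b₂, hS.upper_eq_replicate hc2]
    have := List.length_pos_of_mem hc2
    rw [hS2, List.getLast?_append, List.getLast?_replicate, if_neg (by omega)]
    rfl
  · by_cases hum : u ≤ h - (S b₂).1.length
    · left
      have : m = u := by omega
      rw [e1, this, Nat.sub_self, List.replicate_zero, List.append_nil]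
      by_cases h0 : τ b₁ = 0
      · have : A = [] := List.length_eq_zero_iff.1 (by rw [hAlen, h0])
        simp [this]
      · -- the unit just below a border has another color
        intro hlast
        rw [hA, hS.low b₁, List.getLast?_take, if_neg h0] at hlast
        have hlt := lt_length_of_mem_borders (hS.border b₁) h0
        refine getElem?_ne_of_mem_borders (hS.border b₁) h0 ?_
        rw [hS.color b₁ h0 c hc, ← hlast]
        have : τ b₁ - 1 < (S₀ b₁).1.length := by omega
        simp [this]
    · right
      rw [e2]; simp only [List.length_append, List.length_replicate]; omega
  · rw [h1]; simp
  · rw [e2]; simp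

/-- As long as units are poured only from bins of larger weight into bins of smaller weight, the
process stops. When it has stopped, all possible targets are full. -/
theorem Fits.exists_stuck (hS : Fits S₀ S τ) (w : B → ℕ) :
    ∃ S' : Config B C h, Relation.ReflTransGen WaterMove S S' ∧ Fits S₀ S' τ ∧
      (∀ b, w b = 0 → (S b).1.length ≤ (S' b).1.length) ∧
      ∀ (b₁ b₂ : B) (c : C), w b₂ < w b₁ → c ∈ upper S' τ b₁ →
        ((S' b₂).1 = [] ∨ c ∈ upper S' τ b₂) → (S' b₂).1.length = h := by
  let P : Set (Config B C h) := {T | Relation.ReflTransGen WaterMove S T ∧ Fits S₀ T τ ∧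
    ∀ b, w b = 0 → (S b).1.length ≤ (T b).1.length}
  let Ψ : Config B C h → ℕ := fun T => ∑ b, w b * (T b).1.length
  obtain ⟨S', ⟨hreach, hfit, hzero⟩, hmin⟩ :=
    (measure Ψ).wf.has_min P ⟨S, Relation.ReflTransGen.refl, hS, fun _ _ => le_rfl⟩
  refine ⟨S', hreach, hfit, hzero, fun b₁ b₂ c hw hc htgt => ?_⟩
  by_contra hfull
  have hne : b₁ ≠ b₂ := by rintro rfl; omega
  obtain ⟨T, m, hm, hmove, hT, hl1, hl2, hrest⟩ :=
    hfit.exists_pour hne hc htgt (lt_of_le_of_ne (S' b₂).2 hfull)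
  refine hmin T ⟨hreach.tail hmove, hT, fun b hb => (hzero b hb).trans ?_⟩ ?_
  · by_cases hb1 : b = b₁
    · subst hb1; omega
    by_cases hb2 : b = b₂
    · subst hb2; omega
    rw [hrest b hb1 hb2]
  · change Ψ T < Ψ S'
    have key : ∀ b, w b * (T b).1.length + (if b = b₁ then w b₁ * m else 0) =
        w b * (S' b).1.length + (if b = b₂ then w b₂ * m else 0) := by
      intro b
      by_cases hb1 : b = b₁
      · subst hb1; rw [if_pos rfl, if_neg hne, hl1]; ring
      by_cases hb2 : b = b₂
      · subst hb2; rw [if_neg hb1, if_pos rfl, hl2]; ring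
      rw [if_neg hb1, if_neg hb2, hrest b hb1 hb2]
    have hsum := Finset.sum_congr (rfl : (Finset.univ : Finset B) = _) fun b _ => key b
    rw [Finset.sum_add_distrib, Finset.sum_add_distrib] at hsum
    simp only [Finset.sum_ite_eq', Finset.mem_univ, if_true] at hsum
    have : w b₂ * m < w b₁ * m := Nat.mul_lt_mul_of_pos_right hw hm
    change ∑ b, _ < ∑ b, _
    omega

/-- In a stuck configuration all bins of a color but the one of largest weight are full. -/
theorem le_sum_count_of_stuck {c : C} (hS : Fits S₀ S τ) {X : Finset B} {a : B}
    (hX : ∀ b ∈ X, c ∈ upper S τ b) (ha : a ∈ X)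
    (hfull : ∀ b ∈ X, b ≠ a → τ b = 0 ∧ (S b).1.length = h) :
    ∑ b ∈ X, (upper S τ b).count c = h * (X.card - 1) + (upper S τ a).length := by
  rw [← Finset.sum_erase_add X _ ha, hS.count_upper (hX a ha)]
  congr 1
  rw [Finset.sum_congr rfl (g := fun _ => h), Finset.sum_const, Finset.card_erase_of_mem ha,
    smul_eq_mul, mul_comm]
  intro b hb
  obtain ⟨hba, hbX⟩ := Finset.mem_erase.1 hb
  obtain ⟨h0, hl⟩ := hfull b hbX hba
  rw [hS.count_upper (hX b hbX), length_upper, h0, hl, Nat.sub_zero]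

/-- A legal transition of tables is realized by water-moves. -/
theorem Compat.exists_waterMoves (hS : Compat S₀ S τ) {b : B} (hm : TableMove S₀ b τ τ') :
    ∃ S' : Config B C h, Relation.ReflTransGen WaterMove S S' ∧ Compat S₀ S' τ' := by
  classical
  obtain ⟨heq, h0, hb', hsum⟩ := hm
  let idx : B → ℕ := fun a => Fintype.equivFin B a
  have hidx : ∀ a, idx a < Fintype.card B := fun a => (Fintype.equivFin B a).2
  have hinj : Function.Injective idx := fun a a' h =>
    (Fintype.equivFin B).injective (Fin.ext h)
  -- the bin `b` is poured into every other bin, a monochrome bin into those of smaller index and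
  -- into the bins with a border, and the latter are never poured out
  let w : B → ℕ := fun a => if a = b then Fintype.card B + 1 else if τ a = 0 then idx a + 1 else 0
  have hwb : w b = Fintype.card B + 1 := by simp [w]
  have hw_lt : ∀ a, a ≠ b → w a < w b := by
    intro a ha
    have := hidx a
    rw [hwb]; simp only [w, if_neg ha]; split_ifs <;> omega
  obtain ⟨S', hreach, hfit, hkeep, hstuck⟩ := hS.toFits.exists_stuck w
  have htop : ∀ a, a ≠ b → τ a ≠ 0 → τ a < (S' a).1.length := fun a ha h0 =>
    (hS.top a h0).trans_le (hkeep a (by simp [w, ha, h0]))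
  refine ⟨S', hreach, ?_⟩
  by_cases hempty : upper S' τ b = []
  · have hlen : (S' b).1.length = τ b := by
      have h1 := congrArg List.length hempty
      have h2 := hfit.le_length b
      rw [length_upper] at h1; simp at h1; omega
    obtain ⟨hf, hlt⟩ := hfit.tableMove h0 hlen heq hb'
    refine ⟨hf, fun a ha => ?_⟩
    by_cases hab : a = b
    · subst hab; exact hlt
    · rw [← heq a hab] at ha ⊢; exact htop a hab ha
  exfalso
  obtain ⟨c₀, hc₀⟩ := List.exists_mem_of_ne_nil _ hempty
  have hh : 0 < h := by have := (List.length_pos_of_mem hc₀).trans_le (length_upper_le S' τ b); omega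
  let X : C → Finset B := fun c =>
    Finset.univ.filter fun a => (τ a = 0 ∨ a = b) ∧ c ∈ upper S' τ a
  have hXmem : ∀ c a, a ∈ X c ↔ (τ a = 0 ∨ a = b) ∧ c ∈ upper S' τ a := by simp [X]
  have hwpos : ∀ c, ∀ a ∈ X c, 0 < w a := by
    intro c a ha
    simp only [w]
    split_ifs with h1 h2
    · omega
    · omega
    · rcases ((hXmem c a).1 ha).1 with h | h
      · exact absurd h h2
      · exact absurd h h1
  have hwinj : ∀ c, ∀ a ∈ X c, ∀ a' ∈ X c, w a = w a' → a = a' := by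
    intro c a ha a' ha' hww
    by_cases h1 : a = b
    · by_cases h2 : a' = b
      · rw [h1, h2]
      · have := hw_lt a' h2; rw [h1] at hww; omega
    · by_cases h2 : a' = b
      · have := hw_lt a h1; rw [h2] at hww; omega
      · have z1 : τ a = 0 := (((hXmem c a).1 ha).1).resolve_right h1
        have z2 : τ a' = 0 := (((hXmem c a').1 ha').1).resolve_right h2
        simp only [w, if_neg h1, if_neg h2, if_pos z1, if_pos z2] at hww
        exact hinj (by omega)
  have hM : ∀ c, ((X c).card : ℤ) ≤ countMWithout S₀ τ b c := by
    intro c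
    rcases (X c).eq_empty_or_nonempty with hX | hX
    · rw [hX]; exact le_max_left _ _
    refine le_max_of_le_right ?_
    obtain ⟨a, ha, hamax⟩ := Finset.exists_max_image (X c) w hX
    have hcard : 0 < (X c).card := Finset.card_pos.2 hX
    have hca := ((hXmem c a).1 ha).2
    have hfull : ∀ a' ∈ X c, a' ≠ a → τ a' = 0 ∧ (S' a').1.length = h := by
      intro a' ha' hne
      have hlt : w a' < w a := lt_of_le_of_ne (hamax a' ha')
        fun h => hne (hwinj c a' ha' a ha h)
      obtain ⟨hor, hmem⟩ := (hXmem c a').1 ha'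
      refine ⟨hor.resolve_right ?_, hstuck a a' c hlt hca (Or.inr hmem)⟩
      rintro rfl
      have := hw_lt a (Ne.symm hne); omega
    have hsumX := le_sum_count_of_stuck hfit (fun a ha => ((hXmem c a).1 ha).2) ha hfull
    have hsumY : ∑ a' ∈ (colorBins S₀ τ c).erase b, (upper S' τ a').count c =
        countGWithout S₀ τ b c := by
      refine Finset.sum_congr rfl fun a' ha' => ?_
      obtain ⟨hne, hcol⟩ := Finset.mem_erase.1 ha'
      obtain ⟨hτ, hcol⟩ := colorBins_iff.1 hcol
      have hlt := htop a' hne hτ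
      obtain ⟨x, hx⟩ : ∃ x, x ∈ upper S' τ a' := List.exists_mem_of_length_pos (by
        rw [length_upper]; omega)
      have hxc : c = x := Option.some_injective _ (hcol.symm.trans (hfit.color a' hτ x hx))
      rw [← hxc] at hx
      have hw0 : w a' < w a := by
        have : w a' = 0 := by simp [w, hne, hτ]
        have := hwpos c a ha; omega
      rw [hfit.count_upper hx, length_upper, hstuck a a' c hw0 hca (Or.inr hx)]
    have hdisj : Disjoint ((colorBins S₀ τ c).erase b) (X c) := by
      refine Finset.disjoint_left.2 fun a' h1 h2 => ?_
      obtain ⟨hne, hcol⟩ := Finset.mem_erase.1 h1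
      rcases ((hXmem c a').1 h2).1 with h | h
      · exact (colorBins_iff.1 hcol).1 h
      · exact hne h
    have hF : countGWithout S₀ τ b c + (h * ((X c).card - 1) + (upper S' τ a).length) ≤
        countF S₀ τ c := by
      rw [hfit.countF_eq, ← hsumY, ← hsumX, ← Finset.sum_union hdisj]
      exact Finset.sum_le_sum_of_subset (Finset.subset_univ _)
    have hpos := List.length_pos_of_mem hca
    have hF' : countGWithout S₀ τ b c + (h * ((X c).card - 1) + 1) ≤ countF S₀ τ c := by omega
    have : ((X c).card : ℤ) - 1 < ⌈((countF S₀ τ c : ℚ) - countGWithout S₀ τ b c) / h⌉ := by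
      rw [Int.lt_ceil, lt_div_iff₀ (by exact_mod_cast hh)]
      have hq : (countGWithout S₀ τ b c : ℚ) + (h * (((X c).card - 1 : ℕ) : ℚ) + 1) ≤
          countF S₀ τ c := by exact_mod_cast hF'
      rw [Nat.cast_sub hcard] at hq
      push_cast at hq ⊢
      linarith
    omega
  -- the bins of the sets `X c`, with `b` among them, are at most as many as the bins of `B_ε(τ)`;
  -- hence some bin of `B_ε(τ)` is empty, and the unit above the border of `b` could go there
  have hcardX : ∑ c, (X c).card = (Finset.univ.biUnion X).card := by
    refine (Finset.card_biUnion fun c _ c' _ hcc' => ?_).symm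
    refine Finset.disjoint_left.2 fun a ha ha' => ?_
    exact hcc' (hfit.mono a _ ((hXmem c a).1 ha).2 _ ((hXmem c' a).1 ha').2)
  have hle : (Finset.univ.biUnion X).card ≤ (monoBins τ).card := by
    have h1 : ((∑ c, (X c).card : ℕ) : ℤ) ≤ (monoBins τ).card := by
      push_cast
      exact (Finset.sum_le_sum fun c _ => hM c).trans hsum
    rw [hcardX] at h1
    exact_mod_cast h1
  have hex : ∃ a, τ a = 0 ∧ (S' a).1 = [] := by
    by_contra hno
    push Not at hno
    have hsub : insert b (monoBins τ) ⊆ Finset.univ.biUnion X := by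
      intro a ha
      rw [Finset.mem_biUnion]
      rcases Finset.mem_insert.1 ha with rfl | ha
      · exact ⟨c₀, Finset.mem_univ _, (hXmem _ _).2 ⟨Or.inr rfl, hc₀⟩⟩
      · have hz : τ a = 0 := by simpa [monoBins] using ha
        obtain ⟨c, hc⟩ := List.exists_mem_of_ne_nil _ (hno a hz)
        exact ⟨c, Finset.mem_univ _, (hXmem _ _).2 ⟨Or.inl hz, by simpa [upper, hz] using hc⟩⟩
    have := Finset.card_le_card hsub
    rw [Finset.card_insert_of_notMem (by simp [monoBins]; omega)] at this
    omega
  obtain ⟨a, ha0, hanil⟩ := hex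
  have hab : a ≠ b := by rintro rfl; omega
  have := hstuck b a c₀ (hw_lt a hab) hc₀ (Or.inl hanil)
  rw [hanil] at this
  simp at this; omega

/-- Once all borders are gone, units of equal colors can be collected. -/
theorem Fits.exists_sorted (hS : Fits S₀ S τ) (hτ : ∀ b, τ b = 0)
    (hbal : ∀ c, ∃ j : ℕ, ∑ b, (S₀ b).1.count c = h * j) :
    ∃ S' : Config B C h, Relation.ReflTransGen WaterMove S S' ∧ Sorted S' := by
  classical
  let w : B → ℕ := fun a => Fintype.equivFin B a
  have hinj : Function.Injective w := fun a a' h => (Fintype.equivFin B).injective (Fin.ext h)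
  obtain ⟨S', hreach, hfit, -, hstuck⟩ := hS.exists_stuck w
  have hup : ∀ b, upper S' τ b = (S' b).1 := fun b => by simp [upper, hτ b]
  refine ⟨S', hreach, fun b => ?_⟩
  rcases List.eq_nil_or_concat (S' b).1 with hnil | ⟨_, c, hc⟩
  · exact Or.inl hnil
  right
  have hcb : c ∈ (S' b).1 := by rw [hc]; simp
  refine ⟨c, ?_⟩
  let X : Finset B := Finset.univ.filter fun a => c ∈ (S' a).1
  have hXmem : ∀ a, a ∈ X ↔ c ∈ (S' a).1 := by simp [X]
  have hbX : b ∈ X := (hXmem b).2 hcb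
  obtain ⟨a, ha, hamax⟩ := Finset.exists_max_image X w ⟨b, hbX⟩
  have hcard : 0 < X.card := Finset.card_pos.2 ⟨b, hbX⟩
  have hfull : ∀ a' ∈ X, a' ≠ a → τ a' = 0 ∧ (S' a').1.length = h := by
    intro a' ha' hne
    have hlt : w a' < w a := lt_of_le_of_ne (hamax a' ha') fun h => hne (hinj h)
    refine ⟨hτ a', hstuck a a' c hlt ?_ (Or.inr ?_)⟩
    · rw [hup]; exact (hXmem a).1 ha
    · rw [hup]; exact (hXmem a').1 ha'
  have hsumX := le_sum_count_of_stuck hfit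
    (fun a ha => by rw [hup]; exact (hXmem a).1 ha) ha hfull
  have hall : ∑ b, (S' b).1.count c = ∑ b ∈ X, (upper S' τ b).count c := by
    rw [← Finset.sum_subset (Finset.subset_univ X)]
    · exact Finset.sum_congr rfl fun b _ => by rw [hup]
    · intro a _ ha
      exact List.count_eq_zero_of_not_mem fun hmem => ha ((hXmem a).2 hmem)
  obtain ⟨j, hj⟩ := hbal c
  rw [← hfit.count c, hall, hsumX, hup] at hj
  have hlen : (S' a).1.length = h := by
    have h1 : 0 < (S' a).1.length := List.length_pos_of_mem ((hXmem a).1 ha)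
    have h2 := (S' a).2
    have h3 : h ∣ (S' a).1.length := by
      rw [← Nat.dvd_add_right (Dvd.intro (X.card - 1) rfl : h ∣ h * (X.card - 1)), hj]
      exact Dvd.intro _ rfl
    exact le_antisymm h2 (Nat.le_of_dvd h1 h3)
  have hlenb : (S' b).1.length = h := by
    by_cases hba : b = a
    · rw [hba, hlen]
    · exact (hfull b hbX hba).2
  have := hfit.upper_eq_replicate (b := b) (c := c) (by rw [hup]; exact hcb)
  rw [hup, hlenb] at this
  exact this

theorem exists_waterMoves_of_removalOrder {bs : List B} (hbs : IsRemovalOrder S₀ bs)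
    (hbal : ∀ c, ∃ j : ℕ, ∑ b, (S₀ b).1.count c = h * j) :
    ∃ T : Config B C h, Relation.ReflTransGen WaterMove S₀ T ∧ Sorted T := by
  obtain ⟨hlen, σ, h0, hmoves⟩ := hbs
  have key : ∀ i ≤ bs.length, ∃ T : Config B C h, Relation.ReflTransGen WaterMove S₀ T ∧
      Compat S₀ T (σ i) ∧ pending S₀ (σ 0) = i + pending S₀ (σ i) := by
    intro i
    induction i with
    | zero =>
      intro _
      exact ⟨S₀, Relation.ReflTransGen.refl, by rw [h0]; exact compat_topBorder S₀, by simp⟩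
    | succ i ih =>
      intro hi
      obtain ⟨T, hT, hc, hp⟩ := ih (by omega)
      have hm := hmoves i (by omega)
      obtain ⟨T', hT', hc'⟩ := hc.exists_waterMoves hm
      exact ⟨T', hT.trans hT', hc', by rw [hp, hm.pending (hc.border _)]; omega⟩
  obtain ⟨T, hT, hc, hp⟩ := key _ le_rfl
  rw [h0, pending_topBorder, hlen] at hp
  have hz : ∀ b, σ bs.length b = 0 := by
    intro b
    by_contra hb
    have h1 := bordersUpTo_pos (hc.border b) (Nat.pos_of_ne_zero hb)
    have h2 : bordersUpTo (S₀ b).1 (σ bs.length b) ≤ pending S₀ (σ bs.length) :=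
      Finset.single_le_sum (f := fun b => bordersUpTo (S₀ b).1 (σ bs.length b))
        (fun _ _ => Nat.zero_le _) (Finset.mem_univ b)
    rw [hlen] at h1 h2; omega
  obtain ⟨T', hT', hs⟩ := hc.toFits.exists_sorted hz hbal
  exact ⟨T', hT.trans hT', hs⟩

/-! ### Water-moves as sequences of ball-moves -/

/-- A water-move is a sequence of ball-moves. -/
theorem WaterMove.ballMoves (hm : WaterMove S S') : Relation.ReflTransGen BallMove S S' := by
  obtain ⟨m, b₁, b₂, c, hm1, h1, h2, h3, -, hrest⟩ := hm
  have hne : b₁ ≠ b₂ := by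
    rintro rfl
    have e1 := congrArg List.length h1
    have e2 := congrArg List.length h3
    simp at e1 e2; omega
  clear hm1
  induction m generalizing S with
  | zero =>
    have : S = S' := by
      funext b
      by_cases hb1 : b = b₁
      · subst hb1; exact Subtype.ext (by simpa using h1)
      by_cases hb2 : b = b₂
      · subst hb2; exact Subtype.ext (by simpa using h3.symm)
      exact hrest b hb1 hb2
    rw [this]
  | succ m ih =>
    have hl1 := (S b₁).2
    have hl2 := (S' b₂).2
    rw [h1] at hl1
    rw [h3] at hl2
    simp only [List.length_append, List.length_replicate] at hl1 hl2
    let T : Config B C h := Function.update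
      (Function.update S b₁ ⟨(S' b₁).1 ++ List.replicate m c, by simp; omega⟩)
      b₂ ⟨(S b₂).1 ++ [c], by simp; omega⟩
    have e1 : (T b₁).1 = (S' b₁).1 ++ List.replicate m c := by simp [T, hne]
    have e2 : (T b₂).1 = (S b₂).1 ++ [c] := by simp [T]
    have e3 : ∀ b, b ≠ b₁ → b ≠ b₂ → S b = T b := fun b hb1 hb2 => by simp [T, hb1, hb2]
    refine Relation.ReflTransGen.head ⟨b₁, b₂, c, ?_, h2, e2, e3⟩ (ih e1 (Or.inr ?_) ?_ ?_)
    · rw [h1, e1, List.replicate_succ', List.append_assoc]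
    · rw [e2]; simp
    · rw [h3, e2, List.replicate_succ]; simp
    · intro b hb1 hb2
      rw [← e3 b hb1 hb2]; exact hrest b hb1 hb2

theorem ballMoves_of_waterMoves {T : Config B C h} (hT : Relation.ReflTransGen WaterMove S T) :
    Relation.ReflTransGen BallMove S T := by
  induction hT with
  | refl => exact Relation.ReflTransGen.refl
  | tail _ hm ih => exact ih.trans hm.ballMoves

end Sufficiency

/-! ### The equivalence of the two puzzles -/

theorem Puzzle.WaterSolvable.ballSolvable {I : Puzzle} (hI : I.WaterSolvable) : I.BallSolvable := by
  obtain ⟨T, hT, hs⟩ := hI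
  exact ⟨T, ballMoves_of_waterMoves hT, hs⟩

theorem Puzzle.BallSolvable.balanced {I : Puzzle} (hI : I.BallSolvable) : I.Balanced := by
  obtain ⟨T, hT, hs⟩ := hI
  intro c
  rw [count_eq_of_ballMoves hT c]
  have : ∀ b, I.h ∣ (T b).1.count c := by
    intro b
    rcases hs b with h | ⟨c', h⟩
    · simp [h]
    · rw [h, List.count_replicate]; split_ifs <;> simp
  exact Finset.dvd_sum fun b _ => this b

theorem Puzzle.BallSolvable.exists_removalOrder {I : Puzzle} (hI : I.BallSolvable) :
    ∃ bs : List I.Bin, IsRemovalOrder I.init bs := by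
  obtain ⟨T, hT, hs⟩ := hI
  exact exists_removalOrder_of_ballMoves hT hs

theorem Puzzle.waterSolvable_of_removalOrder {I : Puzzle} (hbal : I.Balanced) {bs : List I.Bin}
    (hbs : IsRemovalOrder I.init bs) : I.WaterSolvable :=
  exists_waterMoves_of_removalOrder hbs hbal

theorem Puzzle.ballSolvable_iff (I : Puzzle) :
    I.BallSolvable ↔ I.Balanced ∧ ∃ bs : List I.Bin, IsRemovalOrder I.init bs :=
  ⟨fun h => ⟨h.balanced, h.exists_removalOrder⟩,
    fun ⟨h, _, hbs⟩ => (waterSolvable_of_removalOrder h hbs).ballSolvable⟩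

theorem Puzzle.waterSolvable_iff (I : Puzzle) :
    I.WaterSolvable ↔ I.Balanced ∧ ∃ bs : List I.Bin, IsRemovalOrder I.init bs :=
  ⟨fun h => I.ballSolvable_iff.1 h.ballSolvable,
    fun ⟨h, _, hbs⟩ => waterSolvable_of_removalOrder h hbs⟩

/-! ### A random access machine program for the transitions -/

/-- The program that checks and performs a transition. Cell 4 receives the top border `τ b`, cells
11 and 17 the colors `c` and `c'` above it and just below it, and cell 15 the next border. Cells 25
and 27 receive `M_c(τ)` and `M_c^b(τ)`, cell 28 the sum of the `M_c^b(τ)`. Only the data of the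
two colors `c` and `c'` change. The answer 0 is given by the instructions 7 and 8. -/
def transitionProgram : List Instr :=
  [.const 1 1, .const 2 40, .add 3 2 0, .load 4 3, .sub 5 33 0, .mul 6 4 5,
   .jump 6 9, .const 0 0, .jump 1 69,
   .add 7 2 33, .add 7 7 34, .add 7 7 34, .mul 9 0 32, .add 8 9 4, .add 10 7 8, .mul 12 33 32,
   .add 13 7 12, .add 14 13 8,
   .load 11 10, .load 15 14, .add 16 7 9, .add 16 16 15, .load 17 16,
   .add 18 2 33, .add 19 18 17, .add 18 18 11, .add 20 18 34, .add 21 19 34,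
   .load 22 18, .load 23 20, .sub 24 32 4,
   .sub 25 22 23, .add 25 25 32, .sub 25 25 1, .div 25 25 32, .sub 26 23 24,
   .sub 27 22 26, .add 27 27 32, .sub 27 27 1, .div 27 27 32, .add 28 35 27, .sub 28 28 25,
   .sub 29 28 36, .jump 29 7,
   .store 20 26, .load 22 19, .load 23 21, .sub 25 22 23, .add 25 25 32, .sub 25 25 1,
   .div 25 25 32, .sub 29 4 15, .add 26 22 29, .store 19 26,
   .sub 29 32 15, .sub 30 1 15, .sub 31 1 30, .mul 29 29 31, .add 27 23 29, .store 21 27,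
   .sub 26 26 27, .add 26 26 32, .sub 26 26 1, .div 26 26 32, .add 28 28 26, .sub 35 28 25,
   .add 36 36 30, .store 3 15, .const 0 1]

/-- `⌈(F - G) / h⌉`, or zero if this is negative, in the arithmetic of natural numbers. -/
def ceilDiff (F G h : ℕ) : ℕ := (F - G + h - 1) / h

/-- The effect of an instruction on the memory. -/
def Instr.write (M : ℕ → ℕ) (i : Instr) : ℕ → ℕ := (i.exec ⟨0, M⟩).mem

/-- The table entry of the bin is read, and cell 6 is zero if the bin is not a full bin with a
border. -/
theorem run_address (M : ℕ → ℕ) :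
    ∃ M', (ramStep transitionProgram)^[6] ⟨0, M⟩ = ⟨6, M'⟩ ∧
      (∀ a, a ∉ [1, 2, 3, 4, 5, 6] → M' a = M a) ∧
      M' 1 = 1 ∧ M' 2 = 40 ∧ M' 3 = 40 + M 0 ∧ M' 4 = M (40 + M 0) ∧
      M' 6 = M (40 + M 0) * (M 33 - M 0) := by
  have h3 : 40 + M 0 ≠ 3 := by omega
  have h2 : 40 + M 0 ≠ 2 := by omega
  have h1 : 40 + M 0 ≠ 1 := by omega
  refine ⟨((transitionProgram.drop 0).take 6).foldl Instr.write M, rfl, fun a ha => ?_, ?_, ?_,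
    ?_, ?_, ?_⟩
  · simp only [List.mem_cons, List.not_mem_nil, or_false, not_or] at ha
    simp [transitionProgram, Instr.write, Instr.exec, Function.update_apply, ha]
  all_goals simp [transitionProgram, Instr.write, Instr.exec, Function.update_apply, h1, h2, h3]

/-- The addresses of the data for the position of the border are computed. -/
theorem run_offsets (M : ℕ → ℕ) :
    ∃ M', (ramStep transitionProgram)^[9] ⟨9, M⟩ = ⟨18, M'⟩ ∧
      (∀ a, a ∉ [7, 8, 9, 10, 12, 13, 14] → M' a = M a) ∧
      M' 7 = M 2 + M 33 + M 34 + M 34 ∧ M' 9 = M 0 * M 32 ∧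
      M' 10 = M 2 + M 33 + M 34 + M 34 + (M 0 * M 32 + M 4) ∧
      M' 14 = M 2 + M 33 + M 34 + M 34 + M 33 * M 32 + (M 0 * M 32 + M 4) := by
  refine ⟨((transitionProgram.drop 9).take 9).foldl Instr.write M, rfl, fun a ha => ?_, ?_, ?_,
    ?_, ?_⟩
  · simp only [List.mem_cons, List.not_mem_nil, or_false, not_or] at ha
    simp [transitionProgram, Instr.write, Instr.exec, Function.update_apply, ha]
  all_goals simp [transitionProgram, Instr.write, Instr.exec, Function.update_apply]

/-- The two colors and the next border are read. -/
theorem run_colors (M : ℕ → ℕ) (h14 : 40 ≤ M 14) (h7 : 40 ≤ M 7) :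
    ∃ M', (ramStep transitionProgram)^[5] ⟨18, M⟩ = ⟨23, M'⟩ ∧
      (∀ a, a ∉ [11, 15, 16, 17] → M' a = M a) ∧
      M' 11 = M (M 10) ∧ M' 15 = M (M 14) ∧ M' 17 = M (M 7 + M 9 + M (M 14)) := by
  refine ⟨((transitionProgram.drop 18).take 5).foldl Instr.write M, rfl, fun a ha => ?_, ?_, ?_, ?_⟩
  · simp only [List.mem_cons, List.not_mem_nil, or_false, not_or] at ha
    simp [transitionProgram, Instr.write, Instr.exec, Function.update_apply, ha]
  · simp [transitionProgram, Instr.write, Instr.exec, Function.update_apply]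
  · simp [transitionProgram, Instr.write, Instr.exec, Function.update_apply,
      show M 14 ≠ 11 by omega]
  · simp [transitionProgram, Instr.write, Instr.exec, Function.update_apply,
      show M 14 ≠ 11 by omega, show M 7 + M 9 + M (M 14) ≠ 11 by omega,
      show M 7 + M 9 + M (M 14) ≠ 15 by omega, show M 7 + M 9 + M (M 14) ≠ 16 by omega]

/-- The addresses of the counts for the two colors are computed. -/
theorem run_cells (M : ℕ → ℕ) :
    ∃ M', (ramStep transitionProgram)^[5] ⟨23, M⟩ = ⟨28, M'⟩ ∧
      (∀ a, a ∉ [18, 19, 20, 21] → M' a = M a) ∧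
      M' 18 = M 2 + M 33 + M 11 ∧ M' 19 = M 2 + M 33 + M 17 ∧
      M' 20 = M 2 + M 33 + M 11 + M 34 ∧ M' 21 = M 2 + M 33 + M 17 + M 34 := by
  refine ⟨((transitionProgram.drop 23).take 5).foldl Instr.write M, rfl, fun a ha => ?_, ?_, ?_,
    ?_, ?_⟩
  · simp only [List.mem_cons, List.not_mem_nil, or_false, not_or] at ha
    simp [transitionProgram, Instr.write, Instr.exec, Function.update_apply, ha]
  all_goals simp [transitionProgram, Instr.write, Instr.exec, Function.update_apply]

/-- The number `M_c(τ)` and the count `G_c` without the bin `b` are computed. -/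
theorem run_oldM (M : ℕ → ℕ) (h20 : 40 ≤ M 20) (h1 : M 1 = 1) :
    ∃ M', (ramStep transitionProgram)^[8] ⟨28, M⟩ = ⟨36, M'⟩ ∧
      (∀ a, a ∉ [22, 23, 24, 25, 26] → M' a = M a) ∧
      M' 22 = M (M 18) ∧ M' 25 = ceilDiff (M (M 18)) (M (M 20)) (M 32) ∧
      M' 26 = M (M 20) - (M 32 - M 4) := by
  refine ⟨((transitionProgram.drop 28).take 8).foldl Instr.write M, rfl, fun a ha => ?_, ?_, ?_, ?_⟩
  · simp only [List.mem_cons, List.not_mem_nil, or_false, not_or] at ha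
    simp [transitionProgram, Instr.write, Instr.exec, Function.update_apply, ha]
  all_goals simp [transitionProgram, Instr.write, Instr.exec, Function.update_apply, ceilDiff, h1,
    show M 20 ≠ 22 by omega]

/-- The total of the numbers `M_c^b(τ)` is computed and compared with that of the monochrome bins. -/
theorem run_newTotal (M : ℕ → ℕ) (h1 : M 1 = 1) :
    ∃ M', (ramStep transitionProgram)^[7] ⟨36, M⟩ = ⟨43, M'⟩ ∧
      (∀ a, a ∉ [27, 28, 29] → M' a = M a) ∧
      M' 28 = M 35 + ceilDiff (M 22) (M 26) (M 32) - M 25 ∧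
      M' 29 = M 35 + ceilDiff (M 22) (M 26) (M 32) - M 25 - M 36 := by
  refine ⟨((transitionProgram.drop 36).take 7).foldl Instr.write M, rfl, fun a ha => ?_, ?_, ?_⟩
  · simp only [List.mem_cons, List.not_mem_nil, or_false, not_or] at ha
    simp [transitionProgram, Instr.write, Instr.exec, Function.update_apply, ha]
  all_goals simp [transitionProgram, Instr.write, Instr.exec, Function.update_apply, ceilDiff, h1]

/-- The counts of units and room for the two colors are updated, but for the room that the bin `b`
offers to the second one. -/
theorem run_storeFG (M : ℕ → ℕ) (h20 : 40 ≤ M 20) (h19 : 40 ≤ M 19) (h21 : 40 ≤ M 21)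
    (h1 : M 1 = 1) (hd : M 19 ≠ M 20) (hd' : M 21 ≠ M 20) :
    ∃ M', (ramStep transitionProgram)^[10] ⟨44, M⟩ = ⟨54, M'⟩ ∧
      (∀ a, a ∉ [22, 23, 25, 26, 29, M 19, M 20] → M' a = M a) ∧
      M' 23 = M (M 21) ∧ M' 25 = ceilDiff (M (M 19)) (M (M 21)) (M 32) ∧
      M' 26 = M (M 19) + (M 4 - M 15) ∧ M' (M 19) = M (M 19) + (M 4 - M 15) ∧
      M' (M 20) = M 26 := by
  refine ⟨((transitionProgram.drop 44).take 10).foldl Instr.write M, rfl, fun a ha => ?_, ?_, ?_,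
    ?_, ?_, ?_⟩
  · simp only [List.mem_cons, List.not_mem_nil, or_false, not_or] at ha
    simp [transitionProgram, Instr.write, Instr.exec, Function.update_apply, ha,
      show (19 : ℕ) ≠ M 20 by omega]
  all_goals
    simp [transitionProgram, Instr.write, Instr.exec, Function.update_apply, ceilDiff, h1,
      show M 21 ≠ 22 by omega, hd, hd', Ne.symm hd,
      show (19 : ℕ) ≠ M 20 by omega, show (21 : ℕ) ≠ M 20 by omega, show (32 : ℕ) ≠ M 20 by omega,
      show (1 : ℕ) ≠ M 20 by omega, show (4 : ℕ) ≠ M 20 by omega, show (15 : ℕ) ≠ M 20 by omega,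
      show (23 : ℕ) ≠ M 19 by omega, show (25 : ℕ) ≠ M 19 by omega, show (26 : ℕ) ≠ M 19 by omega,
      show M 20 ≠ 22 by omega, show M 20 ≠ 23 by omega, show M 20 ≠ 25 by omega,
      show M 20 ≠ 26 by omega, show M 20 ≠ 29 by omega]

/-- The room for the second color is updated; it does not change if the bin has become monochrome. -/
theorem run_storeG (M : ℕ → ℕ) (h21 : 40 ≤ M 21) (h1 : M 1 = 1) :
    ∃ M', (ramStep transitionProgram)^[6] ⟨54, M⟩ = ⟨60, M'⟩ ∧
      (∀ a, a ∉ [27, 29, 30, 31, M 21] → M' a = M a) ∧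
      M' 27 = M 23 + (M 32 - M 15) * (1 - (1 - M 15)) ∧ M' 30 = 1 - M 15 ∧
      M' (M 21) = M 23 + (M 32 - M 15) * (1 - (1 - M 15)) := by
  refine ⟨((transitionProgram.drop 54).take 6).foldl Instr.write M, rfl, fun a ha => ?_, ?_, ?_, ?_⟩
  · simp only [List.mem_cons, List.not_mem_nil, or_false, not_or] at ha
    simp [transitionProgram, Instr.write, Instr.exec, Function.update_apply, ha]
  all_goals
    simp [transitionProgram, Instr.write, Instr.exec, Function.update_apply, h1,
      show (27 : ℕ) ≠ M 21 by omega, show (30 : ℕ) ≠ M 21 by omega]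

/-- The totals and the table are updated, and the answer 1 is given. -/
theorem run_totals (M : ℕ → ℕ) (h1 : M 1 = 1) (h3 : 40 ≤ M 3) :
    ∃ M', (ramStep transitionProgram)^[9] ⟨60, M⟩ = ⟨69, M'⟩ ∧
      (∀ a, a ∉ [0, 26, 28, 35, 36, M 3] → M' a = M a) ∧
      M' 35 = M 28 + ceilDiff (M 26) (M 27) (M 32) - M 25 ∧ M' 36 = M 36 + M 30 ∧
      M' (M 3) = M 15 ∧ M' 0 = 1 := by
  refine ⟨((transitionProgram.drop 60).take 9).foldl Instr.write M, rfl, fun a ha => ?_, ?_, ?_,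
    ?_, ?_⟩
  · simp only [List.mem_cons, List.not_mem_nil, or_false, not_or] at ha
    simp [transitionProgram, Instr.write, Instr.exec, Function.update_apply, ha,
      show (3 : ℕ) ≠ 0 by omega]
  · simp [transitionProgram, Instr.write, Instr.exec, Function.update_apply, ceilDiff, h1,
      show (35 : ℕ) ≠ M 3 by omega]
  · simp [transitionProgram, Instr.write, Instr.exec, Function.update_apply,
      show (36 : ℕ) ≠ M 3 by omega]
  · simp [transitionProgram, Instr.write, Instr.exec, Function.update_apply, show M 3 ≠ 0 by omega]
  · simp [transitionProgram, Instr.write, Instr.exec, Function.update_apply]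

theorem halts_of_reaches {Q : List Instr} {t k : ℕ} {M M' : ℕ → ℕ} {pc : ℕ}
    (hk : (ramStep Q)^[k] ⟨0, M⟩ = ⟨pc, M'⟩) (hkt : k ≤ t) (hpc : Q[pc]? = none) :
    HaltsWithin Q t M M' := by
  refine ⟨pc, hpc, ?_⟩
  obtain ⟨j, rfl⟩ := Nat.exists_eq_add_of_le hkt
  rw [Nat.add_comm, Function.iterate_add_apply, hk]
  exact Function.iterate_fixed (by simp [ramStep, hpc]) j

/-- The instructions 7 and 8 give the answer 0. -/
theorem halts_of_reject {k : ℕ} {M M₁ : ℕ → ℕ} (hk : (ramStep transitionProgram)^[k] ⟨0, M⟩ = ⟨7,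
  M₁⟩)
    (hkt : k + 2 ≤ 70) (h1 : M₁ 1 = 1) : ∃ M',
      HaltsWithin transitionProgram 70 M M' ∧ M' 0 = 0 := by
  refine ⟨Function.update M₁ 0 0, halts_of_reaches (k := 2 + k) (pc := 69) ?_ (by omega) rfl, ?_⟩
  · rw [Function.iterate_add_apply, hk]
    change RamState.mk (if 0 < Function.update M₁ 0 0 1 then 69 else 9) (Function.update M₁ 0 0) = _
    simp [h1]
  · simp

theorem iterate_chain {α : Type*} {f : α → α} {j k : ℕ} {x y z : α} (h1 : f^[j] x = y)
    (h2 : f^[k] y = z) : f^[k + j] x = z := by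
  rw [Function.iterate_add_apply, h1, h2]

/-- The answer is 0 if the bin is empty or monochrome. -/
theorem halts_of_no_border {M : ℕ → ℕ} (hM : M (40 + M 0) * (M 33 - M 0) = 0) :
    ∃ M', HaltsWithin transitionProgram 70 M M' ∧ M' 0 = 0 := by
  obtain ⟨M₁, r1, f1, a1, a2, a3, a4, a6⟩ := run_address M
  refine halts_of_reject (k := 1 + 6) (M₁ := M₁) (iterate_chain r1 ?_) (by omega) a1
  change RamState.mk (if 0 < M₁ 6 then 9 else 7) _ = _
  rw [a6, hM]; rfl

section Run

variable {M : ℕ → ℕ} {b n m h t c p c' : ℕ}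

/-- The memory when the decision is taken. -/
theorem run_to_decision (h0 : M 0 = b) (hn : M 33 = n) (hm : M 34 = m) (hh : M 32 = h)
    (hb : b < n) (ht : M (40 + b) = t) (ht0 : 0 < t)
    (hc : M (40 + n + 2 * m + (b * h + t)) = c)
    (hp : M (40 + n + 2 * m + n * h + (b * h + t)) = p)
    (hc' : M (40 + n + 2 * m + (b * h + p)) = c') :
    ∃ M', (ramStep transitionProgram)^[41] ⟨0, M⟩ = ⟨43, M'⟩ ∧ (∀ a, 32 ≤ a → M' a = M a) ∧
      M' 1 = 1 ∧ M' 3 = 40 + b ∧ M' 4 = t ∧ M' 15 = p ∧ M' 19 = 40 + n + c' ∧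
      M' 20 = 40 + n + m + c ∧ M' 21 = 40 + n + m + c' ∧
      M' 26 = M (40 + n + m + c) - (h - t) ∧
      M' 28 = M 35 + ceilDiff (M (40 + n + c)) (M (40 + n + m + c) - (h - t)) h -
        ceilDiff (M (40 + n + c)) (M (40 + n + m + c)) h ∧
      M' 29 = M' 28 - M 36 := by
  obtain ⟨M₁, r1, f1, a1, a2, a3, a4, a6⟩ := run_address M
  have j1 : (ramStep transitionProgram)^[1] ⟨6, M₁⟩ = ⟨9, M₁⟩ := by
    change RamState.mk (if 0 < M₁ 6 then 9 else 7) _ = _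
    rw [if_pos]
    rw [a6, h0, ht, hn]
    exact Nat.mul_pos ht0 (by omega)
  obtain ⟨M₂, r2, f2, b7, b9, b10, b14⟩ := run_offsets M₁
  have e2 : ∀ a, 32 ≤ a → M₂ a = M a := by
    intro a ha
    rw [f2 a (by simp; omega), f1 a (by simp; omega)]
  have g2 : M₁ 2 + M₁ 33 + M₁ 34 + M₁ 34 = 40 + n + 2 * m := by
    rw [a2, f1 33 (by decide), f1 34 (by decide), hn, hm]; omega
  have g0 : M₁ 0 * M₁ 32 = b * h := by rw [f1 0 (by decide), f1 32 (by decide), h0, hh]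
  have g4 : M₁ 4 = t := by rw [a4, h0, ht]
  rw [g2] at b7 b10 b14
  rw [g0] at b9 b10 b14
  rw [g4] at b10 b14
  rw [f1 33 (by decide), f1 32 (by decide), hn, hh] at b14
  obtain ⟨M₃, r3, f3, c11, c15, c17⟩ := run_colors M₂ (by omega) (by omega)
  have e3 : ∀ a, 32 ≤ a → M₃ a = M a := fun a ha => by rw [f3 a (by simp; omega), e2 a ha]
  rw [b10, e2 _ (by omega), hc] at c11
  rw [b14, e2 _ (by omega), hp] at c15
  rw [b14, b7, b9, e2 (40 + n + 2 * m + n * h + (b * h + t)) (by omega), hp, e2 _ (by omega),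
    Nat.add_assoc, hc'] at c17
  have g1 : M₂ 1 = 1 := by rw [f2 1 (by decide), a1]
  have g2' : M₃ 2 = 40 := by rw [f3 2 (by decide), f2 2 (by decide), a2]
  obtain ⟨M₄, r4, f4, d18, d19, d20, d21⟩ := run_cells M₃
  rw [g2', e3 33 (by omega), hn, c11] at d18 d20
  rw [g2', e3 33 (by omega), hn, c17] at d19 d21
  rw [e3 34 (by omega), hm] at d20 d21
  have e4 : ∀ a, 32 ≤ a → M₄ a = M a := fun a ha => by rw [f4 a (by simp; omega), e3 a ha]
  have i1 : M₄ 1 = 1 := by rw [f4 1 (by decide), f3 1 (by decide), g1]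
  have i4 : M₄ 4 = t := by rw [f4 4 (by decide), f3 4 (by decide), f2 4 (by decide), g4]
  obtain ⟨M₅, r5, f5, k22, k25, k26⟩ := run_oldM M₄ (by omega) i1
  have e5 : ∀ a, 32 ≤ a → M₅ a = M a := fun a ha => by rw [f5 a (by simp; omega), e4 a ha]
  rw [d18, e4 _ (by omega)] at k22 k25
  rw [d20, e4 _ (by omega)] at k25 k26
  rw [e4 32 (by omega), hh] at k25 k26
  rw [i4] at k26
  obtain ⟨M₆, r6, f6, l28, l29⟩ := run_newTotal M₅ (by rw [f5 1 (by decide), i1])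
  rw [← l28] at l29
  rw [e5 35 (by omega), k22, k26, k25, e5 32 (by omega), hh] at l28
  rw [e5 36 (by omega)] at l29
  have comm : 40 + n + c + m = 40 + n + m + c := by omega
  rw [comm] at k25 k26 l28 d20
  have comm' : 40 + n + c' + m = 40 + n + m + c' := by omega
  rw [comm'] at d21
  refine ⟨M₆, ?_, fun a ha => by rw [f6 a (by simp; omega), e5 a ha], ?_, ?_, ?_, ?_, ?_, ?_, ?_,
    ?_, l28, l29⟩
  · have s1 := iterate_chain r1 j1
    have s2 := iterate_chain s1 r2
    have s3 := iterate_chain s2 r3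
    have s4 := iterate_chain s3 r4
    have s5 := iterate_chain s4 r5
    have s6 := iterate_chain s5 r6
    simp only [Nat.reduceAdd] at s6
    exact s6
  · rw [f6 1 (by decide), f5 1 (by decide), i1]
  · rw [f6 3 (by decide), f5 3 (by decide), f4 3 (by decide), f3 3 (by decide), f2 3 (by decide),
      a3, h0]
  · rw [f6 4 (by decide), f5 4 (by decide), i4]
  · rw [f6 15 (by decide), f5 15 (by decide), f4 15 (by decide), c15]
  · rw [f6 19 (by decide), f5 19 (by decide), d19]
  · rw [f6 20 (by decide), f5 20 (by decide), d20]
  · rw [f6 21 (by decide), f5 21 (by decide), d21]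
  · rw [f6 26 (by decide), k26]

/-- The run of the program on a bin with a border. -/
theorem halts_of_border (h0 : M 0 = b) (hn : M 33 = n) (hm : M 34 = m) (hh : M 32 = h)
    (hb : b < n) (ht : M (40 + b) = t) (ht0 : 0 < t)
    (hc : M (40 + n + 2 * m + (b * h + t)) = c)
    (hp : M (40 + n + 2 * m + n * h + (b * h + t)) = p)
    (hc' : M (40 + n + 2 * m + (b * h + p)) = c') (hcm : c < m) (hcm' : c' < m) (hne : c ≠ c')
    {T : ℕ} (hT : M 35 + ceilDiff (M (40 + n + c)) (M (40 + n + m + c) - (h - t)) h -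
        ceilDiff (M (40 + n + c)) (M (40 + n + m + c)) h = T) :
    ∃ M', HaltsWithin transitionProgram 70 M M' ∧ (M 36 < T → M' 0 = 0) ∧ (T ≤ M 36 → M' 0 = 1 ∧
      M' (40 + b) = p ∧ M' (40 + n + m + c) = M (40 + n + m + c) - (h - t) ∧
      M' (40 + n + c') = M (40 + n + c') + (t - p) ∧
      M' (40 + n + m + c') = M (40 + n + m + c') + (if p = 0 then 0 else h - p) ∧
      M' 35 = T + ceilDiff (M' (40 + n + c')) (M' (40 + n + m + c')) h -
        ceilDiff (M (40 + n + c')) (M (40 + n + m + c')) h ∧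
      M' 36 = M 36 + (if p = 0 then 1 else 0) ∧
      ∀ a, 32 ≤ a → a ≠ 35 → a ≠ 36 → a ≠ 40 + b → a ≠ 40 + n + m + c → a ≠ 40 + n + c' →
        a ≠ 40 + n + m + c' → M' a = M a) := by
  obtain ⟨M₁, r1, e1, a1, a3, a4, a15, a19, a20, a21, a26, a28, a29⟩ :=
    run_to_decision h0 hn hm hh hb ht ht0 hc hp hc'
  rw [hT] at a28
  rw [a28] at a29
  rcases lt_or_ge (M 36) T with hlt | hle
  · obtain ⟨M', h1, h2⟩ := halts_of_reject (k := 1 + 41) (M₁ := M₁) (iterate_chain r1 (by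
      change RamState.mk (if 0 < M₁ 29 then 7 else 44) _ = _
      rw [if_pos (by omega)])) (by omega) a1
    exact ⟨M', h1, fun _ => h2, fun h => by omega⟩
  have j1 : (ramStep transitionProgram)^[1] ⟨43, M₁⟩ = ⟨44, M₁⟩ := by
    change RamState.mk (if 0 < M₁ 29 then 7 else 44) _ = _
    rw [if_neg (by omega)]
  obtain ⟨M₂, r2, f2, b23, b25, b26, b19, b20⟩ := run_storeFG M₁ (by omega) (by omega) (by omega)
    a1 (by omega) (by omega)
  rw [a19] at f2 b19
  rw [a20] at f2 b20
  rw [a19, e1 _ (by omega)] at b25 b26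
  rw [a21, e1 _ (by omega)] at b25 b23
  rw [e1 _ (by omega), hh] at b25
  rw [a4, a15] at b26
  rw [e1 (40 + n + c') (by omega), a4, a15] at b19
  have e2 : ∀ a, 32 ≤ a → a ≠ 40 + n + c' → a ≠ 40 + n + m + c → M₂ a = M a := by
    intro a ha ha1 ha2
    rw [f2 a (by simp; omega), e1 a ha]
  have u2 : ∀ a, a ∉ [22, 23, 25, 26, 29] → a < 32 → M₂ a = M₁ a := by
    intro a ha ha'
    refine f2 a ?_
    simp only [List.mem_cons, List.not_mem_nil, or_false, not_or] at ha ⊢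
    omega
  have g21 : M₂ 21 = 40 + n + m + c' := by rw [u2 21 (by decide) (by omega), a21]
  have g1 : M₂ 1 = 1 := by rw [u2 1 (by decide) (by omega), a1]
  have g15 : M₂ 15 = p := by rw [u2 15 (by decide) (by omega), a15]
  have gg : (M₂ 32 - M₂ 15) * (1 - (1 - M₂ 15)) = if p = 0 then 0 else h - p := by
    rw [e2 32 (by omega) (by omega) (by omega), hh, g15]
    split_ifs with hp0
    · simp [hp0]
    · have : 1 - (1 - p) = 1 := by omega
      rw [this, Nat.mul_one]
  obtain ⟨M₃, r3, f3, c27, c30, c21⟩ := run_storeG M₂ (by omega) g1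
  rw [g21] at f3 c21
  rw [gg, b23] at c27 c21
  rw [g15] at c30
  have u3 : ∀ a, a ∉ [27, 29, 30, 31] → a < 32 → M₃ a = M₂ a := by
    intro a ha ha'
    refine f3 a ?_
    simp only [List.mem_cons, List.not_mem_nil, or_false, not_or] at ha ⊢
    omega
  have e3 : ∀ a, 32 ≤ a → a ≠ 40 + n + m + c' → M₃ a = M₂ a := by
    intro a ha ha1
    exact f3 a (by simp; omega)
  have g3 : M₃ 3 = 40 + b := by
    rw [u3 3 (by decide) (by omega), u2 3 (by decide) (by omega), a3]
  obtain ⟨M₄, r4, f4, d35, d36, d3, d0⟩ := run_totals M₃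
    (by rw [u3 1 (by decide) (by omega), g1]) (by omega)
  rw [g3] at f4 d3
  have e4 : ∀ a, 32 ≤ a → a ≠ 35 → a ≠ 36 → a ≠ 40 + b → M₄ a = M₃ a := by
    intro a ha h1 h2 h3
    exact f4 a (by simp; omega)
  have q1 : M₄ (40 + n + m + c) = M (40 + n + m + c) - (h - t) := by
    rw [e4 _ (by omega) (by omega) (by omega) (by omega), e3 _ (by omega) (by omega), b20, a26]
  have q2 : M₄ (40 + n + c') = M (40 + n + c') + (t - p) := by
    rw [e4 _ (by omega) (by omega) (by omega) (by omega), e3 _ (by omega) (by omega), b19]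
  have q3 : M₄ (40 + n + m + c') = M (40 + n + m + c') + (if p = 0 then 0 else h - p) := by
    rw [e4 _ (by omega) (by omega) (by omega) (by omega), c21]
  have s1 := iterate_chain r1 j1
  have s2 := iterate_chain s1 r2
  have s3 := iterate_chain s2 r3
  have s4 := iterate_chain s3 r4
  refine ⟨M₄, halts_of_reaches s4 (by omega) rfl, fun h => by omega, fun _ => ⟨d0, ?_, q1, q2, q3,
    ?_, ?_, ?_⟩⟩
  · rw [d3, u3 15 (by decide) (by omega), g15]
  · rw [d35, q2, q3, u3 28 (by decide) (by omega), u2 28 (by decide) (by omega), a28,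
      u3 26 (by decide) (by omega), b26, c27, u3 25 (by decide) (by omega), b25,
      e3 32 (by omega) (by omega), e2 32 (by omega) (by omega) (by omega), hh]
  · rw [d36, e3 36 (by omega) (by omega), e2 36 (by omega) (by omega) (by omega), c30]
    split_ifs with hp0 <;> omega
  · intro a ha h1 h2 h3 h4 h5 h6
    rw [e4 a ha h1 h2 h3, e3 a ha h6, e2 a ha h5 h4]

end Run

/-! ### The change of the counts in a transition -/

theorem max_zero_ceil_eq_ceilDiff {h : ℕ} (hh : 0 < h) (F G : ℕ) :
    max 0 ⌈((F : ℚ) - (G : ℚ)) / (h : ℚ)⌉ = (ceilDiff F G h : ℤ) := by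
  have hq : (0 : ℚ) < h := by exact_mod_cast hh
  rcases le_or_gt F G with hFG | hFG
  · have h1 : ceilDiff F G h = 0 := by
      unfold ceilDiff; rw [Nat.sub_eq_zero_of_le hFG]; exact Nat.div_eq_of_lt (by omega)
    rw [h1, max_eq_left]
    · rfl
    · rw [Int.ceil_le]
      have : (F : ℚ) ≤ G := by exact_mod_cast hFG
      rw [div_le_iff₀ hq]; push_cast; linarith
  · set q := ceilDiff F G h with hqd
    have hq1 : 0 < q := Nat.div_pos (by omega) hh
    have hlow : (q - 1) * h < F - G := by
      have : q * h ≤ F - G + h - 1 := Nat.div_mul_le_self _ _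
      have e : (q - 1) * h + h = q * h := by
        rw [← Nat.succ_mul, Nat.succ_eq_add_one, Nat.sub_add_cancel hq1]
      omega
    have hupp : F - G ≤ q * h := by
      have h1 := Nat.div_add_mod (F - G + h - 1) h
      have h2 := Nat.mod_lt (F - G + h - 1) hh
      change h * q + _ = _ at h1
      rw [Nat.mul_comm] at h1
      omega
    have hceil : ⌈((F : ℚ) - (G : ℚ)) / (h : ℚ)⌉ = (q : ℤ) := by
      rw [Int.ceil_eq_iff, lt_div_iff₀ hq, div_le_iff₀ hq]
      have e1 : ((F - G : ℕ) : ℚ) = (F : ℚ) - G := Nat.cast_sub hFG.le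
      have e2 : ((q - 1 : ℕ) : ℚ) = (q : ℚ) - 1 := by rw [Nat.cast_sub hq1]; simp
      have e3 : ((q - 1 : ℕ) : ℚ) * h < ((F - G : ℕ) : ℚ) := by exact_mod_cast hlow
      have e4 : ((F - G : ℕ) : ℚ) ≤ (q : ℚ) * h := by exact_mod_cast hupp
      rw [e1] at e3 e4
      rw [e2] at e3
      push_cast
      exact ⟨e3, e4⟩
    rw [hceil]; omega

section Update

variable {B C : Type} [Fintype B] [DecidableEq B] [Fintype C] [DecidableEq C] {h : ℕ}
variable {S₀ : Config B C h} {τ τ' : B → ℕ} {b : B}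

theorem countM_eq (hh : 0 < h) (c : C) :
    countM S₀ τ c = (ceilDiff (countF S₀ τ c) (countG S₀ τ c) h : ℤ) :=
  max_zero_ceil_eq_ceilDiff hh _ _

theorem countMWithout_eq (hh : 0 < h) (c : C) :
    countMWithout S₀ τ b c = (ceilDiff (countF S₀ τ c) (countGWithout S₀ τ b c) h : ℤ) :=
  max_zero_ceil_eq_ceilDiff hh _ _

/-- The contribution of a single bin to `G_c(τ)`. -/
theorem countG_eq_countGWithout_add (S₀ : Config B C h) (τ : B → ℕ) (b : B) (c : C) :
    countG S₀ τ c = countGWithout S₀ τ b c +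
      if τ b ≠ 0 ∧ (S₀ b).1[τ b]? = some c then h - τ b else 0 := by
  unfold countG countGWithout
  split_ifs with hb
  · rw [Finset.sum_erase_add _ _ (colorBins_iff.2 hb)]
  · rw [Finset.erase_eq_of_notMem fun h => hb (colorBins_iff.1 h), Nat.add_zero]

theorem countGWithout_congr (heq : ∀ a, a ≠ b → τ a = τ' a) (c : C) :
    countGWithout S₀ τ b c = countGWithout S₀ τ' b c := by
  unfold countGWithout
  have : (colorBins S₀ τ c).erase b = (colorBins S₀ τ' c).erase b := by
    ext a
    simp only [Finset.mem_erase, colorBins_iff]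
    refine and_congr_right fun ha => ?_
    rw [heq a ha]
  rw [this]
  exact Finset.sum_congr rfl fun a ha => by rw [heq a (Finset.ne_of_mem_erase ha)]

/-- Removing the top border of `b` uncovers units of a single color. -/
theorem countF_of_prevBorder (hτ : τ b ∈ borders (S₀ b).1) (h0 : 0 < τ b)
    (heq : ∀ a, a ≠ b → τ a = τ' a) (hb' : τ' b = prevBorder (S₀ b).1 (τ b)) {c' : C}
    (hc' : (S₀ b).1[τ' b]? = some c') (c : C) :
    countF S₀ τ' c = countF S₀ τ c + if c = c' then τ b - τ' b else 0 := by
  have hlt : τ' b < τ b := by rw [hb']; exact prevBorder_lt h0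
  have hle := le_length_of_mem_borders hτ
  have hseg : ((S₀ b).1.drop (τ' b)).take (τ b - τ' b) = List.replicate (τ b - τ' b) c' := by
    rw [List.eq_replicate_iff]
    refine ⟨by simp; omega, fun x hx => ?_⟩
    obtain ⟨i, hi⟩ := List.mem_iff_getElem?.1 hx
    rw [List.getElem?_take] at hi
    split_ifs at hi with hi'
    rw [List.getElem?_drop, getElem?_eq_of_no_border (s := τ b) hle
      (fun j hj hjl => by rw [hb']; exact le_prevBorder hj hjl) (Nat.le_add_right _ _) (by omega),
      hc'] at hi
    exact (Option.some_injective _ hi).symm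
  have key : ∀ a, ((S₀ a).1.drop (τ' a)).count c = ((S₀ a).1.drop (τ a)).count c +
      if a = b then (List.replicate (τ b - τ' b) c').count c else 0 := by
    intro a
    by_cases hab : a = b
    · subst hab
      rw [if_pos rfl, ← hseg, ← Nat.add_comm, ← List.count_append]
      congr 1
      conv_lhs => rw [← List.take_append_drop (τ a - τ' a) ((S₀ a).1.drop (τ' a))]
      rw [List.drop_drop, Nat.add_sub_cancel' hlt.le]
    · rw [if_neg hab, heq a hab]; rfl
  have hF : ∀ σ : B → ℕ, countF S₀ σ c = ∑ a, ((S₀ a).1.drop (σ a)).count c := fun σ =>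
    Finset.sum_congr rfl fun a _ => card_filter_Ioc_eq_count_drop (S₀ a).2 c (σ a)
  rw [hF, hF, Finset.sum_congr rfl fun a _ => key a, Finset.sum_add_distrib]
  simp only [Finset.sum_ite_eq', Finset.mem_univ, if_true, List.count_replicate]
  congr 1
  by_cases h : c = c'
  · simp [h]
  · simp [h, Ne.symm h]

theorem monoBins_card_of_prevBorder (h0 : 0 < τ b) (heq : ∀ a, a ≠ b → τ a = τ' a) :
    (monoBins τ').card = (monoBins τ).card + if τ' b = 0 then 1 else 0 := by
  have hnot : b ∉ monoBins τ := by simp [monoBins]; omega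
  split_ifs with hb
  · have : monoBins τ' = insert b (monoBins τ) := by
      ext a
      by_cases hab : a = b
      · subst hab; simp [monoBins, hb]
      · simp [monoBins, hab, heq a hab]
    rw [this, Finset.card_insert_of_notMem hnot]
  · have : monoBins τ' = monoBins τ := by
      ext a
      by_cases hab : a = b
      · subst hab; simp [monoBins, hb]; omega
      · simp [monoBins, heq a hab]
    rw [this, Nat.add_zero]

/-- A sum of which one term changes. -/
theorem sum_add_of_eq_off {ι : Type} [Fintype ι] [DecidableEq ι] {f g : ι → ℕ} {c : ι}
    (hfg : ∀ i, i ≠ c → f i = g i) : ∑ i, f i + g c = ∑ i, g i + f c := by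
  have h : ∑ i ∈ Finset.univ.erase c, f i = ∑ i ∈ Finset.univ.erase c, g i :=
    Finset.sum_congr rfl fun i hi => hfg i (Finset.ne_of_mem_erase hi)
  rw [← Finset.add_sum_erase _ f (Finset.mem_univ c), ← Finset.add_sum_erase _ g (Finset.mem_univ c),
    h]
  omega

end Update

theorem borders_nil {C : Type} [DecidableEq C] : borders ([] : List C) = {0} := rfl

theorem Puzzle.init_inl_getElem? (I : Puzzle) (b : Fin I.n) {i : ℕ} (hi : i < I.h) :
    (I.init (Sum.inl b)).1[i]? = some (I.content b ⟨i, hi⟩) := by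
  simp [Puzzle.init, hi]

theorem Puzzle.init_inl_length (I : Puzzle) (b : Fin I.n) :
    (I.init (Sum.inl b)).1.length = I.h := by
  simp [Puzzle.init]

theorem not_tableMove_of_zero {I : Puzzle} {τ : I.Bin → ℕ} {b : I.Bin} (h : τ b = 0) :
    ¬ ∃ τ', TableMove I.init b τ τ' := by
  rintro ⟨τ', -, h0, -⟩
  omega

/-! ### Correctness of the program -/

/-- The program decides whether a transition is legal and performs it. -/
theorem checksTransitions_transitionProgram : ChecksTransitions transitionProgram 70 := by
  intro I τ b M hτ hM h0
  rcases b with b | b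
  swap
  · -- an empty bin has no border
    have hz : τ (Sum.inr b) = 0 := by
      have := hτ (Sum.inr b)
      simpa [Puzzle.init, borders_nil] using this
    obtain ⟨M', hM', hans⟩ := halts_of_no_border (M := M) (by
      rw [hM.fullBins, h0]
      have : I.n - I.binIndex (Sum.inr b) = 0 := by simp [Puzzle.binIndex]
      rw [this, Nat.mul_zero])
    exact ⟨M', hM', fun τ' h => absurd ⟨τ', h⟩ (not_tableMove_of_zero hz), fun _ => hans⟩
  have h0' : M 0 = b := h0
  have ht := hM.table b
  by_cases hz : τ (Sum.inl b) = 0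
  · obtain ⟨M', hM', hans⟩ := halts_of_no_border (M := M) (by rw [h0', ht, hz, Nat.zero_mul])
    exact ⟨M', hM', fun τ' h => absurd ⟨τ', h⟩ (not_tableMove_of_zero hz), fun _ => hans⟩
  have hpos : 0 < τ (Sum.inl b) := Nat.pos_of_ne_zero hz
  set t := τ (Sum.inl b) with htdef
  have hbord : t ∈ borders (I.init (Sum.inl b)).1 := hτ (Sum.inl b)
  have hth : t < I.h := by
    have := lt_length_of_mem_borders hbord hz
    rwa [I.init_inl_length] at this
  set p := prevBorder (I.init (Sum.inl b)).1 t with hpdef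
  have hpt : p < t := prevBorder_lt hpos
  set c := I.content b ⟨t, hth⟩ with hcdef
  set c' := I.content b ⟨p, hpt.trans hth⟩ with hcdef'
  have hct : (I.init (Sum.inl b)).1[t]? = some c := I.init_inl_getElem? b hth
  have hcp : (I.init (Sum.inl b)).1[p]? = some c' := I.init_inl_getElem? b (hpt.trans hth)
  have hcc : c ≠ c' := by
    intro h
    refine getElem?_ne_of_mem_borders hbord hz ?_
    rw [hct, h, ← hcp]
    refine getElem?_eq_of_no_border (s := t) (le_length_of_mem_borders hbord)
      (fun j hj hjl => le_prevBorder hj hjl) (Nat.le_sub_one_of_lt hpt) (by omega)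
  have hvc : (c : ℕ) ≠ c' := fun h => hcc (Fin.ext h)
  have hcell : M (40 + I.n + 2 * I.m + (b * I.h + t)) = c := hM.colorAbove b ⟨t, hth⟩
  have hcell' : M (40 + I.n + 2 * I.m + (b * I.h + p)) = c' :=
    hM.colorAbove b ⟨p, hpt.trans hth⟩
  have hcellp : M (40 + I.n + 2 * I.m + I.n * I.h + (b * I.h + t)) = p :=
    hM.borderBelow b ⟨t, hth⟩
  obtain ⟨M', hrun, hrej, hacc⟩ := halts_of_border h0' hM.fullBins hM.colors hM.capacity b.2 ht hpos
    hcell hcellp hcell' c.2 c'.2 hvc rfl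
  rw [hM.tableF c, hM.tableG c] at hrej hacc
  -- the table after the transition
  let τ' : I.Bin → ℕ := Function.update τ (Sum.inl b) p
  have heq : ∀ a, a ≠ Sum.inl b → τ a = τ' a := fun a ha => by simp [τ', ha]
  have hτ'b : τ' (Sum.inl b) = p := by simp [τ']
  have hGc : ∀ x, countG I.init τ x = countGWithout I.init τ (Sum.inl b) x +
      if x = c then I.h - t else 0 := by
    intro x
    rw [countG_eq_countGWithout_add I.init τ (Sum.inl b) x, ← htdef, hct]
    congr 1
    simp [hz, eq_comm]
  have hG' : ∀ x, countG I.init τ' x = countGWithout I.init τ (Sum.inl b) x +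
      if p ≠ 0 ∧ x = c' then I.h - p else 0 := by
    intro x
    rw [countG_eq_countGWithout_add I.init τ' (Sum.inl b) x, hτ'b, hcp,
      ← countGWithout_congr heq]
    congr 1
    simp [eq_comm]
  have hF' : ∀ x, countF I.init τ' x = countF I.init τ x + if x = c' then t - p else 0 := by
    intro x
    have := countF_of_prevBorder hbord hpos heq hτ'b (hτ'b.symm ▸ hcp) x
    rwa [hτ'b] at this
  have hWc : countG I.init τ c - (I.h - t) = countGWithout I.init τ (Sum.inl b) c := by
    rw [hGc c, if_pos rfl]; omega
  -- the numbers `M_x` before, in between and after, in natural numbers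
  let m₀ : Fin I.m → ℕ := fun x => ceilDiff (countF I.init τ x) (countG I.init τ x) I.h
  let m₁ : Fin I.m → ℕ := fun x =>
    ceilDiff (countF I.init τ x) (countGWithout I.init τ (Sum.inl b) x) I.h
  let m₂ : Fin I.m → ℕ := fun x => ceilDiff (countF I.init τ' x) (countG I.init τ' x) I.h
  have hm₀ : M 35 = ∑ x, m₀ x := by
    have := hM.totalM
    rw [Finset.sum_congr rfl fun x _ => countM_eq I.h_pos x] at this
    exact_mod_cast this
  have h01 : ∀ x, x ≠ c → m₁ x = m₀ x := by
    intro x hx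
    simp only [m₀, m₁]
    rw [hGc x, if_neg hx, Nat.add_zero]
  have h12 : ∀ x, x ≠ c' → m₂ x = m₁ x := by
    intro x hx
    simp only [m₁, m₂]
    rw [hF' x, hG' x, if_neg hx, if_neg (fun h => hx h.2), Nat.add_zero, Nat.add_zero]
  have hs01 := sum_add_of_eq_off h01
  have hs12 := sum_add_of_eq_off h12
  have hle0 : m₀ c ≤ ∑ x, m₀ x :=
    Finset.single_le_sum (f := m₀) (fun _ _ => Nat.zero_le _) (Finset.mem_univ c)
  have hle1 : m₁ c' ≤ ∑ x, m₁ x :=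
    Finset.single_le_sum (f := m₁) (fun _ _ => Nat.zero_le _) (Finset.mem_univ c')
  rw [hWc] at hrej hacc
  have hT : M 35 + ceilDiff (countF I.init τ c) (countGWithout I.init τ (Sum.inl b) c) I.h -
      ceilDiff (countF I.init τ c) (countG I.init τ c) I.h = ∑ x, m₁ x := by
    change M 35 + m₁ c - m₀ c = _
    omega
  rw [hT, hM.totalMono] at hrej hacc
  have hlegal : ∀ σ, TableMove I.init (Sum.inl b) τ σ ↔ σ = τ' ∧
      ∑ x, m₁ x ≤ (monoBins τ).card := by
    intro σ
    have hsum : ∑ x, countMWithout I.init τ (Sum.inl b) x = ((∑ x, m₁ x : ℕ) : ℤ) := by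
      push_cast
      exact Finset.sum_congr rfl fun x _ => countMWithout_eq I.h_pos x
    unfold TableMove
    rw [hsum]
    constructor
    · rintro ⟨h1, -, h3, h4⟩
      refine ⟨funext fun a => ?_, by exact_mod_cast h4⟩
      by_cases ha : a = Sum.inl b
      · subst ha; rw [h3, hτ'b]
      · rw [← h1 a ha, heq a ha]
    · rintro ⟨rfl, h4⟩
      exact ⟨heq, hpos, hτ'b, by exact_mod_cast h4⟩
  refine ⟨M', hrun, fun σ hσ => ?_, fun hno => hrej ?_⟩
  swap
  · by_contra hle
    exact hno ⟨τ', (hlegal τ').2 ⟨rfl, not_lt.1 hle⟩⟩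
  obtain ⟨rfl, hle⟩ := (hlegal σ).1 hσ
  obtain ⟨h1, htab, hGcell, hFcell, hGcell', h35, h36, hframe⟩ := hacc hle
  have hnewF : M' (40 + I.n + c') = countF I.init τ' c' := by
    rw [hFcell, hM.tableF c', hF' c', if_pos rfl]
  have hWc' : countG I.init τ c' = countGWithout I.init τ (Sum.inl b) c' := by
    rw [hGc c', if_neg (Ne.symm hcc), Nat.add_zero]
  have hnewG : M' (40 + I.n + I.m + c') = countG I.init τ' c' := by
    rw [hGcell', hM.tableG c', hG' c', hWc']
    congr 1
    by_cases hp0 : p = 0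
    · simp [hp0]
    · simp [hp0]
  have hnewGc : M' (40 + I.n + I.m + c) = countG I.init τ' c := by
    rw [hGcell, hG' c, if_neg (fun h => hcc h.2), Nat.add_zero]
  have hb := b.2
  have hcm := c.2
  have hcm' := c'.2
  refine ⟨h1, ?_, ?_, ?_, ?_, ?_, fun a => ?_, fun x => ?_, fun x => ?_, fun a i => ?_,
    fun a i => ?_⟩
  · rw [hframe 32 le_rfl (by omega) (by omega) (by omega) (by omega) (by omega) (by omega),
      hM.capacity]
  · rw [hframe 33 (by omega) (by omega) (by omega) (by omega) (by omega) (by omega) (by omega),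
      hM.fullBins]
  · rw [hframe 34 (by omega) (by omega) (by omega) (by omega) (by omega) (by omega) (by omega),
      hM.colors]
  · rw [Finset.sum_congr rfl fun x _ => countM_eq I.h_pos x, ← Nat.cast_sum]
    congr 1
    change M' 35 = ∑ x, m₂ x
    rw [h35, hnewF, hnewG, hM.tableF c', hM.tableG c', hWc']
    change ∑ x, m₁ x + m₂ c' - m₁ c' = _
    omega
  · rw [h36, monoBins_card_of_prevBorder hpos heq, hτ'b]
  · by_cases hab : a = b
    · subst hab; rw [htab, hτ'b]
    · have hne : (a : ℕ) ≠ b := fun h => hab (Fin.ext h)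
      have ha := a.2
      rw [hframe _ (by omega) (by omega) (by omega) (by omega) (by omega) (by omega) (by omega),
        hM.table a]
      exact heq _ fun h => hab (Sum.inl_injective h)
  · by_cases hx : x = c'
    · subst hx; exact hnewF
    · have hne : (x : ℕ) ≠ c' := fun h => hx (Fin.ext h)
      have hxm := x.2
      rw [hframe _ (by omega) (by omega) (by omega) (by omega) (by omega) (by omega) (by omega),
        hM.tableF x, hF' x, if_neg hx, Nat.add_zero]
  · by_cases hx : x = c'
    · subst hx; exact hnewG
    by_cases hxc : x = c
    · subst hxc; exact hnewGc
    have hne : (x : ℕ) ≠ c' := fun h => hx (Fin.ext h)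
    have hne' : (x : ℕ) ≠ c := fun h => hxc (Fin.ext h)
    have hxm := x.2
    rw [hframe _ (by omega) (by omega) (by omega) (by omega) (by omega) (by omega) (by omega),
      hM.tableG x, hGc x, if_neg hxc, hG' x, if_neg (fun h => hx h.2)]
  · rw [hframe _ (by omega) (by omega) (by omega) (by omega) (by omega) (by omega) (by omega),
      hM.colorAbove a i]
  · rw [hframe _ (by omega) (by omega) (by omega) (by omega) (by omega) (by omega) (by omega),
      hM.borderBelow a i]

/-! ### Programs over counters and a word, and their Turing machines -/

section Programs

variable {A : Type}

/-- Structured programs that work on counters and on a word, the part of which that has been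
read is kept aside. -/
inductive Prog (A : Type) : Type
  /-- increment the counter `r` -/
  | inc (r : ℕ)
  /-- decrement the counter `r`, unless it is zero -/
  | dec (r : ℕ)
  /-- run `p`, and then `q` -/
  | seq (p q : Prog A)
  /-- as long as the counter `r` is positive, decrement it and run `p` -/
  | loop (r : ℕ) (p : Prog A)
  /-- read one symbol of the word -/
  | fwd
  /-- read the word to its end, adding the number of its symbols to the counter `r` -/
  | scan (r : ℕ)
  /-- increment the counter `r` if the next symbol of the word is `s` -/
  | test (s : A) (r : ℕ)
  /-- return to the beginning of the word -/
  | rewind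

/-- The data of a program: the unread part of the word, the part that has been read (in reverse
order), and the counters. -/
structure Store (A : Type) : Type where
  inp : List A
  bak : List A
  reg : ℕ → ℕ

/-- `Run p S S' t`: the program `p` turns `S` into `S'` in `t` steps. -/
inductive Run [DecidableEq A] : Prog A → Store A → Store A → ℕ → Prop
  | inc (z y g r) : Run (.inc r) ⟨z, y, g⟩ ⟨z, y, Function.update g r (g r + 1)⟩ 1
  | dec (z y g r) : Run (.dec r) ⟨z, y, g⟩ ⟨z, y, Function.update g r (g r - 1)⟩ 1
  | seq {p q S S' S'' t t'} : Run p S S' t → Run q S' S'' t' → Run (.seq p q) S S'' (t + t')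
  | loop_zero {r p z y g} : g r = 0 → Run (.loop r p) ⟨z, y, g⟩ ⟨z, y, g⟩ 1
  | loop_succ {r p z y g k S' S'' t t'} : g r = k + 1 →
      Run p ⟨z, y, Function.update g r k⟩ S' t → Run (.loop r p) S' S'' t' →
      Run (.loop r p) ⟨z, y, g⟩ S'' (1 + t + t')
  | fwd_nil (y g) : Run .fwd ⟨[], y, g⟩ ⟨[], y, g⟩ 1
  | fwd_cons (a z y g) : Run .fwd ⟨a :: z, y, g⟩ ⟨z, a :: y, g⟩ 1
  | scan_nil (y g r) : Run (.scan r) ⟨[], y, g⟩ ⟨[], y, g⟩ 1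
  | scan_cons {a z y g r S' t} : Run (.scan r) ⟨z, a :: y, Function.update g r (g r + 1)⟩ S' t →
      Run (.scan r) ⟨a :: z, y, g⟩ S' (1 + t)
  | test (z y g s r) : Run (.test s r) ⟨z, y, g⟩
      ⟨z, y, Function.update g r (g r + if z.head? = some s then 1 else 0)⟩ 1
  | rewind_nil (z g) : Run .rewind ⟨z, [], g⟩ ⟨z, [], g⟩ 1
  | rewind_cons {a z y g S' t} : Run .rewind ⟨a :: z, y, g⟩ S' t →
      Run .rewind ⟨z, a :: y, g⟩ S' (1 + t)

namespace Prog

/-- A bound for the counters that a program uses. -/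
def bound : Prog A → ℕ
  | inc r => r
  | dec r => r
  | seq p q => max p.bound q.bound
  | loop r p => max r p.bound
  | fwd => 0
  | scan r => r
  | test _ r => r
  | rewind => 0

/-- The positions in a program. They are the labels of its Turing machine. -/
def Pos : Prog A → Type
  | seq p q => p.Pos ⊕ q.Pos
  | loop _ p => Option p.Pos
  | _ => Unit

noncomputable instance Pos.fintype : (p : Prog A) → Fintype p.Pos
  | inc _ => inferInstanceAs (Fintype Unit)
  | dec _ => inferInstanceAs (Fintype Unit)
  | seq p q => by
    have := Pos.fintype p
    have := Pos.fintype q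
    exact inferInstanceAs (Fintype (p.Pos ⊕ q.Pos))
  | loop _ p => by
    have := Pos.fintype p
    exact inferInstanceAs (Fintype (Option p.Pos))
  | fwd => inferInstanceAs (Fintype Unit)
  | scan _ => inferInstanceAs (Fintype Unit)
  | test _ _ => inferInstanceAs (Fintype Unit)
  | rewind => inferInstanceAs (Fintype Unit)

/-- The position where a program starts. -/
def entry : (p : Prog A) → p.Pos
  | inc _ => ()
  | dec _ => ()
  | seq p _ => Sum.inl p.entry
  | loop _ _ => (none : Option _)
  | fwd => ()
  | scan _ => ()
  | test _ _ => ()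
  | rewind => ()

end Prog

/-- The stacks of the machine: `none` for the output, two for the word, and one for each counter
up to `N`. -/
abbrev Stack (N : ℕ) : Type := Option (Bool ⊕ Fin (N + 1))

/-- The stack of the unread part of the word, which is the input stack. -/
abbrev inpStack (N : ℕ) : Stack N := some (Sum.inl false)

/-- The stack of the part of the word that has been read. -/
abbrev bakStack (N : ℕ) : Stack N := some (Sum.inl true)

/-- The stack of a counter. -/
abbrev regStack (N : ℕ) (r : ℕ) : Stack N := some (Sum.inr (Fin.ofNat (N + 1) r))

/-- The alphabets of the stacks. The counters are unary; their stacks contain copies of one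
symbol. -/
abbrev StackAlphabet (A : Type) (N : ℕ) : Stack N → Type
  | none => Bool
  | some _ => A

/-- The contents of the stacks that correspond to a store. -/
def Store.stacks [Inhabited A] (N : ℕ) (S : Store A) : (k : Stack N) → List (StackAlphabet A N k)
  | none => []
  | some (Sum.inl false) => S.inp
  | some (Sum.inl true) => S.bak
  | some (Sum.inr i) => List.replicate (S.reg i) default

section Code

open Turing TM2 Stmt

variable [Inhabited A] [DecidableEq A]

/-- The statements of the Turing machine of a program, which is embedded by `f` into a larger
machine and continues at the label `ex`. The internal state holds the symbol that has been popped
last; between the steps it is `none`. -/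
def Prog.code (N : ℕ) {Λ : Type} : (p : Prog A) → (p.Pos → Λ) → Λ → p.Pos →
    Stmt (StackAlphabet A N) Λ (Option A)
  | inc r, _, ex, _ => push (regStack N r) (fun _ => (default : A)) (goto fun _ => ex)
  | dec r, _, ex, _ => pop (regStack N r) (fun _ _ => none) (goto fun _ => ex)
  | seq p q, f, ex, pos => match pos with
    | Sum.inl i => p.code N (fun j => f (Sum.inl j)) (f (Sum.inr q.entry)) i
    | Sum.inr i => q.code N (fun j => f (Sum.inr j)) ex i
  | loop r p, f, ex, pos => match pos with
    | none => pop (regStack N r) (fun _ (o : Option A) => o)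
        (branch (fun s => s.isSome) (load (fun _ => none) (goto fun _ => f (some p.entry)))
          (goto fun _ => ex))
    | some i => p.code N (fun j => f (some j)) (f (none : Option p.Pos)) i
  | fwd, _, ex, _ => pop (inpStack N) (fun _ (o : Option A) => o)
      (branch (fun s => s.isSome)
        (push (bakStack N) (fun s => (s.getD default : A)) (load (fun _ => none) (goto fun _ => ex)))
        (goto fun _ => ex))
  | scan r, f, ex, _ => pop (inpStack N) (fun _ (o : Option A) => o)
      (branch (fun s => s.isSome)
        (push (bakStack N) (fun s => (s.getD default : A)) (push (regStack N r)
          (fun _ => (default : A)) (load (fun _ => none) (goto fun _ => f ()))))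
        (goto fun _ => ex))
  | test s r, _, ex, _ => peek (inpStack N) (fun _ (o : Option A) => o)
      (branch (fun o => decide (o = some s))
        (push (regStack N r) (fun _ => (default : A)) (load (fun _ => none) (goto fun _ => ex)))
        (load (fun _ => none) (goto fun _ => ex)))
  | rewind, f, ex, _ => pop (bakStack N) (fun _ (o : Option A) => o)
      (branch (fun s => s.isSome)
        (push (inpStack N) (fun s => (s.getD default : A))
          (load (fun _ => none) (goto fun _ => f ())))
        (goto fun _ => ex))

variable {N : ℕ}

theorem fin_ofNat_eq_iff {r : ℕ} (hr : r ≤ N) (i : Fin (N + 1)) :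
    i = Fin.ofNat (N + 1) r ↔ (i : ℕ) = r := by
  rw [Fin.ext_iff, Fin.val_ofNat, Nat.mod_eq_of_lt (by omega)]

theorem stacks_reg {z y : List A} {g : ℕ → ℕ} {r : ℕ} (hr : r ≤ N) :
    Store.stacks N ⟨z, y, g⟩ (regStack N r) = List.replicate (g r) default := by
  simp [Store.stacks, Nat.mod_eq_of_lt (show r < N + 1 by omega)]

theorem update_stacks_reg {z y : List A} {g : ℕ → ℕ} {r k : ℕ} (hr : r ≤ N) :
    Function.update (Store.stacks N ⟨z, y, g⟩) (regStack N r) (List.replicate k default) =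
      Store.stacks N ⟨z, y, Function.update g r k⟩ := by
  funext i
  rcases i with _ | (_ | _) | i
  · simp [Store.stacks]
  · simp [Store.stacks]
  · simp [Store.stacks]
  · by_cases hi : i = Fin.ofNat (N + 1) r
    · subst hi
      rw [Function.update_self]
      simp [Store.stacks, Nat.mod_eq_of_lt (show r < N + 1 by omega)]
    · have hi' : (i : ℕ) ≠ r := fun h => hi ((fin_ofNat_eq_iff hr i).2 h)
      rw [Function.update_of_ne (by simpa using hi)]
      simp [Store.stacks, hi']

theorem update_stacks_inp {z z' y : List A} {g : ℕ → ℕ} :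
    Function.update (Store.stacks N ⟨z, y, g⟩) (inpStack N) z' = Store.stacks N ⟨z', y, g⟩ := by
  funext i
  rcases i with _ | (_ | _) | i <;> simp [Store.stacks]

theorem update_stacks_bak {z y y' : List A} {g : ℕ → ℕ} :
    Function.update (Store.stacks N ⟨z, y, g⟩) (bakStack N) y' = Store.stacks N ⟨z, y', g⟩ := by
  funext i
  rcases i with _ | (_ | _) | i <;> simp [Store.stacks]

/-- `t` steps of a machine lead from `a` to `b`. -/
def Steps {Λ : Type} (M : Λ → Stmt (StackAlphabet A N) Λ (Option A)) (t : ℕ)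
    (a b : Cfg (StackAlphabet A N) Λ (Option A)) : Prop :=
  (flip bind (TM2.step M))^[t] (some a) = some b

theorem Steps.trans {Λ : Type} {M : Λ → Stmt (StackAlphabet A N) Λ (Option A)} {t t' : ℕ}
    {a b c : Cfg (StackAlphabet A N) Λ (Option A)} (h : Steps M t a b) (h' : Steps M t' b c) :
    Steps M (t + t') a c := by
  unfold Steps at *
  rw [Nat.add_comm t t', Function.iterate_add_apply, h, h']

theorem Steps.single {Λ : Type} {M : Λ → Stmt (StackAlphabet A N) Λ (Option A)} {l : Λ}
    {s : Option A} {st : (k : Stack N) → List (StackAlphabet A N k)}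
    {b : Cfg (StackAlphabet A N) Λ (Option A)}
    (h : TM2.stepAux (M l) s st = b) : Steps M 1 ⟨some l, s, st⟩ b := by
  change TM2.step M ⟨some l, s, st⟩ = some b
  rw [← h]; rfl

/-- The Turing machine of a program carries out its runs, with the same number of steps. -/
theorem Run.steps {p : Prog A} {S S' : Store A} {t : ℕ} (h : Run p S S' t) {Λ : Type}
    {M : Λ → Stmt (StackAlphabet A N) Λ (Option A)} (hN : p.bound ≤ N) (f : p.Pos → Λ) (ex : Λ)
    (hM : ∀ i, M (f i) = p.code N f ex i) :
    Steps M t ⟨some (f p.entry), none, S.stacks N⟩ ⟨some ex, none, S'.stacks N⟩ := by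
  induction h generalizing ex with
  | inc z y g r =>
    refine Steps.single ?_
    rw [hM]
    simp only [Prog.code, stepAux, stacks_reg (show r ≤ N from hN), ← List.replicate_succ]
    rw [update_stacks_reg (show r ≤ N from hN)]
  | dec z y g r =>
    refine Steps.single ?_
    rw [hM]
    simp only [Prog.code, stepAux, stacks_reg (show r ≤ N from hN), List.tail_replicate]
    rw [update_stacks_reg (show r ≤ N from hN)]
  | @seq p q _ _ _ _ _ h1 h2 ih1 ih2 =>
    have hb := max_le_iff.1 hN
    exact (ih1 hb.1 (fun j => f (Sum.inl j)) _ fun i => hM (Sum.inl i)).trans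
      (ih2 hb.2 (fun j => f (Sum.inr j)) _ fun i => hM (Sum.inr i))
  | @loop_zero r p z y g h0 =>
    have hb := max_le_iff.1 hN
    refine Steps.single ?_
    rw [hM]
    simp only [Prog.code, Prog.entry, stepAux, stacks_reg hb.1, h0, List.replicate_zero,
      List.head?_nil, List.tail_nil, Option.isSome_none, cond_false]
    rw [← List.replicate_zero (a := (default : A)), update_stacks_reg hb.1, ← h0,
      Function.update_eq_self]
  | @loop_succ r p z y g k _ _ _ _ h0 _ _ ih1 ih2 =>
    have hb := max_le_iff.1 hN
    have h1 : Steps M 1 ⟨some (f (none : Option p.Pos)), none, Store.stacks N ⟨z, y, g⟩⟩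
        ⟨some (f (some p.entry)), none, Store.stacks N ⟨z, y, Function.update g r k⟩⟩ := by
      refine Steps.single ?_
      rw [hM (none : Option p.Pos)]
      simp only [Prog.code, stepAux, stacks_reg hb.1, h0, List.replicate_succ, List.head?_cons,
        List.tail_cons, Option.isSome_some, cond_true]
      rw [update_stacks_reg hb.1]
    exact (h1.trans (ih1 hb.2 (fun j => f (some j)) _ fun i => hM (some i))).trans
      (ih2 hN f ex hM)
  | fwd_nil y g =>
    refine Steps.single ?_
    rw [hM]
    have e : Store.stacks N ⟨[], y, g⟩ (inpStack N) = ([] : List A) := rfl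
    simp only [Prog.code, stepAux, e, List.head?_nil, List.tail_nil, Option.isSome_none, cond_false]
    rw [update_stacks_inp]
  | fwd_cons a z y g =>
    refine Steps.single ?_
    rw [hM]
    have e : Store.stacks N ⟨a :: z, y, g⟩ (inpStack N) = a :: z := rfl
    simp only [Prog.code, stepAux, e, List.head?_cons, List.tail_cons, Option.isSome_some,
      cond_true, Option.getD_some]
    rw [update_stacks_inp, update_stacks_bak]
    rfl
  | scan_nil y g r =>
    refine Steps.single ?_
    rw [hM]
    have e : Store.stacks N ⟨[], y, g⟩ (inpStack N) = ([] : List A) := rfl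
    simp only [Prog.code, stepAux, e, List.head?_nil, List.tail_nil, Option.isSome_none, cond_false]
    rw [update_stacks_inp]
  | @scan_cons a z y g r _ _ _ ih =>
    refine Steps.trans (Steps.single ?_) (ih hN f ex hM)
    rw [hM]
    have e : Store.stacks N ⟨a :: z, y, g⟩ (inpStack N) = a :: z := rfl
    have e' : Store.stacks N ⟨z, y, g⟩ (bakStack N) = y := rfl
    simp only [Prog.code, stepAux, e, List.head?_cons, List.tail_cons, Option.isSome_some,
      cond_true, Option.getD_some]
    rw [update_stacks_inp, e', update_stacks_bak, stacks_reg (show r ≤ N from hN),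
      ← List.replicate_succ, update_stacks_reg (show r ≤ N from hN)]
    rfl
  | test z y g s r =>
    refine Steps.single ?_
    rw [hM]
    have e : Store.stacks N ⟨z, y, g⟩ (inpStack N) = z := rfl
    simp only [Prog.code, stepAux, e]
    by_cases h : z.head? = some s
    · simp only [h, decide_true, cond_true, if_true, stacks_reg (show r ≤ N from hN),
        ← List.replicate_succ]
      rw [update_stacks_reg (show r ≤ N from hN)]
    · simp only [h, decide_false, cond_false, if_false, Nat.add_zero, Function.update_eq_self]
  | rewind_nil z g =>
    refine Steps.single ?_
    rw [hM]
    have e : Store.stacks N ⟨z, [], g⟩ (bakStack N) = ([] : List A) := rfl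
    simp only [Prog.code, stepAux, e, List.head?_nil, List.tail_nil, Option.isSome_none, cond_false]
    rw [update_stacks_bak]
  | @rewind_cons a z y g _ _ _ ih =>
    refine Steps.trans (Steps.single ?_) (ih hN f ex hM)
    rw [hM]
    have e : Store.stacks N ⟨z, a :: y, g⟩ (bakStack N) = a :: y := rfl
    have e' : Store.stacks N ⟨z, y, g⟩ (inpStack N) = z := rfl
    simp only [Prog.code, stepAux, e, List.head?_cons, List.tail_cons, Option.isSome_some,
      cond_true, Option.getD_some]
    rw [update_stacks_bak, e', update_stacks_inp]
    rfl

/-- The statement that ends the computation: it empties the input stack and moves the value of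
the counter 1, which is 0 or 1, to the output. -/
def finish (N : ℕ) {Λ : Type} (l : Λ) : Stmt (StackAlphabet A N) Λ (Option A) :=
  pop (inpStack N) (fun _ (o : Option A) => o)
    (branch (fun s => s.isSome) (load (fun _ => none) (goto fun _ => l))
      (pop (regStack N 1) (fun _ (o : Option A) => o)
        (push (none : Stack N) (fun s => s.isSome) (load (fun _ => none) halt))))

theorem steps_finish {Λ : Type} {M : Λ → Stmt (StackAlphabet A N) Λ (Option A)} {l : Λ}
    (hM : M l = finish N l) (hN : 1 ≤ N) (z : List A) (b : Bool) :
    Steps M (z.length + 1)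
      ⟨some l, none, Store.stacks N ⟨z, [], Function.update (fun _ => 0) 1 b.toNat⟩⟩
      ⟨none, none, Function.update (Store.stacks N (⟨[], [], fun _ => 0⟩ : Store A))
        (none : Stack N) [b]⟩ := by
  induction z with
  | nil =>
    refine Steps.single ?_
    rw [hM]
    have e : Store.stacks N ⟨[], [], Function.update (fun _ => 0) 1 b.toNat⟩ (inpStack N) =
      ([] : List A) := rfl
    simp only [finish, stepAux, e, List.head?_nil, List.tail_nil, Option.isSome_none, cond_false]
    rw [update_stacks_inp, stacks_reg hN, List.tail_replicate, update_stacks_reg hN,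
      Function.update_self, Function.update_idem]
    have h0 : b.toNat - 1 = 0 := by cases b <;> rfl
    have hb : (List.replicate b.toNat (default : A)).head?.isSome = b := by cases b <;> rfl
    rw [h0, hb, Function.update_eq_self_iff.2 rfl]
    rfl
  | cons a z ih =>
    rw [List.length_cons, Nat.add_comm (z.length + 1)]
    refine Steps.trans (Steps.single ?_) ih
    rw [hM]
    have e : Store.stacks N ⟨a :: z, [], Function.update (fun _ => 0) 1 b.toNat⟩ (inpStack N) =
      a :: z := rfl
    simp only [finish, stepAux, e, List.head?_cons, List.tail_cons, Option.isSome_some, cond_true]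
    rw [update_stacks_inp]

end Code

end Programs

/-! ### Arithmetic terms with bounded sums, and their compilation -/

/-- Terms for numbers that depend on a word and on variables (numbered from the innermost one).
All of them can be computed in polynomial time. -/
inductive WordTerm (A : Type) : Type
  /-- a variable -/
  | var (i : ℕ)
  /-- the number 1 -/
  | one
  /-- the length of the word -/
  | len
  | add (a b : WordTerm A)
  /-- the truncated difference -/
  | sub (a b : WordTerm A)
  /-- the sum of `e` over all values smaller than `a` of a new variable -/
  | sum (a e : WordTerm A)
  /-- 1 if the symbol of the word at the position `a` is `s`, and 0 otherwise -/
  | sym (s : A) (a : WordTerm A)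

/-- The assignment `v` after a new variable with the value `i` has been introduced. -/
def consVar {β : Type} (i : β) (v : ℕ → β) : ℕ → β
  | 0 => i
  | n + 1 => v n

section Terms

variable {A : Type} [DecidableEq A]

namespace WordTerm

/-- The value of a term. -/
def eval (z : List A) : WordTerm A → (ℕ → ℕ) → ℕ
  | var i, v => v i
  | one, _ => 1
  | len, _ => z.length
  | add a b, v => a.eval z v + b.eval z v
  | sub a b, v => a.eval z v - b.eval z v
  | sum a e, v => ∑ i ∈ Finset.range (a.eval z v), e.eval z (consVar i v)
  | sym s a, v => if z[a.eval z v]? = some s then 1 else 0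

/-- The renaming of variables under a new variable. -/
def liftVar (ρ : ℕ → ℕ) : ℕ → ℕ := consVar 0 fun n => ρ n + 1

/-- The renaming of variables. -/
def rename : (ℕ → ℕ) → WordTerm A → WordTerm A
  | ρ, var i => var (ρ i)
  | _, one => one
  | _, len => len
  | ρ, add a b => add (a.rename ρ) (b.rename ρ)
  | ρ, sub a b => sub (a.rename ρ) (b.rename ρ)
  | ρ, sum a e => sum (a.rename ρ) (e.rename (liftVar ρ))
  | ρ, sym s a => sym s (a.rename ρ)

theorem eval_rename (z : List A) (e : WordTerm A) (ρ v : ℕ → ℕ) :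
    (e.rename ρ).eval z v = e.eval z (fun i => v (ρ i)) := by
  induction e generalizing ρ v with
  | var i => rfl
  | one => rfl
  | len => rfl
  | add a b iha ihb => simp only [rename, eval, iha, ihb]
  | sub a b iha ihb => simp only [rename, eval, iha, ihb]
  | sum a e iha ihe =>
    simp only [rename, eval, iha, ihe]
    refine Finset.sum_congr rfl fun i _ => ?_
    congr 1
    funext n
    cases n <;> rfl
  | sym s a iha => simp only [rename, eval, iha]

/-- A program that adds the value of a term to the counter `t`. The variable `i` is held by the
counter `ρ i`; the counters from `d` on are working space. -/
def compile : WordTerm A → (ρ : ℕ → ℕ) → (t d : ℕ) → Prog A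
  | var i, ρ, t, d =>
    .seq (.loop (ρ i) (.inc d)) (.loop d (.seq (.inc (ρ i)) (.inc t)))
  | one, _, t, _ => .inc t
  | len, _, t, _ => .seq (.scan t) .rewind
  | add a b, ρ, t, d => .seq (a.compile ρ t d) (b.compile ρ t d)
  | sub a b, ρ, t, d =>
    .seq (a.compile ρ d (d + 1)) (.seq (b.compile ρ (d + 1) (d + 2))
      (.seq (.loop (d + 1) (.dec d)) (.loop d (.inc t))))
  | sum a e, ρ, t, d =>
    .seq (a.compile ρ d (d + 1)) (.seq
      (.loop d (.seq (e.compile (consVar (d + 1) ρ) t (d + 2)) (.inc (d + 1))))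
      (.loop (d + 1) (.dec d)))
  | sym s a, ρ, t, d =>
    .seq (a.compile ρ d (d + 1)) (.seq (.loop d .fwd) (.seq (.test s t) .rewind))

end WordTerm

/-- A loop whose body needs at most `c` steps. -/
theorem run_loop {r c : ℕ} {p : Prog A} (z y : ℕ → List A) (g : ℕ → ℕ → ℕ) (n : ℕ)
    (hr : ∀ k ≤ n, g k r = k)
    (hp : ∀ k < n, ∃ t ≤ c, Run p ⟨z (k + 1), y (k + 1), Function.update (g (k + 1)) r k⟩
      ⟨z k, y k, g k⟩ t) :
    ∃ t ≤ n * (c + 1) + 1, Run (.loop r p) ⟨z n, y n, g n⟩ ⟨z 0, y 0, g 0⟩ t := by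
  induction n with
  | zero => exact ⟨1, by omega, Run.loop_zero (hr 0 le_rfl)⟩
  | succ n ih =>
    obtain ⟨t, ht, hrun⟩ := ih (fun k hk => hr k (by omega)) fun k hk => hp k (by omega)
    obtain ⟨t', ht', hrun'⟩ := hp n (by omega)
    refine ⟨1 + t' + t, ?_, Run.loop_succ (hr (n + 1) le_rfl) hrun' hrun⟩
    rw [Nat.succ_mul]; omega

theorem run_scan (z y : List A) (g : ℕ → ℕ) (r : ℕ) :
    Run (.scan r) ⟨z, y, g⟩ ⟨[], z.reverse ++ y, Function.update g r (g r + z.length)⟩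
      (z.length + 1) := by
  induction z generalizing y g with
  | nil => simpa using Run.scan_nil y g r
  | cons a z ih =>
    have := Run.scan_cons (ih (a :: y) (Function.update g r (g r + 1)))
    simp only [Function.update_self, Function.update_idem] at this
    simpa [Nat.add_assoc, Nat.add_comm, Nat.add_left_comm] using this

theorem run_rewind (z y : List A) (g : ℕ → ℕ) :
    Run .rewind ⟨z, y, g⟩ ⟨y.reverse ++ z, [], g⟩ (y.length + 1) := by
  induction y generalizing z with
  | nil => exact Run.rewind_nil z g
  | cons a y ih =>
    have := Run.rewind_cons (ih (a :: z))
    simpa [Nat.add_comm] using this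

theorem run_fwds (z : List A) (g : ℕ → ℕ) (d n : ℕ) (hd : g d = n) :
    ∃ t ≤ n * 2 + 1, Run (.loop d .fwd) ⟨z, [], g⟩
      ⟨z.drop n, (z.take n).reverse, Function.update g d 0⟩ t := by
  have := run_loop (p := Prog.fwd) (r := d) (c := 1) (fun k => z.drop (n - k))
    (fun k => (z.take (n - k)).reverse) (fun k => Function.update g d k) n (by simp) ?_
  · simpa [← hd] using this
  · intro k hk
    refine ⟨1, le_rfl, ?_⟩
    have e1 : n - k = n - (k + 1) + 1 := by omega
    simp only [Function.update_idem, e1]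
    set m := n - (k + 1)
    rcases lt_or_ge m z.length with h | h
    · rw [List.drop_eq_getElem_cons h, ← List.take_concat_get' z m h, List.reverse_append]
      exact Run.fwd_cons _ _ _ _
    · rw [List.drop_eq_nil_of_le h, List.drop_eq_nil_of_le (by omega), List.take_of_length_le h,
        List.take_of_length_le (by omega)]
      exact Run.fwd_nil _ _

/-- Copying a counter with the help of an auxiliary one. -/
theorem run_copy (z : List A) {g : ℕ → ℕ} {r t d : ℕ} (hrd : r ≠ d) (hrt : r ≠ t) (htd : t ≠ d)
    (hd : g d = 0) : ∃ T ≤ 5 * g r + 2,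
      Run (.seq (.loop r (.inc d)) (.loop d (.seq (.inc r) (.inc t)))) ⟨z, [], g⟩
        ⟨z, [], Function.update g t (g t + g r)⟩ T := by
  obtain ⟨n, hn⟩ : ∃ n, g r = n := ⟨_, rfl⟩
  obtain ⟨T1, hT1, r1⟩ := run_loop (p := Prog.inc d) (r := r) (c := 1) (fun _ => z)
    (fun _ => []) (fun k => Function.update (Function.update g d (n - k)) r k) n
    (by simp) (fun k hk => ⟨1, le_rfl, by
      convert Run.inc z [] _ d using 2
      funext x
      simp only [Function.update_apply]
      split_ifs <;> omega⟩)
  obtain ⟨T2, hT2, r2⟩ := run_loop (p := Prog.seq (.inc r) (.inc t)) (r := d) (c := 2)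
    (fun _ => z) (fun _ => []) (fun k => Function.update (Function.update (Function.update g d k)
      r (n - k)) t (g t + (n - k))) n
    (by intro k _
        simp [Function.update_apply, htd.symm, hrd.symm])
    (fun k hk => ⟨1 + 1, le_rfl, by
      refine Run.seq (Run.inc z [] _ r) ?_
      convert Run.inc z [] _ t using 2
      funext x
      simp only [Function.update_apply]
      split_ifs <;> omega⟩)
  refine ⟨T1 + T2, by omega, Run.seq (S' := ⟨z, [], Function.update (Function.update g d n) r 0⟩)
    ?_ ?_⟩
  · convert r1 using 2 <;>
    · funext x
      simp only [Function.update_apply]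
      split_ifs <;> subst_vars <;> omega
  · convert r2 using 2 <;>
    · funext x
      simp only [Function.update_apply]
      split_ifs <;> subst_vars <;> omega

/-- Adding the difference of two auxiliary counters to a third one. -/
theorem run_monus (z : List A) {g : ℕ → ℕ} {t d x y : ℕ} (htd : t < d) (hd : g d = 0)
    (hd' : g (d + 1) = 0) : ∃ T ≤ 2 * x + 2 * y + 2,
      Run (.seq (.loop (d + 1) (.dec d)) (.loop d (.inc t)))
        ⟨z, [], Function.update (Function.update g d x) (d + 1) y⟩
        ⟨z, [], Function.update g t (g t + (x - y))⟩ T := by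
  obtain ⟨T1, hT1, r1⟩ := run_loop (p := Prog.dec d) (r := d + 1) (c := 1) (fun _ => z)
    (fun _ => []) (fun k => Function.update (Function.update g d (x - (y - k))) (d + 1) k) y
    (by simp) (fun k hk => ⟨1, le_rfl, by
      convert Run.dec z [] _ d using 2
      funext j
      simp only [Function.update_apply]
      split_ifs <;> omega⟩)
  obtain ⟨T2, hT2, r2⟩ := run_loop (p := Prog.inc t) (r := d) (c := 1) (fun _ => z)
    (fun _ => []) (fun k => Function.update (Function.update g d k) t (g t + (x - y - k))) (x - y)
    (by intro k _
        simp [Function.update_apply, htd.ne'])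
    (fun k hk => ⟨1, le_rfl, by
      convert Run.inc z [] _ t using 2
      funext j
      simp only [Function.update_apply]
      split_ifs <;> omega⟩)
  refine ⟨T1 + T2, by omega, Run.seq (S' := ⟨z, [], Function.update g d (x - y)⟩) ?_ ?_⟩
  · convert r1 using 2 <;>
    · funext j
      simp only [Function.update_apply]
      split_ifs <;> subst_vars <;> omega
  · convert r2 using 2 <;>
    · funext j
      simp only [Function.update_apply]
      split_ifs <;> subst_vars <;> omega

/-- Emptying a counter. -/
theorem run_clear (z : List A) {g : ℕ → ℕ} {d n : ℕ} (hd : g d = 0) (hd' : g (d + 1) = 0) :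
    ∃ T ≤ 2 * n + 1, Run (.loop (d + 1) (.dec d)) ⟨z, [], Function.update g (d + 1) n⟩
      ⟨z, [], g⟩ T := by
  obtain ⟨T, hT, r⟩ := run_loop (p := Prog.dec d) (r := d + 1) (c := 1) (fun _ => z)
    (fun _ => []) (fun k => Function.update g (d + 1) k) n
    (by simp) (fun k hk => ⟨1, le_rfl, by
      convert Run.dec z [] _ d using 2
      funext j
      simp only [Function.update_apply]
      split_ifs <;> subst_vars <;> omega⟩)
  refine ⟨T, by omega, ?_⟩
  convert r using 2
  funext j
  simp only [Function.update_apply]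
  split_ifs <;> subst_vars <;> omega

namespace WordTerm

/-- The values of a term and the running time of its program are bounded by polynomials in the
length of the word and in bounds for the variables. -/
theorem exists_run_compile (e : WordTerm A) : ∀ P : Polynomial ℕ, ∃ Q : Polynomial ℕ,
    ∀ (z : List A) (v ρ g : ℕ → ℕ) (t d : ℕ), t < d → (∀ i, ρ i < d ∧ ρ i ≠ t ∧ g (ρ i) = v i) →
      (∀ j, d ≤ j → g j = 0) → (∀ i, v i ≤ P.eval z.length) →
      e.eval z v ≤ Q.eval z.length ∧ ∃ T ≤ Q.eval z.length,
        Run (e.compile ρ t d) ⟨z, [], g⟩ ⟨z, [], Function.update g t (g t + e.eval z v)⟩ T := by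
  induction e with
  | var i =>
    intro P
    refine ⟨5 * P + 2, fun z v ρ g t d htd hρ hg hv => ?_⟩
    obtain ⟨h1, h2, h3⟩ := hρ i
    have hvi := hv i
    obtain ⟨T, hT, hr⟩ := run_copy z h1.ne h2 htd.ne (hg d le_rfl)
    rw [h3] at hT hr
    simp only [eval, Polynomial.eval_add, Polynomial.eval_mul, Polynomial.eval_ofNat]
    exact ⟨by omega, T, by omega, hr⟩
  | one =>
    intro P
    refine ⟨1, fun z v ρ g t d htd hρ hg hv => ?_⟩
    simp only [eval, Polynomial.eval_one]
    exact ⟨le_rfl, 1, le_rfl, Run.inc z [] g t⟩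
  | len =>
    intro P
    refine ⟨2 * Polynomial.X + 2, fun z v ρ g t d htd hρ hg hv => ?_⟩
    simp only [eval, Polynomial.eval_add, Polynomial.eval_mul, Polynomial.eval_ofNat,
      Polynomial.eval_X]
    have r2 := run_rewind [] (z.reverse ++ []) (Function.update g t (g t + z.length))
    refine ⟨by omega, _, ?_, Run.seq (run_scan z [] g t) (by simpa using r2)⟩
    omega
  | add a b iha ihb =>
    intro P
    obtain ⟨Qa, ha⟩ := iha P
    obtain ⟨Qb, hb⟩ := ihb P
    refine ⟨Qa + Qb, fun z v ρ g t d htd hρ hg hv => ?_⟩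
    obtain ⟨ha1, Ta, hTa, ra⟩ := ha z v ρ g t d htd hρ hg hv
    obtain ⟨hb1, Tb, hTb, rb⟩ := hb z v ρ (Function.update g t (g t + a.eval z v)) t d htd
      (fun i => ⟨(hρ i).1, (hρ i).2.1, by
        rw [Function.update_of_ne (hρ i).2.1]; exact (hρ i).2.2⟩)
      (fun j hj => by rw [Function.update_of_ne (by omega)]; exact hg j hj) hv
    simp only [eval, Polynomial.eval_add]
    refine ⟨by omega, Ta + Tb, by omega, Run.seq ra ?_⟩
    simpa [Nat.add_assoc] using rb
  | sub a b iha ihb =>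
    intro P
    obtain ⟨Qa, ha⟩ := iha P
    obtain ⟨Qb, hb⟩ := ihb P
    refine ⟨3 * Qa + 3 * Qb + 2, fun z v ρ g t d htd hρ hg hv => ?_⟩
    obtain ⟨ha1, Ta, hTa, ra⟩ := ha z v ρ g d (d + 1) (by omega)
      (fun i => ⟨by have := (hρ i).1; omega, by have := (hρ i).1; omega, (hρ i).2.2⟩)
      (fun j hj => hg j (by omega)) hv
    obtain ⟨hb1, Tb, hTb, rb⟩ := hb z v ρ (Function.update g d (g d + a.eval z v)) (d + 1) (d + 2)
      (by omega)
      (fun i => ⟨by have := (hρ i).1; omega, by have := (hρ i).1; omega, by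
        rw [Function.update_of_ne (by have := (hρ i).1; omega)]; exact (hρ i).2.2⟩)
      (fun j hj => by rw [Function.update_of_ne (by omega)]; exact hg j (by omega)) hv
    have hgd := hg d le_rfl
    have hgd' := hg (d + 1) (by omega)
    rw [hgd, Nat.zero_add] at ra rb
    rw [Function.update_of_ne (by omega), hgd', Nat.zero_add] at rb
    set x := a.eval z v with hx
    set y := b.eval z v with hy
    obtain ⟨T1, hT1, r1⟩ := run_monus z (x := x) (y := y) htd hgd hgd'
    simp only [eval, Polynomial.eval_add, Polynomial.eval_mul, Polynomial.eval_ofNat]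
    exact ⟨by omega, Ta + (Tb + T1), by omega, Run.seq ra (Run.seq rb r1)⟩
  | sum a e iha ihe =>
    intro P
    obtain ⟨Qa, ha⟩ := iha P
    obtain ⟨Qe, he⟩ := ihe (P + Qa)
    refine ⟨Qa * Qe + Qa + (Qa * (Qe + 2) + 1) + (Qa * 2 + 1), fun z v ρ g t d htd hρ hg hv => ?_⟩
    obtain ⟨ha1, Ta, hTa, ra⟩ := ha z v ρ g d (d + 1) (by omega)
      (fun i => ⟨by have := (hρ i).1; omega, by have := (hρ i).1; omega, (hρ i).2.2⟩)
      (fun j hj => hg j (by omega)) hv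
    have hgd := hg d le_rfl
    have hgd' := hg (d + 1) (by omega)
    rw [hgd, Nat.zero_add] at ra
    set n := a.eval z v with hn
    set s : ℕ → ℕ := fun m => ∑ i ∈ Finset.range m, e.eval z (consVar i v) with hs
    -- `k` rounds before the end, the new variable has the value `n - k`
    let G : ℕ → ℕ → ℕ := fun k => Function.update (Function.update (Function.update g t
      (g t + s (n - k))) (d + 1) (n - k)) d k
    have hbody : ∀ k < n, e.eval z (consVar (n - (k + 1)) v) ≤ Qe.eval z.length ∧
        ∃ T ≤ Qe.eval z.length + 1, Run (.seq (e.compile (consVar (d + 1) ρ) t (d + 2)) (.inc (d + 1)))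
          ⟨z, [], Function.update (G (k + 1)) d k⟩ ⟨z, [], G k⟩ T := by
      intro k hk
      obtain ⟨he1, Te, hTe, re⟩ := he z (consVar (n - (k + 1)) v) (consVar (d + 1) ρ)
        (Function.update (G (k + 1)) d k) t (d + 2) (by omega) (by
          intro i
          cases i with
          | zero => refine ⟨by simp [consVar], by simp [consVar]; omega, by simp [consVar, G]⟩
          | succ i =>
            obtain ⟨h1, h2, h3⟩ := hρ i
            refine ⟨by simp only [consVar]; omega, h2, ?_⟩
            simp only [consVar, G, Function.update_apply]
            rw [if_neg (by omega), if_neg (by omega), if_neg (by omega), if_neg h2, h3])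
        (by
          intro j hj
          simp only [G, Function.update_apply]
          rw [if_neg (by omega), if_neg (by omega), if_neg (by omega), if_neg (by omega)]
          exact hg j (by omega))
        (by
          intro i
          rw [Polynomial.eval_add]
          cases i with
          | zero => simp only [consVar]; omega
          | succ i => have := hv i; simp only [consVar]; omega)
      refine ⟨he1, Te + 1, by omega, Run.seq re ?_⟩
      convert Run.inc z [] _ (d + 1) using 2
      have e1 : n - k = n - (k + 1) + 1 := by omega
      have e2 : s (n - k) = s (n - (k + 1)) + e.eval z (consVar (n - (k + 1)) v) := by
        rw [e1]; exact Finset.sum_range_succ _ _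
      funext j
      simp only [G, Function.update_apply]
      split_ifs <;> omega
    obtain ⟨T1, hT1, r1⟩ := run_loop (r := d) (c := Qe.eval z.length + 1) (fun _ => z) (fun _ => []) G n
      (fun k _ => by simp [G]) fun k hk => (hbody k hk).2
    obtain ⟨T2, hT2, r2⟩ := run_clear z (g := Function.update g t (g t + s n)) (d := d) (n := n)
      (by rw [Function.update_of_ne (by omega), hgd])
      (by rw [Function.update_of_ne (by omega), hgd'])
    have hsum : s n ≤ Qa.eval z.length * Qe.eval z.length := by
      calc s n ≤ ∑ i ∈ Finset.range n, Qe.eval z.length := by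
            refine Finset.sum_le_sum fun i hi => ?_
            have hi' := Finset.mem_range.1 hi
            have := (hbody (n - 1 - i) (by omega)).1
            rwa [show n - (n - 1 - i + 1) = i by omega] at this
        _ = n * Qe.eval z.length := by simp
        _ ≤ _ := Nat.mul_le_mul_right _ ha1
    have m1 : n * (Qe.eval z.length + 1 + 1) ≤ Qa.eval z.length * (Qe.eval z.length + 2) := Nat.mul_le_mul_right _ ha1
    simp only [eval, Polynomial.eval_add, Polynomial.eval_mul, Polynomial.eval_ofNat,
      Polynomial.eval_one]
    refine ⟨by change s n ≤ _; omega, Ta + (T1 + T2), by omega, Run.seq ra (Run.seq (S' := ⟨z, [],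
      G 0⟩) ?_ ?_)⟩
    · convert r1 using 2
      funext j
      simp only [G, Nat.sub_self, hs, Finset.range_zero, Finset.sum_empty, Function.update_apply]
      split_ifs <;> subst_vars <;> omega
    · convert r2 using 2
      funext j
      simp only [G, Nat.sub_zero, Function.update_apply]
      split_ifs <;> subst_vars <;> omega
  | sym s a iha =>
    intro P
    obtain ⟨Qa, ha⟩ := iha P
    refine ⟨Qa + (Qa * 2 + 1) + 1 + (Polynomial.X + 1), fun z v ρ g t d htd hρ hg hv => ?_⟩
    obtain ⟨ha1, Ta, hTa, ra⟩ := ha z v ρ g d (d + 1) (by omega)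
      (fun i => ⟨by have := (hρ i).1; omega, by have := (hρ i).1; omega, (hρ i).2.2⟩)
      (fun j hj => hg j (by omega)) hv
    have hgd := hg d le_rfl
    rw [hgd, Nat.zero_add] at ra
    set n := a.eval z v with hn
    obtain ⟨T1, hT1, r1⟩ := run_fwds z (Function.update g d n) d n (by simp)
    have e1 : Function.update (Function.update g d n) d 0 = g := by
      rw [Function.update_idem, ← hgd, Function.update_eq_self]
    rw [e1] at r1
    have r2 := Run.test (z.drop n) (z.take n).reverse g s t
    rw [List.head?_drop] at r2
    have r3 := run_rewind (z.drop n) (z.take n).reverse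
      (Function.update g t (g t + if z[n]? = some s then 1 else 0))
    rw [List.reverse_reverse, List.take_append_drop] at r3
    simp only [eval, Polynomial.eval_add, Polynomial.eval_mul, Polynomial.eval_ofNat,
      Polynomial.eval_one, Polynomial.eval_X]
    refine ⟨by split_ifs <;> omega, _, ?_, Run.seq ra (Run.seq r1 (Run.seq r2 r3))⟩
    have : (z.take n).reverse.length ≤ z.length := by simp
    omega

end WordTerm

open Turing in
/-- A relation whose characteristic function is the value of a term is decided by a Turing machine
in polynomial time. -/
theorem WordTerm.polyTimeRelation {Γ Δ : Type} [Fintype Γ] [Fintype Δ] [DecidableEq Γ]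
    [DecidableEq Δ] [Inhabited (Γ ⊕ Δ)] {R : List Γ → List Δ → Prop} (e : WordTerm (Γ ⊕ Δ))
    (he : ∀ x y, (R x y → e.eval (pairWord (x, y)) (fun _ => 0) = 1) ∧
      (¬ R x y → e.eval (pairWord (x, y)) (fun _ => 0) = 0)) : PolyTimeRelation R := by
  classical
  obtain ⟨Q, hQ⟩ := e.exists_run_compile 0
  set p : Prog (Γ ⊕ Δ) := e.compile (fun _ => 0) 1 2 with hp
  let N := max p.bound 1
  let tm : FinTM2 :=
    { K := Stack N
      k₀ := inpStack N
      k₁ := none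
      Γ := StackAlphabet (Γ ⊕ Δ) N
      Λ := Option p.Pos
      main := some p.entry
      σ := Option (Γ ⊕ Δ)
      initialState := none
      Γk₀Fin := inferInstanceAs (Fintype (Γ ⊕ Δ))
      m := fun l => match l with
        | some i => p.code N some none i
        | none => finish N none }
  suffices h : ∀ a : List Γ × List Δ, ∃ T ≤ (Q + (Polynomial.X + 1)).eval (pairWord a).length,
      (flip bind tm.step)^[T] (some (initList tm ((pairWord a).map (Equiv.refl (Γ ⊕ Δ)).invFun))) =
        some (haltList tm ((Computability.encodeBool (decide (R a.1 a.2))).map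
          (Equiv.refl Bool).invFun)) by
    choose T hT hsteps using h
    exact ⟨{ tm := tm, inputAlphabet := Equiv.refl _, outputAlphabet := Equiv.refl _,
             time := Q + (Polynomial.X + 1), outputsFun := fun a => ⟨⟨T a, hsteps a⟩, hT a⟩ }⟩
  intro a
  set z := pairWord a with hz
  have hval : e.eval z (fun _ => 0) = (decide (R a.1 a.2)).toNat := by
    by_cases h : R a.1 a.2
    · simpa [h] using (he a.1 a.2).1 h
    · simpa [h] using (he a.1 a.2).2 h
  obtain ⟨-, T, hT, hrun⟩ := hQ z (fun _ => 0) (fun _ => 0) (fun _ => 0) 1 2 (by omega) (by simp)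
    (by simp) (by simp)
  rw [hval, Nat.zero_add] at hrun
  have s1 := hrun.steps (N := N) (M := tm.m) (le_max_left _ _) some none fun _ => rfl
  have s2 := steps_finish (N := N) (M := tm.m) (l := none) rfl (le_max_right _ _) z
    (decide (R a.1 a.2))
  have s := s1.trans s2
  have hin : List.map (Equiv.refl (Γ ⊕ Δ)).invFun z = z := by simp
  have hinit : initList tm (List.map (Equiv.refl (Γ ⊕ Δ)).invFun z) =
      ⟨some (some p.entry), none, Store.stacks N ⟨z, [], fun _ => 0⟩⟩ := by
    rw [hin]
    unfold initList
    congr 1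
    funext k
    rcases k with _ | (_ | _) | k
    · rfl
    · rfl
    · rfl
    · rfl
  have hout : haltList tm (List.map (Equiv.refl Bool).invFun
        (Computability.encodeBool (decide (R a.1 a.2)))) =
      ⟨none, none, Function.update (Store.stacks N (⟨[], [], fun _ => 0⟩ : Store (Γ ⊕ Δ)))
        (none : Stack N) [decide (R a.1 a.2)]⟩ := by
    unfold haltList
    congr 1
    funext k
    rcases k with _ | (_ | _) | k
    · rfl
    · rfl
    · rfl
    · rfl
  refine ⟨T + (z.length + 1), ?_, ?_⟩
  · simp only [Polynomial.eval_add, Polynomial.eval_X, Polynomial.eval_one]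
    omega
  · rw [hinit, hout]
    exact s

end Terms

/-! ### Functions of a pair of words that are given by terms -/

open Classical in
/-- The indicator of `p`: 1 if `p` holds, and 0 otherwise. -/
noncomputable def ind (p : Prop) : ℕ := if p then 1 else 0

theorem ind_pos {p : Prop} (h : p) : ind p = 1 := if_pos h

theorem ind_neg {p : Prop} (h : ¬ p) : ind p = 0 := if_neg h

/-- The alphabet of the words that encode an instance and a certificate. -/
abbrev PairSym : Type := Sym ⊕ Bool

/-- A type whose elements consist of an instance word, a certificate word, and further numbers, the
values of the variables. Pairing a context with a number introduces a new innermost variable. -/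
class Context (α : Type) where
  word : α → List Sym × List Bool
  vars : α → ℕ → ℕ

instance : Context (List Sym × List Bool) := ⟨id, fun _ _ => 0⟩

instance {α : Type} [Context α] : Context (α × ℕ) :=
  ⟨fun a => Context.word a.1, fun a => consVar a.2 (Context.vars a.1)⟩

noncomputable instance : DecidableEq Sym := Classical.decEq Sym

section Closure

variable {α : Type} [Context α]

/-- `f` is the value of a term in the words and numbers of the context. -/
def Arith (f : α → ℕ) : Prop :=
  ∃ e : WordTerm PairSym, ∀ a, e.eval (pairWord (Context.word a)) (Context.vars a) = f a

/-- The predicates whose indicator functions are given by terms. -/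
def ArithPred (p : α → Prop) : Prop := Arith fun a => ind (p a)

namespace Arith

variable {f g : α → ℕ}

theorem congr (hf : Arith f) (h : ∀ a, f a = g a) : Arith g :=
  hf.imp fun _ he a => (he a).trans (h a)

theorem one : Arith fun _ : α => 1 := ⟨.one, fun _ => rfl⟩

theorem add (hf : Arith f) (hg : Arith g) : Arith fun a => f a + g a := by
  obtain ⟨e, he⟩ := hf
  obtain ⟨e', he'⟩ := hg
  exact ⟨.add e e', fun a => by simp only [WordTerm.eval, he, he']⟩

theorem sub (hf : Arith f) (hg : Arith g) : Arith fun a => f a - g a := by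
  obtain ⟨e, he⟩ := hf
  obtain ⟨e', he'⟩ := hg
  exact ⟨.sub e e', fun a => by simp only [WordTerm.eval, he, he']⟩

theorem const (n : ℕ) : Arith fun _ : α => n := by
  induction n with
  | zero => exact (one.sub one).congr fun _ => rfl
  | succ n ih => exact ih.add one

/-- A function that does not depend on the last variable. -/
theorem weak (hf : Arith f) : Arith fun a : α × ℕ => f a.1 := by
  obtain ⟨e, he⟩ := hf
  refine ⟨e.rename Nat.succ, fun a => ?_⟩
  rw [WordTerm.eval_rename]
  exact he a.1

theorem last : Arith fun a : α × ℕ => a.2 := ⟨.var 0, fun _ => rfl⟩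

theorem sum {F : α → ℕ → ℕ} (hf : Arith f) (hF : Arith fun a : α × ℕ => F a.1 a.2) :
    Arith fun a => ∑ i ∈ Finset.range (f a), F a i := by
  obtain ⟨e, he⟩ := hf
  obtain ⟨e', he'⟩ := hF
  refine ⟨.sum e e', fun a => ?_⟩
  simp only [WordTerm.eval, he]
  exact Finset.sum_congr rfl fun i _ => he' (a, i)

theorem mul (hf : Arith f) (hg : Arith g) : Arith fun a => f a * g a :=
  (hf.sum (F := fun a _ => g a) hg.weak).congr fun a => by simp

end Arith

namespace ArithPred

variable {p q : α → Prop} {f g : α → ℕ}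

theorem congr (hp : ArithPred p) (h : ∀ a, p a ↔ q a) : ArithPred q :=
  Arith.congr hp fun a => by rw [propext (h a)]

theorem not (hp : ArithPred p) : ArithPred fun a => ¬ p a :=
  (Arith.one.sub hp).congr fun a => by by_cases h : p a <;> simp [ind, h]

theorem and (hp : ArithPred p) (hq : ArithPred q) : ArithPred fun a => p a ∧ q a :=
  (Arith.mul hp hq).congr fun a => by by_cases h : p a <;> by_cases h' : q a <;> simp [ind, h, h']

theorem or (hp : ArithPred p) (hq : ArithPred q) : ArithPred fun a => p a ∨ q a :=
  (hp.not.and hq.not).not.congr fun a => by tauto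

theorem imp (hp : ArithPred p) (hq : ArithPred q) : ArithPred fun a => p a → q a :=
  (hp.and hq.not).not.congr fun a => by tauto

theorem iff (hp : ArithPred p) (hq : ArithPred q) : ArithPred fun a => (p a ↔ q a) :=
  ((hp.imp hq).and (hq.imp hp)).congr fun a => by tauto

theorem le (hf : Arith f) (hg : Arith g) : ArithPred fun a => f a ≤ g a := by
  refine Arith.congr (Arith.one.sub (hf.sub hg)) fun a => ?_
  by_cases h : f a ≤ g a
  · rw [ind_pos h, Nat.sub_eq_zero_of_le h]
  · rw [ind_neg h]; omega

theorem lt (hf : Arith f) (hg : Arith g) : ArithPred fun a => f a < g a :=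
  le (hf.add .one) hg

theorem eq (hf : Arith f) (hg : Arith g) : ArithPred fun a => f a = g a :=
  ((le hf hg).and (le hg hf)).congr fun a => by omega

theorem ne (hf : Arith f) (hg : Arith g) : ArithPred fun a => f a ≠ g a := (eq hf hg).not

/-- Bounded existential quantification. -/
theorem ex {P : α → ℕ → Prop} (hf : Arith f) (hP : ArithPred fun a : α × ℕ => P a.1 a.2) :
    ArithPred fun a => ∃ i < f a, P a i := by
  refine (lt (.const 0) (Arith.sum (F := fun a i => ind (P a i)) hf hP)).congr fun a => ?_
  rw [Finset.sum_pos_iff]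
  refine exists_congr fun i => ?_
  rw [Finset.mem_range]
  by_cases h : P a i <;> simp [ind, h]

/-- Bounded universal quantification. -/
theorem all {P : α → ℕ → Prop} (hf : Arith f) (hP : ArithPred fun a : α × ℕ => P a.1 a.2) :
    ArithPred fun a => ∀ i < f a, P a i :=
  (ex (P := fun a i => ¬ P a i) hf hP.not).not.congr fun a => by push Not; rfl

end ArithPred

/-! ### Access to the two words -/

theorem sum_ind_getElem?_eq_countP {β : Type} [DecidableEq β] (l : List β) (s : β) :
    ∑ i ∈ Finset.range l.length, ind (l[i]? = some s) = l.countP fun t => decide (t = s) := by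
  induction l with
  | nil => simp
  | cons a l ih =>
    rw [List.length_cons, Finset.sum_range_succ', List.countP_cons]
    simp only [List.getElem?_cons_succ, ih, List.getElem?_cons_zero]
    by_cases h : a = s <;> simp [ind, h]

theorem sum_ind_getElem?_eq_count_take {β : Type} [DecidableEq β] (l : List β) (s : β) (j : ℕ) :
    ∑ i ∈ Finset.range j, ind (l[i]? = some s) = (l.take j).count s := by
  induction j with
  | zero => simp
  | succ j ih =>
    rw [Finset.sum_range_succ, ih, List.take_add_one, List.count_append]
    congr 1
    rcases lt_or_ge j l.length with h | h
    · rw [List.getElem?_eq_getElem h]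
      by_cases h' : l[j] = s <;> simp [ind, h']
    · rw [List.getElem?_eq_none h]; simp [ind]

theorem pairWord_getElem?_inl (x : List Sym) (y : List Bool) (i : ℕ) (s : Sym) :
    (pairWord (x, y))[i]? = some (Sum.inl s) ↔ x[i]? = some s := by
  unfold pairWord
  rcases lt_or_ge i x.length with h | h
  · rw [List.getElem?_append_left (by simpa using h)]
    simp [h]
  · rw [List.getElem?_append_right (by simpa using h), List.getElem?_eq_none h]
    simp

theorem pairWord_getElem?_inr (x : List Sym) (y : List Bool) (i : ℕ) (b : Bool) :
    (pairWord (x, y))[x.length + i]? = some (Sum.inr b) ↔ y[i]? = some b := by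
  unfold pairWord
  rw [List.getElem?_append_right (by simp)]
  simp

theorem pairWord_countP_inr (x : List Sym) (y : List Bool) (b : Bool) :
    ((pairWord (x, y)).countP fun t => decide (t = Sum.inr b)) = y.count b := by
  unfold pairWord
  rw [List.countP_append, List.countP_map, List.countP_map, List.count, List.countP_eq_zero.2,
    Nat.zero_add]
  · exact List.countP_congr fun t _ => by simp
  · simp

namespace Arith

variable {f : α → ℕ}

theorem pairSym (s : PairSym) (hf : Arith f) :
    ArithPred fun a => (pairWord (Context.word a))[f a]? = some s := by
  obtain ⟨e, he⟩ := hf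
  refine ⟨.sym s e, fun a => ?_⟩
  simp only [WordTerm.eval, he, ind]
  congr

theorem lengthPair : Arith fun a : α => (pairWord (Context.word a)).length := ⟨.len, fun _ => rfl⟩

theorem countSnd (b : Bool) : Arith fun a : α => (Context.word a).2.count b :=
  (lengthPair.sum (F := fun a i => ind ((pairWord (Context.word a))[i]? = some (Sum.inr b)))
    (pairSym (Sum.inr b) (last (α := α)))).congr fun _ =>
      (sum_ind_getElem?_eq_countP _ _).trans (pairWord_countP_inr _ _ _)

/-- The length of the certificate. -/
theorem lengthSnd : Arith fun a : α => (Context.word a).2.length := by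
  refine ((countSnd true).add (countSnd false)).congr fun a => ?_
  exact List.count_true_add_count_false _

/-- The length of the instance. -/
theorem lengthFst : Arith fun a : α => (Context.word a).1.length :=
  (lengthPair.sub lengthSnd).congr fun a => by simp [pairWord]

/-- The symbols of the instance. -/
theorem symFst (s : Sym) (hf : Arith f) : ArithPred fun a => (Context.word a).1[f a]? = some s :=
  (pairSym (Sum.inl s) hf).congr fun _ => pairWord_getElem?_inl _ _ _ _

/-- The symbols of the certificate. -/
theorem symSnd (b : Bool) (hf : Arith f) : ArithPred fun a => (Context.word a).2[f a]? = some b :=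
  (pairSym (Sum.inr b) (lengthFst.add hf)).congr fun _ => pairWord_getElem?_inr _ _ _ _

end Arith

end Closure

noncomputable instance : Fintype Sym :=
  ⟨{.bit true, .bit false, .endNumber, .endUnit, .endBin}, by rintro (_ | _) <;> simp⟩

/-- A relation between words that is given by a term is decidable in polynomial time. -/
theorem ArithPred.polyTimeRelation {R : List Sym → List Bool → Prop}
    (hR : ArithPred fun a : List Sym × List Bool => R a.1 a.2) : PolyTimeRelation R := by
  obtain ⟨e, he⟩ := hR
  have : Inhabited (Sym ⊕ Bool) := ⟨Sum.inr true⟩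
  exact e.polyTimeRelation fun x y => ⟨fun h => (he (x, y)).trans (ind_pos h),
    fun h => (he (x, y)).trans (ind_neg h)⟩

/-! ### The conditions on a certificate, in terms of positions in the words -/

/-- An instance word and a certificate word, together with the numbers that determine how the
instance is to be read: `p` digits for the number of empty bins, `n` full bins of capacity `h`, and
`w` digits for each unit. -/
structure Layout : Type where
  x : List Sym
  y : List Bool
  p : ℕ
  n : ℕ
  h : ℕ
  w : ℕ

namespace Layout

variable (l : Layout)

/-- The position of the digit `j` of the unit `i` of the bin `b`. -/
def pos (b i j : ℕ) : ℕ := l.p + 1 + b * (l.h * (l.w + 1) + 1) + i * (l.w + 1) + j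

/-- The digit at the position `q` is 1. -/
def One (q : ℕ) : Prop := l.x[q]? = some (Sym.bit true)

/-- There is a digit at the position `q`. -/
def Digit (q : ℕ) : Prop := l.x[q]? = some (Sym.bit true) ∨ l.x[q]? = some (Sym.bit false)

/-- The instance word has the form that is described by the numbers of the layout. -/
def Valid : Prop :=
  0 < l.h ∧ l.x.length = l.p + 1 + l.n * (l.h * (l.w + 1) + 1) ∧ (∀ i < l.p, l.Digit i) ∧
  (l.p = 0 ∨ l.One (l.p - 1)) ∧ l.x[l.p]? = some Sym.endNumber ∧
  ∀ b < l.n, (∀ i < l.h, (∀ j < l.w, l.Digit (l.pos b i j)) ∧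
    l.x[l.pos b i l.w]? = some Sym.endUnit) ∧ l.x[l.pos b l.h 0]? = some Sym.endBin

/-- Two units have the same color. -/
def Same (b i b' i' : ℕ) : Prop := ∀ j < l.w, (l.One (l.pos b i j) ↔ l.One (l.pos b' i' j))

/-- The number of entries of the certificate. -/
noncomputable def entries : ℕ := ∑ j ∈ Finset.range l.y.length, ind (l.y[j]? = some false)

/-- The entry `s` of the certificate: the number of symbols `true` after `s` end markers. -/
noncomputable def entry (s : ℕ) : ℕ := ∑ j ∈ Finset.range l.y.length,
  ind (l.y[j]? = some true ∧ ∑ i ∈ Finset.range j, ind (l.y[i]? = some false) = s)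

/-- `i` is a non-trivial border of the bin `b` (for `i` smaller than the capacity). Units are numbered
from zero, so that the units `i - 1` and `i` are those next to the border. -/
def IsBorder (b i : ℕ) : Prop := 1 ≤ i ∧ ¬ l.Same b (i - 1) b i

/-- The number of entries before the entry `s` that are equal to `b`. -/
noncomputable def removed (s b : ℕ) : ℕ := ∑ i ∈ Finset.range s, ind (l.entry i = b)

/-- The border of the bin `b` that is its top border before the transition `s`: above it, there are
as many borders as have been removed. -/
noncomputable def table (s b : ℕ) : ℕ := ∑ i ∈ Finset.range l.h,
  ind (l.IsBorder b i ∧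
    ∑ i' ∈ Finset.range l.h, ind (i < i' ∧ l.IsBorder b i') = l.removed s b) * i

/-- The number `F_c` before the transition `s`, for the color `c` of the unit `i` of the bin `b`. -/
noncomputable def sumF (s b i : ℕ) : ℕ := ∑ a ∈ Finset.range l.n, ∑ j ∈ Finset.range l.h,
  ind (l.table s a ≤ j ∧ l.Same a j b i)

/-- The number `G_c^e` before the transition `s`, for the entry `e` of this transition. -/
noncomputable def sumG (s b i : ℕ) : ℕ := ∑ a ∈ Finset.range l.n,
  ind (a ≠ l.entry s ∧ l.table s a ≠ 0 ∧ l.Same a (l.table s a) b i) * (l.h - l.table s a)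

/-- The number `M_c^e` before the transition `s`. -/
noncomputable def numM (s b i : ℕ) : ℕ :=
  ∑ j ∈ Finset.range (l.n * l.h), ind (j * l.h < l.sumF s b i - l.sumG s b i)

/-- The unit `i` of the bin `b` is the first unit of its color. -/
def IsFirst (b i : ℕ) : Prop :=
  ¬ ∃ b' < l.n, ∃ i' < l.h, b' * l.h + i' < b * l.h + i ∧ l.Same b' i' b i

/-- The sum of the numbers `M_c^e` over all colors `c`, each of which is represented by its first
unit. -/
noncomputable def total (s : ℕ) : ℕ := ∑ b ∈ Finset.range l.n, ∑ i ∈ Finset.range l.h,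
  ind (l.IsFirst b i) * l.numM s b i

/-- `q` is a power of two: it has no odd divisor but 1. -/
def IsPow (q : ℕ) : Prop := 0 < q ∧ ∀ d < q, ∀ e < q + 1, (2 * d + 1) * e = q → d = 0

/-- The number of powers of two below `q`, which is the binary logarithm if `q` is such a power. -/
noncomputable def logPow (q : ℕ) : ℕ := ∑ i ∈ Finset.range q, ind (IsPow i)

/-- A bound for the numbers that have to be compared with the number of empty bins. -/
def cap : ℕ := l.n * l.h * (l.n * l.h)

/-- The value of the digits of small weight of the number of empty bins. Summing over powers of two
instead of exponents avoids exponentiation, which terms do not provide. -/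
noncomputable def smallK : ℕ := ∑ q ∈ Finset.range (l.cap + 1),
  ind (IsPow q ∧ logPow q < l.p ∧ l.One (logPow q)) * q

/-- The number of empty bins has a nonzero digit of large weight. -/
def BigK : Prop := ∃ i < l.p, logPow (l.cap + 1) ≤ i ∧ l.One i

/-- There are enough monochrome bins for the transition `s`. -/
def Room (s : ℕ) : Prop :=
  l.BigK ∨ l.total s ≤ l.smallK + ∑ b ∈ Finset.range l.n, ind (l.table s b = 0)

/-- The number of units of each color is a multiple of the capacity. -/
def IsBalanced : Prop := ∀ b < l.n, ∀ i < l.h, ∃ j < l.n * l.h + 1,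
  ∑ a ∈ Finset.range l.n, ∑ i' ∈ Finset.range l.h, ind (l.Same a i' b i) = l.h * j

/-- The certificate is a sequence of numbers in unary that encodes a removal order. -/
def IsOrder : Prop :=
  (l.y.length = 0 ∨ l.y[l.y.length - 1]? = some false) ∧
  l.entries = ∑ b ∈ Finset.range l.n, ∑ i ∈ Finset.range l.h, ind (l.IsBorder b i) ∧
  ∀ s < l.entries, l.entry s < l.n ∧ l.table s (l.entry s) ≠ 0 ∧ l.Room s

end Layout

section LayoutArith

variable {α : Type} [Context α]

/-- A layout of the words of a context, with numbers that are given by terms. -/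
structure ArithLayout (l : α → Layout) : Prop where
  x : ∀ a, (l a).x = (Context.word a).1
  y : ∀ a, (l a).y = (Context.word a).2
  p : Arith fun a => (l a).p
  n : Arith fun a => (l a).n
  h : Arith fun a => (l a).h
  w : Arith fun a => (l a).w

namespace ArithLayout

variable {l : α → Layout} {b i j b' i' q s : α → ℕ}

theorem weak (hl : ArithLayout l) : ArithLayout fun a : α × ℕ => l a.1 :=
  ⟨fun a => hl.x a.1, fun a => hl.y a.1, hl.p.weak, hl.n.weak, hl.h.weak, hl.w.weak⟩

theorem pos (hl : ArithLayout l) (hb : Arith b) (hi : Arith i) (hj : Arith j) :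
    Arith fun a => (l a).pos (b a) (i a) (j a) :=
  (((hl.p.add .one).add (hb.mul ((hl.h.mul (hl.w.add .one)).add .one))).add
    (hi.mul (hl.w.add .one))).add hj

theorem sym (hl : ArithLayout l) (c : Sym) (hq : Arith q) :
    ArithPred fun a => (l a).x[q a]? = some c :=
  (Arith.symFst c hq).congr fun a => by rw [hl.x]

theorem cert (hl : ArithLayout l) (c : Bool) (hq : Arith q) :
    ArithPred fun a => (l a).y[q a]? = some c :=
  (Arith.symSnd c hq).congr fun a => by rw [hl.y]

theorem lengthX (hl : ArithLayout l) : Arith fun a => (l a).x.length :=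
  Arith.lengthFst.congr fun a => by rw [hl.x]

theorem lengthY (hl : ArithLayout l) : Arith fun a => (l a).y.length :=
  Arith.lengthSnd.congr fun a => by rw [hl.y]

theorem one (hl : ArithLayout l) (hq : Arith q) : ArithPred fun a => (l a).One (q a) :=
  hl.sym _ hq

theorem digit (hl : ArithLayout l) (hq : Arith q) : ArithPred fun a => (l a).Digit (q a) :=
  (hl.sym _ hq).or (hl.sym _ hq)

theorem valid (hl : ArithLayout l) : ArithPred fun a => (l a).Valid := by
  refine (ArithPred.lt (.const 0) hl.h).and ((ArithPred.eq hl.lengthX ((hl.p.add .one).add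
    (hl.n.mul ((hl.h.mul (hl.w.add .one)).add .one)))).and ((ArithPred.all hl.p
    (hl.weak.digit .last)).and (((ArithPred.eq hl.p (.const 0)).or (hl.one (hl.p.sub .one))).and
    ((hl.sym _ hl.p).and (ArithPred.all hl.n (.and ?_ ?_))))))
  · refine ArithPred.all hl.h.weak (.and ?_ ?_)
    · exact ArithPred.all hl.w.weak.weak
        (hl.weak.weak.weak.digit (hl.weak.weak.weak.pos (Arith.last.weak.weak) Arith.last.weak .last))
    · exact hl.weak.weak.sym _ (hl.weak.weak.pos Arith.last.weak .last hl.w.weak.weak)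
  · exact hl.weak.sym _ (hl.weak.pos .last hl.h.weak (.const 0))

theorem same (hl : ArithLayout l) (hb : Arith b) (hi : Arith i) (hb' : Arith b') (hi' : Arith i') :
    ArithPred fun a => (l a).Same (b a) (i a) (b' a) (i' a) :=
  ArithPred.all hl.w (.iff (hl.weak.one (hl.weak.pos hb.weak hi.weak .last))
    (hl.weak.one (hl.weak.pos hb'.weak hi'.weak .last)))

theorem entries (hl : ArithLayout l) : Arith fun a => (l a).entries :=
  hl.lengthY.sum (hl.weak.cert false .last)

theorem entry (hl : ArithLayout l) (hs : Arith s) : Arith fun a => (l a).entry (s a) :=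
  hl.lengthY.sum (ArithPred.and (hl.weak.cert true .last)
    (.eq (Arith.last.sum (hl.weak.weak.cert false .last)) hs.weak))

theorem isBorder (hl : ArithLayout l) (hb : Arith b) (hi : Arith i) :
    ArithPred fun a => (l a).IsBorder (b a) (i a) :=
  (ArithPred.le .one hi).and (hl.same hb (hi.sub .one) hb hi).not

theorem removed (hl : ArithLayout l) (hs : Arith s) (hb : Arith b) :
    Arith fun a => (l a).removed (s a) (b a) :=
  hs.sum (ArithPred.eq (hl.weak.entry .last) hb.weak)

theorem table (hl : ArithLayout l) (hs : Arith s) (hb : Arith b) :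
    Arith fun a => (l a).table (s a) (b a) :=
  hl.h.sum (.mul (ArithPred.and (hl.weak.isBorder hb.weak .last) (.eq (hl.h.weak.sum
    (ArithPred.and (.lt Arith.last.weak .last) (hl.weak.weak.isBorder hb.weak.weak .last)))
    (hl.weak.removed hs.weak hb.weak))) .last)

theorem sumF (hl : ArithLayout l) (hs : Arith s) (hb : Arith b) (hi : Arith i) :
    Arith fun a => (l a).sumF (s a) (b a) (i a) :=
  hl.n.sum (hl.h.weak.sum (ArithPred.and (.le (hl.weak.weak.table hs.weak.weak Arith.last.weak) .last)
    (hl.weak.weak.same Arith.last.weak .last hb.weak.weak hi.weak.weak)))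

theorem sumG (hl : ArithLayout l) (hs : Arith s) (hb : Arith b) (hi : Arith i) :
    Arith fun a => (l a).sumG (s a) (b a) (i a) :=
  have ht := hl.weak.table hs.weak .last
  hl.n.sum (.mul (ArithPred.and (.ne .last (hl.weak.entry hs.weak)) (.and (.ne ht (.const 0))
    (hl.weak.same .last ht hb.weak hi.weak))) (hl.h.weak.sub ht))

theorem numM (hl : ArithLayout l) (hs : Arith s) (hb : Arith b) (hi : Arith i) :
    Arith fun a => (l a).numM (s a) (b a) (i a) :=
  (hl.n.mul hl.h).sum (ArithPred.lt (Arith.last.mul hl.h.weak)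
    ((hl.weak.sumF hs.weak hb.weak hi.weak).sub (hl.weak.sumG hs.weak hb.weak hi.weak)))

theorem isFirst (hl : ArithLayout l) (hb : Arith b) (hi : Arith i) :
    ArithPred fun a => (l a).IsFirst (b a) (i a) :=
  .not (.ex hl.n (.ex hl.h.weak (.and
    (.lt ((Arith.last.weak.mul hl.h.weak.weak).add .last)
      ((hb.weak.weak.mul hl.h.weak.weak).add hi.weak.weak))
    (hl.weak.weak.same Arith.last.weak .last hb.weak.weak hi.weak.weak))))

theorem total (hl : ArithLayout l) (hs : Arith s) : Arith fun a => (l a).total (s a) :=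
  hl.n.sum (hl.h.weak.sum (.mul (hl.weak.weak.isFirst Arith.last.weak .last)
    (hl.weak.weak.numM hs.weak.weak Arith.last.weak .last)))

theorem _root_.SortPuzzle.ArithPred.isPow (hq : Arith q) : ArithPred fun a => Layout.IsPow (q a) :=
  (ArithPred.lt (.const 0) hq).and (.all hq (.all (hq.weak.add .one) (.imp
    (.eq ((((Arith.const 2).mul Arith.last.weak).add .one).mul .last) hq.weak.weak)
    (.eq Arith.last.weak (.const 0)))))

theorem _root_.SortPuzzle.Arith.logPow (hq : Arith q) : Arith fun a => Layout.logPow (q a) :=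
  hq.sum (ArithPred.isPow .last)

theorem cap (hl : ArithLayout l) : Arith fun a => (l a).cap :=
  (hl.n.mul hl.h).mul (hl.n.mul hl.h)

theorem smallK (hl : ArithLayout l) : Arith fun a => (l a).smallK :=
  (hl.cap.add .one).sum (.mul (ArithPred.and (.isPow .last) (.and (.lt (.logPow .last) hl.p.weak)
    (hl.weak.one (.logPow .last)))) .last)

theorem bigK (hl : ArithLayout l) : ArithPred fun a => (l a).BigK :=
  .ex hl.p (.and (.le (.logPow (hl.cap.weak.add .one)) .last) (hl.weak.one .last))

theorem room (hl : ArithLayout l) (hs : Arith s) : ArithPred fun a => (l a).Room (s a) :=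
  hl.bigK.or (.le (hl.total hs) (hl.smallK.add (hl.n.sum
    (ArithPred.eq (hl.weak.table hs.weak .last) (.const 0)))))

theorem isBalanced (hl : ArithLayout l) : ArithPred fun a => (l a).IsBalanced :=
  .all hl.n (.all hl.h.weak (.ex ((hl.n.mul hl.h).add .one).weak.weak (.eq
    (hl.n.weak.weak.weak.sum (hl.h.weak.weak.weak.weak.sum
      (hl.weak.weak.weak.weak.weak.same Arith.last.weak .last
        Arith.last.weak.weak.weak.weak Arith.last.weak.weak.weak)))
    (hl.h.weak.weak.weak.mul .last))))

theorem isOrder (hl : ArithLayout l) : ArithPred fun a => (l a).IsOrder :=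
  .and (.or (.eq hl.lengthY (.const 0)) (hl.cert false (hl.lengthY.sub .one)))
    (.and (.eq hl.entries (hl.n.sum (hl.h.weak.sum
      (hl.weak.weak.isBorder Arith.last.weak .last))))
    (.all hl.entries (.and (.lt (hl.weak.entry .last) hl.n.weak)
      (.and (.ne (hl.weak.table .last (hl.weak.entry .last)) (.const 0)) (hl.weak.room .last)))))

end ArithLayout

/-- The words for which some layout is valid and yields a balanced instance and a removal order. -/
theorem arithPred_exists_layout : ArithPred fun a : List Sym × List Bool =>
    ∃ p < a.1.length + 1, ∃ n < a.1.length + 1, ∃ h < a.1.length + 1, ∃ w < a.1.length + 1,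
      Layout.Valid ⟨a.1, a.2, p, n, h, w⟩ ∧ Layout.IsBalanced ⟨a.1, a.2, p, n, h, w⟩ ∧
        Layout.IsOrder ⟨a.1, a.2, p, n, h, w⟩ := by
  have hL : Arith fun a : List Sym × List Bool => a.1.length + 1 := Arith.lengthFst.add .one
  have hl : ArithLayout fun a : ((((List Sym × List Bool) × ℕ) × ℕ) × ℕ) × ℕ =>
      ⟨a.1.1.1.1.1, a.1.1.1.1.2, a.1.1.1.2, a.1.1.2, a.1.2, a.2⟩ :=
    ⟨fun _ => rfl, fun _ => rfl, Arith.last.weak.weak.weak, Arith.last.weak.weak, Arith.last.weak,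
      Arith.last⟩
  exact .ex hL (.ex hL.weak (.ex hL.weak.weak (.ex hL.weak.weak.weak
    (hl.valid.and (hl.isBalanced.and hl.isOrder)))))

end LayoutArith

/-! ### The positions in the word of an instance -/

theorem length_flatten_ofFn {β : Type} {n L : ℕ} (f : Fin n → List β) (hf : ∀ b, (f b).length = L) :
    (List.ofFn f).flatten.length = n * L := by
  simp [List.length_flatten, List.map_ofFn, Function.comp_def, hf, List.sum_ofFn]

theorem getElem?_flatten_ofFn {β : Type} {n L : ℕ} (f : Fin n → List β)
    (hf : ∀ b, (f b).length = L) (b : Fin n) {r : ℕ} (hr : r < L) :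
    (List.ofFn f).flatten[b * L + r]? = (f b)[r]? := by
  induction n with
  | zero => exact b.elim0
  | succ n ih =>
    rw [List.ofFn_succ, List.flatten_cons]
    rcases Fin.eq_zero_or_eq_succ b with rfl | ⟨b, rfl⟩
    · rw [Fin.val_zero, Nat.zero_mul, Nat.zero_add, List.getElem?_append_left (by rwa [hf])]
    · have : (b.succ : ℕ) * L + r = L + (b * L + r) := by rw [Fin.val_succ]; ring
      rw [this, List.getElem?_append_right (by rw [hf]; omega), hf, Nat.add_sub_cancel_left]
      exact ih (fun b => f b.succ) (fun b => hf b.succ) b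

theorem map_bits_eq_ofFn (k : ℕ) :
    (Nat.bits k).map Sym.bit = List.ofFn fun i : Fin (Nat.bits k).length => Sym.bit (k.testBit i) := by
  refine List.ext_getElem (by simp) fun i h _ => ?_
  rw [List.getElem_map, List.getElem_ofFn, Nat.testBit_eq_inth,
    List.getI_eq_getElem _ (by simpa using h)]

/-- The word that is built from given digits. -/
def digitWord {p n h w : ℕ} (K : Fin p → Bool) (D : Fin n → Fin h → Fin w → Bool) : List Sym :=
  (List.ofFn fun i => Sym.bit (K i)) ++ [Sym.endNumber] ++
  (List.ofFn fun b => (List.ofFn fun i => (List.ofFn fun j => Sym.bit (D b i j)) ++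
    [Sym.endUnit]).flatten ++ [Sym.endBin]).flatten

section DigitWord

variable {p n h w : ℕ} (K : Fin p → Bool) (D : Fin n → Fin h → Fin w → Bool)

theorem length_digitBin (b : Fin n) :
    ((List.ofFn fun i => (List.ofFn fun j => Sym.bit (D b i j)) ++
      [Sym.endUnit]).flatten ++ [Sym.endBin]).length = h * (w + 1) + 1 := by
  rw [List.length_append, length_flatten_ofFn (L := w + 1) _ (by simp)]; rfl

theorem length_digitWord : (digitWord K D).length = p + 1 + n * (h * (w + 1) + 1) := by
  unfold digitWord
  rw [List.length_append, length_flatten_ofFn _ (length_digitBin D)]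
  simp

theorem digitWord_number (i : Fin p) : (digitWord K D)[(i : ℕ)]? = some (Sym.bit (K i)) := by
  unfold digitWord
  rw [List.append_assoc, List.getElem?_append_left (by simp)]
  simp

theorem digitWord_endNumber : (digitWord K D)[p]? = some Sym.endNumber := by
  unfold digitWord
  rw [List.append_assoc, List.getElem?_append_right (by simp)]
  simp

theorem digitWord_bin (b : Fin n) {r : ℕ} (hr : r < h * (w + 1) + 1) :
    (digitWord K D)[p + 1 + (b * (h * (w + 1) + 1) + r)]? =
      ((List.ofFn fun i => (List.ofFn fun j => Sym.bit (D b i j)) ++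
      [Sym.endUnit]).flatten ++ [Sym.endBin])[r]? := by
  unfold digitWord
  rw [List.getElem?_append_right (by simp)]
  simp only [List.length_append, List.length_ofFn, List.length_singleton, Nat.add_sub_cancel_left]
  exact getElem?_flatten_ofFn _ (length_digitBin D) b hr

theorem digitWord_endBin (b : Fin n) :
    (digitWord K D)[p + 1 + b * (h * (w + 1) + 1) + h * (w + 1) + 0]? = some Sym.endBin := by
  rw [Nat.add_zero, Nat.add_assoc, digitWord_bin _ _ _ (Nat.lt_succ_self _),
    List.getElem?_append_right (by rw [length_flatten_ofFn (L := w + 1) _ (by simp)]),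
    length_flatten_ofFn (L := w + 1) _ (by simp)]
  simp

theorem digitWord_unit (b : Fin n) (i : Fin h) {j : ℕ} (hj : j < w + 1) :
    (digitWord K D)[p + 1 + b * (h * (w + 1) + 1) + i * (w + 1) + j]? =
      ((List.ofFn fun j => Sym.bit (D b i j)) ++ [Sym.endUnit])[j]? := by
  have h1 : (i : ℕ) * (w + 1) + j < h * (w + 1) := by
    have := Nat.mul_le_mul_right (w + 1) (Nat.succ_le_of_lt i.2)
    rw [Nat.succ_mul] at this
    omega
  rw [Nat.add_assoc, Nat.add_assoc, digitWord_bin _ _ _ (by omega), List.getElem?_append_left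
    (by rwa [length_flatten_ofFn (L := w + 1) _ (by simp)]),
    getElem?_flatten_ofFn (L := w + 1) _ (by simp) _ hj]

theorem digitWord_digit (b : Fin n) (i : Fin h) (j : Fin w) :
    (digitWord K D)[p + 1 + b * (h * (w + 1) + 1) + i * (w + 1) + j]? =
      some (Sym.bit (D b i j)) := by
  rw [digitWord_unit _ _ _ _ (by omega), List.getElem?_append_left (by simp)]
  simp

theorem digitWord_endUnit (b : Fin n) (i : Fin h) :
    (digitWord K D)[p + 1 + b * (h * (w + 1) + 1) + i * (w + 1) + w]? = some Sym.endUnit := by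
  rw [digitWord_unit _ _ _ _ (by omega), List.getElem?_append_right (by simp)]
  simp

end DigitWord

theorem Puzzle.encode_eq_digitWord (I : Puzzle) : I.encode = digitWord
    (fun i : Fin (Nat.bits I.k).length => I.k.testBit i)
    (fun b i (j : Fin (Nat.clog 2 I.m)) => (I.content b i : ℕ).testBit j) := by
  unfold Puzzle.encode digitWord encodeColor
  rw [map_bits_eq_ofFn]

/-- The layout of the word of an instance. -/
def Puzzle.layout (I : Puzzle) (y : List Bool) : Layout :=
  ⟨I.encode, y, (Nat.bits I.k).length, I.n, I.h, Nat.clog 2 I.m⟩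

theorem Layout.valid_of_eq_digitWord (l : Layout) (hh : 0 < l.h) {K : Fin l.p → Bool}
    {D : Fin l.n → Fin l.h → Fin l.w → Bool} (hx : l.x = digitWord K D)
    (hK : ∀ i : Fin l.p, (i : ℕ) + 1 = l.p → K i = true) : l.Valid := by
  refine ⟨hh, hx ▸ length_digitWord K D, fun i hi => ?_, ?_, hx ▸ digitWord_endNumber K D,
    fun b hb => ⟨fun i hi => ⟨fun j hj => ?_, ?_⟩, ?_⟩⟩
  · have := digitWord_number K D ⟨i, hi⟩
    rw [← hx] at this
    unfold Layout.Digit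
    rw [this]
    cases K ⟨i, hi⟩ <;> simp
  · rcases Nat.eq_zero_or_pos l.p with h | h
    · exact .inl h
    · have := digitWord_number K D ⟨l.p - 1, by omega⟩
      rw [← hx, hK _ (by simp; omega)] at this
      exact .inr this
  · have := digitWord_digit K D ⟨b, hb⟩ ⟨i, hi⟩ ⟨j, hj⟩
    rw [← hx] at this
    unfold Layout.Digit Layout.pos
    rw [this]
    cases D ⟨b, hb⟩ ⟨i, hi⟩ ⟨j, hj⟩ <;> simp
  · have := digitWord_endUnit K D ⟨b, hb⟩ ⟨i, hi⟩
    rwa [← hx] at this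
  · have := digitWord_endBin K D ⟨b, hb⟩
    rwa [← hx] at this

theorem Layout.Valid.eq_digitWord {l : Layout} (hl : l.Valid) {K : Fin l.p → Bool}
    {D : Fin l.n → Fin l.h → Fin l.w → Bool} (hK : ∀ i, K i = true ↔ l.One i)
    (hD : ∀ b i j, D b i j = true ↔ l.One (l.pos b i j)) : l.x = digitWord K D := by
  obtain ⟨hh, hlen, hnum, -, hend, hbin⟩ := hl
  have digit : ∀ {q : ℕ} {c : Bool}, l.Digit q → (c = true ↔ l.One q) →
      l.x[q]? = some (Sym.bit c) := by
    intro q c hq hc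
    unfold Layout.One at hc
    rcases hq with hq | hq <;> rw [hq] at hc ⊢ <;> cases c <;> simp at hc ⊢
  refine List.ext_getElem? fun q => ?_
  rcases lt_trichotomy q l.p with h | rfl | h
  · rw [digit (hnum q h) (hK ⟨q, h⟩)]
    exact (digitWord_number K D ⟨q, h⟩).symm
  · rw [hend, digitWord_endNumber]
  obtain ⟨q, rfl⟩ := Nat.exists_eq_add_of_lt h
  rcases lt_or_ge q (l.n * (l.h * (l.w + 1) + 1)) with hq | hq
  swap
  · rw [List.getElem?_eq_none (by omega), List.getElem?_eq_none (by rw [length_digitWord]; omega)]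
  have hb : q / (l.h * (l.w + 1) + 1) < l.n := (Nat.div_lt_iff_lt_mul (by omega)).2 hq
  have hr : q % (l.h * (l.w + 1) + 1) < l.h * (l.w + 1) + 1 := Nat.mod_lt _ (by omega)
  have hdm := Nat.div_add_mod' q (l.h * (l.w + 1) + 1)
  set b := q / (l.h * (l.w + 1) + 1)
  set r := q % (l.h * (l.w + 1) + 1)
  rcases Nat.lt_or_ge r (l.h * (l.w + 1)) with hr' | hr'
  · have hi : r / (l.w + 1) < l.h := (Nat.div_lt_iff_lt_mul (by omega)).2 hr'
    have hj : r % (l.w + 1) < l.w + 1 := Nat.mod_lt _ (by omega)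
    have hdm' := Nat.div_add_mod' r (l.w + 1)
    set i := r / (l.w + 1)
    set j := r % (l.w + 1)
    have e : l.p + q + 1 = l.pos b i j := by unfold Layout.pos; omega
    rw [e]
    rcases Nat.lt_or_ge j l.w with hj' | hj'
    · rw [digit (((hbin b hb).1 i hi).1 j hj') (hD ⟨b, hb⟩ ⟨i, hi⟩ ⟨j, hj'⟩)]
      exact (digitWord_digit K D ⟨b, hb⟩ ⟨i, hi⟩ ⟨j, hj'⟩).symm
    · have : j = l.w := by omega
      rw [this, ((hbin b hb).1 i hi).2]
      exact (digitWord_endUnit K D ⟨b, hb⟩ ⟨i, hi⟩).symm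
  · have e : l.p + q + 1 = l.pos b l.h 0 := by unfold Layout.pos; omega
    rw [e, (hbin b hb).2]
    exact (digitWord_endBin K D ⟨b, hb⟩).symm

theorem testBit_bits_length {k i : ℕ} (h : i + 1 = (Nat.bits k).length) : k.testBit i = true := by
  rw [Nat.size_eq_bits_len] at h
  exact Nat.testBit_of_two_pow_le_and_two_pow_add_one_gt (Nat.lt_size.1 (by omega))
    (Nat.size_le.1 (by omega))

theorem Puzzle.layout_valid (I : Puzzle) (y : List Bool) : (I.layout y).Valid :=
  Layout.valid_of_eq_digitWord _ I.h_pos I.encode_eq_digitWord fun _ hi => testBit_bits_length hi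

theorem bits_length_ofBits {p : ℕ} (K : Fin p → Bool)
    (hK : ∀ i : Fin p, (i : ℕ) + 1 = p → K i = true) : (Nat.bits (Nat.ofBits K)).length = p := by
  rw [Nat.size_eq_bits_len]
  refine le_antisymm (Nat.size_le.2 (Nat.ofBits_lt_two_pow K)) ?_
  rcases Nat.eq_zero_or_pos p with rfl | hp
  · exact Nat.zero_le _
  have : (Nat.ofBits K).testBit (p - 1) = true := by
    rw [Nat.testBit_ofBits_lt K _ (by omega)]
    exact hK _ (by simp; omega)
  have := Nat.lt_size.2 (Nat.ge_two_pow_of_testBit this)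
  omega

theorem digitWord_congr {p p' n h w w' : ℕ} {K : Fin p → Bool} {K' : Fin p' → Bool}
    {D : Fin n → Fin h → Fin w → Bool} {D' : Fin n → Fin h → Fin w' → Bool} (hp : p = p')
    (hw : w = w') (hK : ∀ i, K i = K' (Fin.cast hp i)) (hD : ∀ b i j, D b i j = D' b i (Fin.cast hw j)) :
    digitWord K D = digitWord K' D' := by
  subst hp hw
  congr
  · exact funext hK
  · exact funext fun b => funext fun i => funext (hD b i)

/-- A word with a valid layout encodes an instance. -/
theorem Layout.Valid.exists_puzzle {l : Layout} (hl : l.Valid) : ∃ I : Puzzle, l = I.layout l.y := by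
  classical
  have hK : ∀ i : Fin l.p, (i : ℕ) + 1 = l.p → decide (l.One i) = true := by
    intro i hi
    have := hl.2.2.2.1.resolve_left (by omega)
    rw [← hi] at this
    exact decide_eq_true this
  have hx := hl.eq_digitWord (K := fun i => decide (l.One i))
    (D := fun b i j => decide (l.One (l.pos b i j))) (by simp) (by simp)
  have hp := bits_length_ofBits _ hK
  have hw : Nat.clog 2 (2 ^ l.w) = l.w := Nat.clog_pow _ _ (by norm_num)
  refine ⟨⟨l.h, hl.1, l.n, Nat.ofBits fun i : Fin l.p => decide (l.One i), 2 ^ l.w,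
    fun b i => ⟨Nat.ofBits fun j : Fin l.w => decide (l.One (l.pos b i j)),
      Nat.ofBits_lt_two_pow _⟩⟩, ?_⟩
  unfold Puzzle.layout
  have : l.x = Puzzle.encode ⟨l.h, hl.1, l.n, Nat.ofBits fun i : Fin l.p => decide (l.One i),
      2 ^ l.w, fun b i => ⟨Nat.ofBits fun j : Fin l.w => decide (l.One (l.pos b i j)),
      Nat.ofBits_lt_two_pow _⟩⟩ := by
    refine hx.trans (Eq.trans ?_ (Puzzle.encode_eq_digitWord _).symm)
    refine (digitWord_congr hp.symm hw.symm (fun i => ?_) (fun b i j => ?_))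
    · exact (Nat.testBit_ofBits_lt (fun i : Fin l.p => decide (l.One i)) _ i.2).symm
    · exact (Nat.testBit_ofBits_lt (fun j : Fin l.w => decide (l.One (l.pos b i j))) _ j.2).symm
  rw [← this]
  cases l
  simp only [Layout.mk.injEq, true_and]
  exact ⟨hp.symm, hw.symm⟩

section LayoutOf

variable (I : Puzzle) (y : List Bool)

theorem Puzzle.layout_one_pos (b : Fin I.n) (i : Fin I.h) {j : ℕ} (hj : j < Nat.clog 2 I.m) :
    (I.layout y).One ((I.layout y).pos b i j) ↔ (I.content b i : ℕ).testBit j = true := by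
  have := digitWord_digit (fun i : Fin (Nat.bits I.k).length => I.k.testBit i)
    (fun b i (j : Fin (Nat.clog 2 I.m)) => (I.content b i : ℕ).testBit j) b i ⟨j, hj⟩
  rw [← I.encode_eq_digitWord] at this
  unfold Layout.One Layout.pos
  simp only [Puzzle.layout]
  rw [this]
  simp

/-- Units are compared by their colors. -/
theorem Puzzle.layout_same (b b' : Fin I.n) (i i' : Fin I.h) :
    (I.layout y).Same b i b' i' ↔ I.content b i = I.content b' i' := by
  have key : ∀ (b : Fin I.n) (i : Fin I.h) (j : ℕ), Nat.clog 2 I.m ≤ j →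
      (I.content b i : ℕ).testBit j = false := fun b i j hj => Nat.testBit_lt_two_pow
    ((I.content b i).2.trans_le ((Nat.le_pow_clog (by norm_num) _).trans
      (Nat.pow_le_pow_right (by norm_num) hj)))
  constructor
  · intro h
    refine Fin.ext (Nat.eq_of_testBit_eq fun j => ?_)
    rcases lt_or_ge j (Nat.clog 2 I.m) with hj | hj
    · have := h j hj
      rw [I.layout_one_pos y _ _ hj, I.layout_one_pos y _ _ hj] at this
      exact Bool.eq_iff_iff.2 this
    · rw [key _ _ _ hj, key _ _ _ hj]
  · intro h j hj
    rw [I.layout_one_pos y _ _ hj, I.layout_one_pos y _ _ hj, h]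

/-- The digits of the number of empty bins. -/
theorem Puzzle.layout_one (i : ℕ) :
    (i < (I.layout y).p ∧ (I.layout y).One i) ↔ I.k.testBit i = true := by
  have hp : (I.layout y).p = (Nat.bits I.k).length := rfl
  rcases lt_or_ge i (Nat.bits I.k).length with hi | hi
  · have := digitWord_number (fun i : Fin (Nat.bits I.k).length => I.k.testBit i)
      (fun b i (j : Fin (Nat.clog 2 I.m)) => (I.content b i : ℕ).testBit j) ⟨i, hi⟩
    rw [← I.encode_eq_digitWord] at this
    rw [hp, and_iff_right hi]
    unfold Layout.One
    simp only [Puzzle.layout]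
    simp only at this
    rw [this]
    simp
  · rw [hp, Nat.testBit_lt_two_pow (Nat.size_le.1 (by rwa [← Nat.size_eq_bits_len]))]
    simp; omega

end LayoutOf

/-! ### Sums over indicators -/

theorem sum_ind_eq_card {ι : Type} [DecidableEq ι] (s : Finset ι) (p : ι → Prop) [DecidablePred p] :
    ∑ i ∈ s, ind (p i) = (s.filter p).card := by
  rw [Finset.card_filter]
  exact Finset.sum_congr rfl fun i _ => by unfold ind; congr

theorem sum_ind_mul {ι : Type} (s : Finset ι) (p : ι → Prop) [DecidablePred p] (f : ι → ℕ) :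
    ∑ i ∈ s, ind (p i) * f i = ∑ i ∈ s.filter p, f i := by
  rw [Finset.sum_filter]
  exact Finset.sum_congr rfl fun i _ => by by_cases h : p i <;> simp [ind, h]

theorem sum_ind_lt_eq_min (N m : ℕ) : ∑ j ∈ Finset.range N, ind (j < m) = min N m := by
  induction N with
  | zero => simp
  | succ N ih =>
    rw [Finset.sum_range_succ, ih]
    by_cases h : N < m
    · rw [ind_pos h]; omega
    · rw [ind_neg h]; omega

/-- A rounded up quotient is the number of multiples of the divisor below the dividend. -/
theorem sum_ind_mul_lt_eq_ceilDiff {F G h N : ℕ} (hh : 0 < h) (hF : F ≤ N * h) :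
    ∑ j ∈ Finset.range N, ind (j * h < F - G) = ceilDiff F G h := by
  have : ∀ j, j * h < F - G ↔ j < ceilDiff F G h := fun j => by
    unfold ceilDiff
    rw [Nat.lt_iff_add_one_le (m := j), Nat.le_div_iff_mul_le hh, Nat.succ_mul]
    omega
  simp only [this, sum_ind_lt_eq_min]
  refine min_eq_right (Nat.le_of_lt_succ ((Nat.div_lt_iff_lt_mul hh).2 ?_))
  rw [Nat.succ_mul]
  omega

/-! ### Powers of two -/

namespace Layout

theorem isPow_iff {q : ℕ} : IsPow q ↔ ∃ i, q = 2 ^ i := by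
  constructor
  · rintro ⟨hq, h⟩
    rcases Nat.eq_two_pow_or_exists_odd_prime_and_dvd q with hi | ⟨d, hd, hdq, hodd⟩
    · exact hi
    · obtain ⟨e, rfl⟩ := hdq
      obtain ⟨d, rfl⟩ := hodd
      have he : 0 < e := Nat.pos_of_mul_pos_left hq
      have h1 := h d (by nlinarith) e (by nlinarith) rfl
      subst h1
      exact absurd hd (by norm_num)
  · rintro ⟨i, rfl⟩
    refine ⟨by positivity, fun d _ e _ h => ?_⟩
    obtain ⟨j, -, hj⟩ := (Nat.dvd_prime_pow Nat.prime_two).1 (Dvd.intro _ h)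
    rcases j with _ | j
    · rw [pow_zero] at hj; omega
    · rw [pow_succ] at hj; omega

open Classical in
theorem sum_ind_isPow_mul (N : ℕ) (f : ℕ → ℕ) :
    ∑ q ∈ Finset.range N, ind (IsPow q) * f q = ∑ i ∈ Finset.range (Nat.clog 2 N), f (2 ^ i) := by
  rw [sum_ind_mul, ← Finset.sum_image (s := Finset.range (Nat.clog 2 N)) (g := fun i => 2 ^ i)
    (f := f) (fun i _ j _ h => Nat.pow_right_injective le_rfl h)]
  refine Finset.sum_congr ?_ fun _ _ => rfl
  ext q
  simp only [Finset.mem_filter, Finset.mem_range, Finset.mem_image, isPow_iff,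
    Nat.lt_clog_iff_pow_lt (by norm_num : 1 < 2)]
  constructor
  · rintro ⟨h, i, rfl⟩; exact ⟨i, h, rfl⟩
  · rintro ⟨i, h, rfl⟩; exact ⟨h, i, rfl⟩

theorem logPow_eq_clog (q : ℕ) : logPow q = Nat.clog 2 q := by
  have := sum_ind_isPow_mul q fun _ => 1
  simpa [logPow] using this

theorem logPow_two_pow (i : ℕ) : logPow (2 ^ i) = i := by
  rw [logPow_eq_clog, Nat.clog_pow _ _ (by norm_num)]

end Layout

theorem sum_ind_testBit (k L : ℕ) :
    ∑ i ∈ Finset.range L, ind (k.testBit i = true) * 2 ^ i = k % 2 ^ L := by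
  induction L with
  | zero => simp [Nat.mod_one]
  | succ L ih =>
    rw [Finset.sum_range_succ, ih, Nat.mod_pow_succ, Nat.testBit_eq_decide_div_mod_eq]
    rcases Nat.mod_two_eq_zero_or_one (k / 2 ^ L) with h | h <;> simp [h, ind]

/-! ### Sequences of numbers in unary -/

/-- The word that consists of the given numbers in unary. -/
def unaryWord (vs : List ℕ) : List Bool := (vs.map fun v => List.replicate v true ++ [false]).flatten

theorem exists_unaryWord : ∀ {y : List Bool},
    (y.length = 0 ∨ y[y.length - 1]? = some false) → ∃ vs, y = unaryWord vs
  | [], _ => ⟨[], rfl⟩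
  | [true], h => by simp at h
  | [false], _ => ⟨[0], rfl⟩
  | c :: d :: y, h => by
    obtain ⟨vs, hvs⟩ := exists_unaryWord (y := d :: y) (.inr (by simpa using h))
    rcases c with _ | _
    · cases vs with
      | nil => simp [unaryWord] at hvs
      | cons v vs => exact ⟨0 :: v :: vs, by rw [hvs]; rfl⟩
    · cases vs with
      | nil => simp [unaryWord] at hvs
      | cons v vs => exact ⟨(v + 1) :: vs, by rw [hvs]; rfl⟩

theorem unaryWord_last (vs : List ℕ) :
    (unaryWord vs).length = 0 ∨ (unaryWord vs)[(unaryWord vs).length - 1]? = some false := by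
  rcases List.eq_nil_or_concat vs with rfl | ⟨vs, v, rfl⟩
  · exact .inl rfl
  · right
    have : unaryWord (vs ++ [v]) = unaryWord vs ++ List.replicate v true ++ [false] := by
      simp [unaryWord]
    rw [List.concat_eq_append, this]
    rw [List.getElem?_append_right (by simp)]
    simp

theorem count_false_unaryWord (vs : List ℕ) : (unaryWord vs).count false = vs.length := by
  induction vs with
  | nil => rfl
  | cons v vs ih =>
    have : unaryWord (v :: vs) = List.replicate v true ++ false :: unaryWord vs := by
      simp [unaryWord]
    rw [this, List.count_append, List.count_cons, ih]
    simp [List.count_replicate]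

/-- The number of symbols `true` that are preceded by `s` symbols `false`. -/
noncomputable def trueCount (y : List Bool) (s : ℕ) : ℕ :=
  ∑ j ∈ Finset.range y.length, ind (y[j]? = some true ∧ (y.take j).count false = s)

theorem trueCount_true_cons (y : List Bool) (s : ℕ) :
    trueCount (true :: y) s = trueCount y s + ind (s = 0) := by
  unfold trueCount
  rw [List.length_cons, Finset.sum_range_succ']
  congr 1
  by_cases h : s = 0 <;> simp [ind, h, eq_comm]

theorem trueCount_false_cons (y : List Bool) (s : ℕ) :
    trueCount (false :: y) s = if s = 0 then 0 else trueCount y (s - 1) := by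
  unfold trueCount
  rw [List.length_cons, Finset.sum_range_succ']
  split_ifs with h
  · subst h; simp [ind]
  · obtain ⟨s, rfl⟩ := Nat.exists_eq_succ_of_ne_zero h
    simp [ind]

theorem trueCount_unaryWord (vs : List ℕ) (s : ℕ) : trueCount (unaryWord vs) s = vs.getD s 0 := by
  induction vs generalizing s with
  | nil => simp [unaryWord, trueCount]
  | cons v vs ih =>
    have : unaryWord (v :: vs) = List.replicate v true ++ false :: unaryWord vs := by
      simp [unaryWord]
    rw [this]
    have key : ∀ v, trueCount (List.replicate v true ++ false :: unaryWord vs) s =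
        (if s = 0 then v else trueCount (unaryWord vs) (s - 1)) := by
      intro v
      induction v with
      | zero => exact trueCount_false_cons _ _
      | succ v ihv =>
        rw [List.replicate_succ, List.cons_append, trueCount_true_cons, ihv]
        by_cases h : s = 0 <;> simp [h, ind]
    rw [key]
    cases s with
    | zero => simp
    | succ s => simp [ih]

/-! ### The elements of a set of numbers in decreasing order -/

/-- The element of the set `D` above which there are `r` elements, or 0. -/
def nthTop (D : Finset ℕ) (r : ℕ) : ℕ :=
  ∑ i ∈ D.filter fun i => (D.filter fun j => i < j).card = r, i

theorem card_above_lt {D : Finset ℕ} {i j : ℕ} (hj : j ∈ D) (hij : i < j) :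
    (D.filter fun k => j < k).card < (D.filter fun k => i < k).card := by
  refine Finset.card_lt_card ⟨fun k hk => ?_, fun h => ?_⟩
  · simp only [Finset.mem_filter] at hk ⊢
    exact ⟨hk.1, hij.trans hk.2⟩
  · exact lt_irrefl j (Finset.mem_filter.1 (h (Finset.mem_filter.2 ⟨hj, hij⟩))).2

theorem nthTop_eq {D : Finset ℕ} {i r : ℕ} (hi : i ∈ D)
    (hr : (D.filter fun j => i < j).card = r) : nthTop D r = i := by
  unfold nthTop
  rw [Finset.sum_eq_single_of_mem i (Finset.mem_filter.2 ⟨hi, hr⟩)]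
  intro j hj hne
  obtain ⟨hj, hj'⟩ := Finset.mem_filter.1 hj
  rcases lt_or_gt_of_ne hne with h | h
  · have := card_above_lt hi h; omega
  · have := card_above_lt hj h; omega

theorem nthTop_eq_zero {D : Finset ℕ} {r : ℕ}
    (h : ∀ i ∈ D, (D.filter fun j => i < j).card ≠ r) : nthTop D r = 0 :=
  Finset.sum_eq_zero fun i hi => absurd (Finset.mem_filter.1 hi).2 (h i (Finset.mem_filter.1 hi).1)

theorem exists_of_nthTop_ne_zero {D : Finset ℕ} {r : ℕ} (h : nthTop D r ≠ 0) :
    nthTop D r ∈ D ∧ (D.filter fun j => nthTop D r < j).card = r := by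
  obtain ⟨i, hi, hr⟩ : ∃ i ∈ D, (D.filter fun j => i < j).card = r := by
    by_contra! hc; exact h (nthTop_eq_zero hc)
  rw [nthTop_eq hi hr]
  exact ⟨hi, hr⟩

theorem nthTop_zero (D : Finset ℕ) : nthTop D 0 = D.sup id := by
  rcases D.eq_empty_or_nonempty with rfl | hD
  · rfl
  · refine nthTop_eq (sup_id_mem hD) (Finset.card_eq_zero.2 (Finset.filter_eq_empty_iff.2 ?_))
    exact fun j hj => not_lt.2 (Finset.le_sup (f := id) hj)

theorem nthTop_succ {D : Finset ℕ} {r : ℕ} (h : nthTop D r ≠ 0) :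
    nthTop D (r + 1) = (D.filter (· < nthTop D r)).sup id := by
  obtain ⟨hi, hr⟩ := exists_of_nthTop_ne_zero h
  set i := nthTop D r
  rcases (D.filter (· < i)).eq_empty_or_nonempty with he | hne
  · rw [he]
    refine nthTop_eq_zero fun j hj hjr => ?_
    rcases lt_trichotomy i j with hij | rfl | hij
    · have := card_above_lt hj hij; omega
    · omega
    · exact Finset.notMem_empty j (he ▸ Finset.mem_filter.2 ⟨hj, hij⟩)
  · have hj := sup_id_mem hne
    have hmax : ∀ k ∈ D, k < i → k ≤ (D.filter (· < i)).sup id := fun k hk hki =>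
      Finset.le_sup (f := id) (Finset.mem_filter.2 ⟨hk, hki⟩)
    set j := (D.filter (· < i)).sup id
    obtain ⟨hjD, hji⟩ := Finset.mem_filter.1 hj
    refine nthTop_eq hjD ?_
    have : (D.filter fun k => j < k) = insert i (D.filter fun k => i < k) := by
      ext k
      simp only [Finset.mem_filter, Finset.mem_insert]
      constructor
      · rintro ⟨hk, hjk⟩
        rcases lt_trichotomy k i with hki | hki | hki
        · exact absurd (hmax k hk hki) (not_le.2 hjk)
        · exact .inl hki
        · exact .inr ⟨hk, hki⟩
      · rintro (rfl | ⟨hk, hki⟩)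
        · exact ⟨hi, hji⟩
        · exact ⟨hk, hji.trans hki⟩
    rw [this, Finset.card_insert_of_notMem (by simp), hr]

/-! ### Sums over first representatives -/

/-- A sum over the values of a map is a sum over the first preimage of each value. -/
theorem sum_ind_first_mul {ι κ : Type} [Fintype ι] [Fintype κ] [DecidableEq κ] (idx : ι → ℕ)
    (hidx : Function.Injective idx) (g : ι → κ) (f : κ → ℕ) (hf : ∀ c, (∀ i, g i ≠ c) → f c = 0) :
    ∑ i, ind (∀ j, idx j < idx i → g j ≠ g i) * f (g i) = ∑ c, f c := by
  classical
  rw [sum_ind_mul]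
  refine Finset.sum_bij_ne_zero (fun i _ _ => g i) (fun _ _ _ => Finset.mem_univ _) ?_ ?_ ?_
  · intro i hi _ j hj _ hij
    have hi := (Finset.mem_filter.1 hi).2 j
    have hj := (Finset.mem_filter.1 hj).2 i
    refine hidx (le_antisymm (not_lt.1 fun h => hi h hij.symm) (not_lt.1 fun h => hj h hij))
  · intro c _ hc
    have hne : (Finset.univ.filter fun i => g i = c).Nonempty := by
      by_contra h
      rw [Finset.not_nonempty_iff_eq_empty, Finset.filter_eq_empty_iff] at h
      exact hc (hf c fun i => h (Finset.mem_univ i))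
    obtain ⟨i, hi, hmin⟩ := Finset.exists_min_image _ idx hne
    have hi := (Finset.mem_filter.1 hi).2
    subst hi
    refine ⟨i, Finset.mem_filter.2 ⟨Finset.mem_univ _, fun j hj hji => ?_⟩, hc, rfl⟩
    exact not_le.2 hj (hmin j (Finset.mem_filter.2 ⟨Finset.mem_univ _, hji⟩))
  · intros; rfl

/-! ### The conditions on a certificate, in terms of an instance -/

namespace Puzzle

variable (I : Puzzle) (y : List Bool)

/-- The non-trivial borders of a full bin. -/
def innerBorders (b : Fin I.n) : Finset ℕ := (borders (I.init (Sum.inl b)).1).erase 0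

theorem mem_innerBorders {b : Fin I.n} {i : ℕ} :
    i ∈ I.innerBorders b ↔ i < I.h ∧ (I.layout y).IsBorder b i := by
  unfold innerBorders
  rw [Finset.mem_erase, mem_borders, I.init_inl_length]
  have : i ≠ 0 ∧ (i = 0 ∨ 1 ≤ i ∧ i < I.h ∧
      (I.init (Sum.inl b)).1[i - 1]? ≠ (I.init (Sum.inl b)).1[i]?) ↔
      i < I.h ∧ 1 ≤ i ∧ (I.init (Sum.inl b)).1[i - 1]? ≠ (I.init (Sum.inl b)).1[i]? := by
    rcases Nat.eq_zero_or_pos i with h | h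
    · simp [h]
    · simp only [h.ne', ne_eq, not_false_eq_true, true_and, false_or]
      tauto
  rw [this]
  refine and_congr_right fun hi => and_congr_right fun _ => not_congr ?_
  rw [I.init_inl_getElem? b hi, I.init_inl_getElem? b (by omega : i - 1 < I.h)]
  exact Option.some_inj.trans (I.layout_same y b b ⟨i - 1, by omega⟩ ⟨i, hi⟩).symm

theorem card_filter_innerBorders (b : Fin I.n) (p : ℕ → Prop) [DecidablePred p] :
    ((I.innerBorders b).filter p).card =
      ∑ i ∈ Finset.range I.h, ind (p i ∧ (I.layout y).IsBorder b i) := by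
  classical
  rw [sum_ind_eq_card]
  congr 1
  ext i
  simp only [Finset.mem_filter, Finset.mem_range, I.mem_innerBorders y]
  tauto

theorem borderCount_init : borderCount I.init =
    ∑ b ∈ Finset.range I.n, ∑ i ∈ Finset.range I.h, ind ((I.layout y).IsBorder b i) := by
  have hr : ∀ k : Fin I.k, ((borders (I.init (Sum.inr k)).1).erase 0).card = 0 := fun _ => rfl
  unfold borderCount
  rw [Fintype.sum_sum_type, Finset.sum_range]
  simp only [hr, Finset.sum_const_zero, Nat.add_zero]
  refine Finset.sum_congr rfl fun b _ => ?_
  have := I.card_filter_innerBorders y b fun _ => True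
  simpa [innerBorders] using this

/-- The table that is determined by the entries of the certificate before the entry `s`. -/
noncomputable def tableAt (s : ℕ) : I.Bin → ℕ
  | Sum.inl b => (I.layout y).table s b
  | Sum.inr _ => 0

theorem tableAt_inl (s : ℕ) (b : Fin I.n) :
    I.tableAt y s (Sum.inl b) = nthTop (I.innerBorders b) ((I.layout y).removed s b) := by
  classical
  change (I.layout y).table s b = _
  unfold nthTop Layout.table
  rw [sum_ind_mul]
  refine Finset.sum_congr ?_ fun _ _ => rfl
  ext i
  have := I.card_filter_innerBorders y b fun j => i < j
  simp only [Finset.mem_filter, Finset.mem_range, I.mem_innerBorders y]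
  have h1 : ∑ i' ∈ Finset.range (I.layout y).h, ind (i < i' ∧ (I.layout y).IsBorder b i') =
    ((I.innerBorders b).filter fun j => i < j).card := by
    exact this.symm
  rw [h1]
  exact (and_assoc (a := i < I.h)).symm

theorem tableAt_zero : I.tableAt y 0 = topBorder I.init := by
  funext b
  rcases b with b | k
  · rw [tableAt_inl]
    unfold Layout.removed
    rw [Finset.sum_range_zero, nthTop_zero, innerBorders]
    exact Finset.sup_erase_bot _
  · rfl

theorem tableAt_mem_borders (s : ℕ) (b : I.Bin) : I.tableAt y s b ∈ borders (I.init b).1 := by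
  rcases b with b | k
  · rw [tableAt_inl]
    by_cases h : nthTop (I.innerBorders b) ((I.layout y).removed s b) = 0
    · rw [h]; exact zero_mem_borders _
    · exact Finset.mem_of_mem_erase (exists_of_nthTop_ne_zero h).1
  · exact zero_mem_borders _

theorem removed_succ (s b : ℕ) : (I.layout y).removed (s + 1) b =
    (I.layout y).removed s b + ind ((I.layout y).entry s = b) :=
  Finset.sum_range_succ _ _

theorem tableAt_succ_of_ne {s : ℕ} {b : I.Bin} (h : I.binIndex b ≠ (I.layout y).entry s) :
    I.tableAt y (s + 1) b = I.tableAt y s b := by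
  rcases b with b | k
  · rw [tableAt_inl, tableAt_inl, removed_succ, ind_neg fun h' => h h'.symm, Nat.add_zero]
  · rfl

theorem tableAt_succ_of_eq {s : ℕ} {b : Fin I.n} (h : (I.layout y).entry s = b)
    (h0 : I.tableAt y s (Sum.inl b) ≠ 0) : I.tableAt y (s + 1) (Sum.inl b) =
      prevBorder (I.init (Sum.inl b)).1 (I.tableAt y s (Sum.inl b)) := by
  rw [tableAt_inl] at h0 ⊢
  rw [tableAt_inl, removed_succ, ind_pos h, nthTop_succ h0, prevBorder, innerBorders,
    Finset.filter_erase]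
  exact Finset.sup_erase_bot _

variable {y}

theorem tableAt_lt {s : ℕ} (b : Fin I.n) : I.tableAt y s (Sum.inl b) < I.h := by
  by_cases h : I.tableAt y s (Sum.inl b) = 0
  · rw [h]; exact I.h_pos
  · have := lt_length_of_mem_borders (I.tableAt_mem_borders y s (Sum.inl b)) h
    rwa [I.init_inl_length] at this

theorem countF_init (τ : I.Bin → ℕ) (c : Fin I.m) : countF I.init τ c =
    ∑ a : Fin I.n, ∑ j : Fin I.h, ind (τ (Sum.inl a) ≤ j ∧ I.content a j = c) := by
  classical
  unfold countF
  rw [Fintype.sum_sum_type, Finset.sum_eq_zero (s := (Finset.univ : Finset (Fin I.k))), Nat.add_zero]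
  swap
  · intro k _
    simp [init]
  refine Finset.sum_congr rfl fun a _ => ?_
  rw [sum_ind_eq_card]
  refine (Finset.card_bij (fun (j : Fin I.h) _ => (j : ℕ) + 1) ?_ ?_ ?_).symm
  · intro j hj
    obtain ⟨hj, hc⟩ := (Finset.mem_filter.1 hj).2
    simp only [Finset.mem_filter, Finset.mem_Ioc, Nat.add_sub_cancel]
    rw [I.init_inl_getElem? a j.2]
    exact ⟨⟨by omega, j.2⟩, congrArg some hc⟩
  · intro i _ j _ h
    exact Fin.ext (Nat.succ_injective h)
  · intro i hi
    simp only [Finset.mem_filter, Finset.mem_Ioc] at hi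
    obtain ⟨⟨h1, h2⟩, h3⟩ := hi
    rw [I.init_inl_getElem? a (by omega : i - 1 < I.h)] at h3
    exact ⟨⟨i - 1, by omega⟩, Finset.mem_filter.2 ⟨Finset.mem_univ _, by simp; omega,
      Option.some_inj.1 h3⟩, by simp; omega⟩

theorem sumF_eq (s : ℕ) (b : Fin I.n) (i : Fin I.h) : (I.layout y).sumF s b i =
    countF I.init (I.tableAt y s) (I.content b i) := by
  rw [countF_init]
  unfold Layout.sumF
  refine (Finset.sum_range _).trans (Finset.sum_congr rfl fun a _ => ?_)
  refine (Finset.sum_range _).trans (Finset.sum_congr rfl fun j _ => ?_)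
  exact congrArg ind (propext (and_congr_right' (I.layout_same y a b j i)))

theorem countF_init_le (τ : I.Bin → ℕ) (c : Fin I.m) : countF I.init τ c ≤ I.n * I.h := by
  rw [countF_init]
  calc _ ≤ ∑ a : Fin I.n, ∑ j : Fin I.h, 1 := Finset.sum_le_sum fun a _ =>
        Finset.sum_le_sum fun j _ => by unfold ind; split_ifs <;> omega
    _ = I.n * I.h := by simp

theorem countF_init_eq_zero (τ : I.Bin → ℕ) {c : Fin I.m} (h : ∀ b i, I.content b i ≠ c) :
    countF I.init τ c = 0 := by
  rw [countF_init]
  exact Finset.sum_eq_zero fun a _ => Finset.sum_eq_zero fun j _ => ind_neg fun h' => h a j h'.2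

theorem sumG_eq {s : ℕ} {e : Fin I.n} (he : (I.layout y).entry s = e) (b : Fin I.n) (i : Fin I.h) :
    (I.layout y).sumG s b i =
      countGWithout I.init (I.tableAt y s) (Sum.inl e) (I.content b i) := by
  classical
  have key : ∀ f : I.Bin → ℕ, ∑ a ∈ (colorBins I.init (I.tableAt y s) (I.content b i)).erase
      (Sum.inl e), f a = ∑ a : I.Bin, ind (a ≠ Sum.inl e ∧ I.tableAt y s a ≠ 0 ∧
        (I.init a).1[I.tableAt y s a]? = some (I.content b i)) * f a := by
    intro f
    rw [sum_ind_mul]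
    refine Finset.sum_congr ?_ fun _ _ => rfl
    ext a
    simp [colorBins]
  unfold countGWithout Layout.sumG
  rw [key, Fintype.sum_sum_type, Finset.sum_eq_zero (s := (Finset.univ : Finset (Fin I.k))),
    Nat.add_zero]
  swap
  · intro k _
    rw [ind_neg (by simp [tableAt]), Nat.zero_mul]
  refine (Finset.sum_range _).trans (Finset.sum_congr rfl fun a _ => ?_)
  refine congrArg₂ _ (congrArg ind (propext (and_congr ?_ (and_congr_right' ?_)))) rfl
  · rw [he]
    exact not_congr ⟨fun h => congrArg Sum.inl (Fin.ext h),
      fun h => congrArg Fin.val (Sum.inl_injective h)⟩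
  · rw [I.init_inl_getElem? a (I.tableAt_lt a), Option.some_inj]
    exact I.layout_same y a b ⟨_, I.tableAt_lt a⟩ i

theorem numM_eq {s : ℕ} {e : Fin I.n} (he : (I.layout y).entry s = e) (b : Fin I.n) (i : Fin I.h) :
    (I.layout y).numM s b i = ceilDiff (countF I.init (I.tableAt y s) (I.content b i))
      (countGWithout I.init (I.tableAt y s) (Sum.inl e) (I.content b i)) I.h := by
  unfold Layout.numM
  rw [I.sumF_eq, I.sumG_eq he]
  refine sum_ind_mul_lt_eq_ceilDiff I.h_pos ((I.countF_init_le _ _).trans ?_)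
  exact Nat.le_mul_of_pos_right _ I.h_pos

theorem isFirst_iff (b : Fin I.n) (i : Fin I.h) : (I.layout y).IsFirst b i ↔
    ∀ q : Fin I.n × Fin I.h, q.1 * I.h + (q.2 : ℕ) < b * I.h + i →
      I.content q.1 q.2 ≠ I.content b i := by
  unfold Layout.IsFirst
  push Not
  constructor
  · intro h q hq hc
    exact h q.1 q.1.2 q.2 q.2.2 hq ((I.layout_same y _ _ _ _).2 hc)
  · intro h b' hb' i' hi' hlt hs
    exact h (⟨b', hb'⟩, ⟨i', hi'⟩) hlt ((I.layout_same y ⟨b', hb'⟩ b ⟨i', hi'⟩ i).1 hs)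

theorem unit_index_injective : Function.Injective fun q : Fin I.n × Fin I.h =>
    (q.1 : ℕ) * I.h + (q.2 : ℕ) := by
  rintro ⟨b, i⟩ ⟨b', i'⟩ h
  simp only at h
  have h1 := congrArg (· / I.h) h
  have h2 := congrArg (· % I.h) h
  simp only [Nat.mul_comm _ I.h, Nat.mul_add_mod, Nat.mod_eq_of_lt, i.2, i'.2, Nat.mul_add_div I.h_pos,
    Nat.div_eq_of_lt, Nat.add_zero] at h1 h2
  exact Prod.ext (Fin.ext h1) (Fin.ext h2)

theorem total_eq {s : ℕ} {e : Fin I.n} (he : (I.layout y).entry s = e) :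
    ((I.layout y).total s : ℤ) =
      ∑ c, countMWithout I.init (I.tableAt y s) (Sum.inl e) c := by
  simp only [countMWithout_eq I.h_pos]
  rw [← Nat.cast_sum, ← sum_ind_first_mul _ I.unit_index_injective
    (fun q => I.content q.1 q.2), Fintype.sum_prod_type]
  · unfold Layout.total
    refine congrArg Nat.cast ((Finset.sum_range _).trans (Finset.sum_congr rfl fun b _ => ?_))
    refine (Finset.sum_range _).trans (Finset.sum_congr rfl fun i _ => ?_)
    refine congrArg₂ _ (congrArg ind (propext (I.isFirst_iff b i))) ?_
    exact I.numM_eq he b i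
  · intro c hc
    rw [I.countF_init_eq_zero _ fun b i => hc (b, i)]
    unfold ceilDiff
    rw [Nat.zero_sub]
    exact Nat.div_eq_of_lt (by have := I.h_pos; omega)

theorem total_le_cap (s : ℕ) : (I.layout y).total s ≤ (I.layout y).cap := by
  unfold Layout.total Layout.cap
  calc _ ≤ ∑ b ∈ Finset.range (I.layout y).n, ∑ i ∈ Finset.range (I.layout y).h,
        (I.layout y).n * (I.layout y).h := by
        refine Finset.sum_le_sum fun b _ => Finset.sum_le_sum fun i _ => ?_
        have h1 : ∀ p, ind p ≤ 1 := fun p => by unfold ind; split_ifs <;> omega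
        have h2 : (I.layout y).numM s b i ≤ (I.layout y).n * (I.layout y).h := by
          unfold Layout.numM
          exact (Finset.sum_le_sum fun j _ => h1 _).trans (by simp)
        exact (Nat.mul_le_mul (h1 _) h2).trans (by rw [Nat.one_mul])
    _ = _ := by simp [Nat.mul_assoc]

theorem smallK_eq : (I.layout y).smallK = I.k % 2 ^ Nat.clog 2 ((I.layout y).cap + 1) := by
  rw [← sum_ind_testBit]
  unfold Layout.smallK
  have h : ∀ q, ind (Layout.IsPow q ∧ Layout.logPow q < (I.layout y).p ∧
      (I.layout y).One (Layout.logPow q)) * q =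
      ind (Layout.IsPow q) * (ind (I.k.testBit (Layout.logPow q) = true) * q) := fun q => by
    rw [I.layout_one]
    by_cases h1 : Layout.IsPow q <;> by_cases h2 : I.k.testBit (Layout.logPow q) = true <;>
      simp [ind, h1, h2]
  simp only [h]
  rw [Layout.sum_ind_isPow_mul]
  simp only [Layout.logPow_two_pow]

theorem bigK_iff : (I.layout y).BigK ↔ 2 ^ Nat.clog 2 ((I.layout y).cap + 1) ≤ I.k := by
  unfold Layout.BigK
  rw [Layout.logPow_eq_clog]
  constructor
  · rintro ⟨i, hi, hle, h1⟩
    exact (Nat.pow_le_pow_right (by norm_num) hle).trans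
      (Nat.ge_two_pow_of_testBit ((I.layout_one y i).1 ⟨hi, h1⟩))
  · intro h
    obtain ⟨i, hi, h1⟩ := Nat.exists_ge_and_testBit_of_ge_two_pow h
    obtain ⟨h2, h3⟩ := (I.layout_one y i).2 h1
    exact ⟨i, h2, hi, h3⟩

theorem card_monoBins_tableAt (s : ℕ) : (monoBins (I.tableAt y s)).card =
    I.k + ∑ b ∈ Finset.range I.n, ind ((I.layout y).table s b = 0) := by
  classical
  unfold monoBins
  rw [← sum_ind_eq_card, Fintype.sum_sum_type, Nat.add_comm]
  refine congrArg₂ _ ?_ (Finset.sum_range fun b => ind ((I.layout y).table s b = 0)).symm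
  simp [tableAt, ind]

theorem room_iff {s : ℕ} {e : Fin I.n} (he : (I.layout y).entry s = e) : (I.layout y).Room s ↔
    ∑ c, countMWithout I.init (I.tableAt y s) (Sum.inl e) c ≤
      ((monoBins (I.tableAt y s)).card : ℤ) := by
  rw [← I.total_eq he, Nat.cast_le, I.card_monoBins_tableAt]
  unfold Layout.Room
  rw [I.bigK_iff, I.smallK_eq]
  have h1 := I.total_le_cap (y := y) s
  have h2 := Nat.le_pow_clog (by norm_num : 1 < 2) ((I.layout y).cap + 1)
  have hn : (I.layout y).n = I.n := rfl
  rw [hn]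
  rcases le_or_gt (2 ^ Nat.clog 2 ((I.layout y).cap + 1)) I.k with hk | hk
  · exact iff_of_true (.inl hk) (by omega)
  · rw [Nat.mod_eq_of_lt hk, or_iff_right (not_le.2 hk)]

theorem tableMove_tableAt_iff {s : ℕ} {e : Fin I.n} (he : (I.layout y).entry s = e) :
    TableMove I.init (Sum.inl e) (I.tableAt y s) (I.tableAt y (s + 1)) ↔
      (I.layout y).table s e ≠ 0 ∧ (I.layout y).Room s := by
  rw [I.room_iff he]
  constructor
  · exact fun h => ⟨h.2.1.ne', h.2.2.2⟩
  · rintro ⟨h1, h2⟩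
    refine ⟨fun a ha => (I.tableAt_succ_of_ne y fun h => ha ?_).symm, Nat.pos_of_ne_zero h1,
      I.tableAt_succ_of_eq y he h1, h2⟩
    rw [he] at h
    rcases a with a | k
    · exact congrArg _ (Fin.ext h)
    · exact absurd e.2 (by rw [← h]; simp [binIndex])

theorem entries_eq {vs : List ℕ} (hy : y = unaryWord vs) : (I.layout y).entries = vs.length := by
  subst hy
  unfold Layout.entries
  rw [sum_ind_getElem?_eq_count_take, List.take_of_length_le le_rfl]
  exact count_false_unaryWord vs

theorem entry_eq {vs : List ℕ} (hy : y = unaryWord vs) (s : ℕ) :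
    (I.layout y).entry s = vs.getD s 0 := by
  subst hy
  rw [← trueCount_unaryWord]
  unfold Layout.entry trueCount
  simp only [sum_ind_getElem?_eq_count_take]
  rfl

theorem isRemovalOrder_iff {us : List (Fin I.n)} (hy : y = unaryWord (us.map (↑))) :
    IsRemovalOrder I.init (us.map Sum.inl) ↔ us.length = borderCount I.init ∧
      ∀ s < us.length, (I.layout y).table s ((I.layout y).entry s) ≠ 0 ∧ (I.layout y).Room s := by
  have he : ∀ (s : ℕ) (hs : s < us.length), (I.layout y).entry s = us[s] := fun s hs => by
    rw [I.entry_eq hy, List.getD_eq_getElem _ _ (by simpa)]; simp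
  have hlen : (us.map (Sum.inl : Fin I.n → I.Bin)).length = us.length := by simp
  unfold IsRemovalOrder
  refine and_congr (by rw [hlen]) ⟨?_, fun h => ⟨I.tableAt y, I.tableAt_zero y, fun s hs => ?_⟩⟩
  · rintro ⟨τ, h0, hτ⟩
    have key : ∀ s ≤ us.length, τ s = I.tableAt y s := by
      intro s
      induction s with
      | zero => intro _; rw [h0, tableAt_zero]
      | succ s ih =>
        intro hs
        have hm := hτ s (hlen.symm ▸ hs)
        rw [ih (by omega), List.getElem_map] at hm
        obtain ⟨h1, h2, h3, h4⟩ := (I.tableMove_tableAt_iff (he s hs)).2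
          ⟨hm.2.1.ne', (I.room_iff (he s hs)).2 hm.2.2.2⟩
        funext a
        by_cases ha : a = Sum.inl us[s]
        · rw [ha, hm.2.2.1, h3]
        · rw [← hm.1 a ha, h1 a ha]
    intro s hs
    have hm := hτ s (hlen.symm ▸ hs)
    rw [key s hs.le, key (s + 1) hs, List.getElem_map, I.tableMove_tableAt_iff (he s hs)] at hm
    rwa [he s hs]
  · rw [hlen] at hs
    rw [List.getElem_map, I.tableMove_tableAt_iff (he s hs)]
    have := h s hs
    rwa [he s hs] at this

theorem exists_map_inl_of_isRemovalOrder {bs : List I.Bin} (h : IsRemovalOrder I.init bs) :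
    ∃ us : List (Fin I.n), us.map Sum.inl = bs := by
  obtain ⟨-, τ, h0, hτ⟩ := h
  have key : ∀ s ≤ bs.length, ∀ k, τ s (Sum.inr k) = 0 := by
    intro s
    induction s with
    | zero => intro _ k; rw [h0]; rfl
    | succ s ih =>
      intro hs k
      have hm := hτ s hs
      by_cases hk : Sum.inr k = bs[s]
      · have := hm.2.1
        rw [← hk, ih (by omega)] at this
        omega
      · rw [← hm.1 _ hk, ih (by omega)]
  have : bs ∈ Set.range (List.map (Sum.inl : Fin I.n → I.Bin)) := by
    rw [Set.range_list_map]
    intro b hb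
    obtain ⟨s, hs, rfl⟩ := List.getElem_of_mem hb
    have := (hτ s hs).2.1
    rcases hb : bs[s] with u | k
    · exact ⟨u, rfl⟩
    · rw [hb, key s hs.le] at this; omega
  exact this

theorem encodeOrder_map_inl (us : List (Fin I.n)) :
    I.encodeOrder (us.map Sum.inl) = unaryWord (us.map (↑)) := by
  unfold encodeOrder unaryWord
  simp [Function.comp_def, binIndex]

/-- The condition on the certificate expresses that it encodes a removal order. -/
theorem isOrder_iff : (I.layout y).IsOrder ↔
    ∃ bs, y = I.encodeOrder bs ∧ IsRemovalOrder I.init bs := by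
  have hn : (I.layout y).n = I.n := rfl
  unfold Layout.IsOrder
  constructor
  · rintro ⟨hlast, hlen, h⟩
    obtain ⟨vs, hy⟩ := exists_unaryWord hlast
    replace hy : y = unaryWord vs := hy
    rw [I.entries_eq hy] at hlen h
    have : vs ∈ Set.range (List.map ((↑) : Fin I.n → ℕ)) := by
      rw [Set.range_list_map]
      intro v hv
      obtain ⟨s, hs, rfl⟩ := List.getElem_of_mem hv
      have := (h s hs).1
      rw [I.entry_eq hy, List.getD_eq_getElem _ _ hs] at this
      exact ⟨⟨_, this⟩, rfl⟩
    obtain ⟨us, rfl⟩ := this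
    refine ⟨us.map Sum.inl, by rw [encodeOrder_map_inl, ← hy], (I.isRemovalOrder_iff hy).2 ⟨?_, ?_⟩⟩
    · rw [I.borderCount_init y, ← us.length_map (f := ((↑) : Fin I.n → ℕ))]
      exact hlen
    · intro s hs
      exact (h s (by simpa using hs)).2
  · rintro ⟨bs, hy, hbs⟩
    obtain ⟨us, rfl⟩ := I.exists_map_inl_of_isRemovalOrder hbs
    rw [encodeOrder_map_inl] at hy
    obtain ⟨h1, h2⟩ := (I.isRemovalOrder_iff hy).1 hbs
    rw [I.entries_eq hy, List.length_map]
    refine ⟨?_, ?_, fun s hs => ⟨?_, h2 s hs⟩⟩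
    · have := unaryWord_last (us.map ((↑) : Fin I.n → ℕ))
      rwa [← hy] at this
    · rw [h1, I.borderCount_init y]; rfl
    · rw [I.entry_eq hy, List.getD_eq_getElem _ _ (by simpa)]
      simp [hn]

theorem sum_count_init (c : Fin I.m) : ∑ b, (I.init b).1.count c =
    ∑ a : Fin I.n, ∑ j : Fin I.h, ind (I.content a j = c) := by
  have h := I.countF_init (fun _ => 0) c
  have h' : countF I.init (fun _ => 0) c = ∑ b, (I.init b).1.count c := by
    unfold countF
    refine Finset.sum_congr rfl fun b _ => ?_
    rw [card_filter_Ioc_eq_count_drop (I.init b).2, List.drop_zero]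
  rw [← h', h]
  simp

theorem isBalanced_iff : (I.layout y).IsBalanced ↔ I.Balanced := by
  have key : ∀ (b : Fin I.n) (i : Fin I.h), ∑ a ∈ Finset.range (I.layout y).n,
      ∑ i' ∈ Finset.range (I.layout y).h, ind ((I.layout y).Same a i' b i) =
      ∑ a, (I.init a).1.count (I.content b i) := by
    intro b i
    rw [sum_count_init]
    refine (Finset.sum_range _).trans (Finset.sum_congr rfl fun a _ => ?_)
    refine (Finset.sum_range _).trans (Finset.sum_congr rfl fun j _ => ?_)
    exact congrArg ind (propext (I.layout_same y a b j i))
  unfold Layout.IsBalanced Balanced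
  constructor
  · intro h c
    by_cases hc : ∃ b i, I.content b i = c
    · obtain ⟨b, i, rfl⟩ := hc
      obtain ⟨j, -, hj⟩ := h b b.2 i i.2
      exact ⟨j, by rw [← key, hj]; rfl⟩
    · push Not at hc
      refine ⟨0, ?_⟩
      rw [sum_count_init]
      exact Finset.sum_eq_zero fun a _ => Finset.sum_eq_zero fun j _ => ind_neg (hc a j)
  · intro h b hb i hi
    obtain ⟨j, hj⟩ := h (I.content ⟨b, hb⟩ ⟨i, hi⟩)
    refine ⟨j, ?_, by rw [key ⟨b, hb⟩ ⟨i, hi⟩, hj]; rfl⟩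
    have h1 : I.h * j ≤ I.n * I.h := by
      rw [← hj, sum_count_init]
      refine (Finset.sum_le_sum fun a _ => Finset.sum_le_sum (g := fun _ => 1) fun j _ => ?_).trans
        (by simp)
      unfold ind; split_ifs <;> omega
    have h2 : j ≤ I.h * j := Nat.le_mul_of_pos_left _ I.h_pos
    exact Nat.lt_succ_of_le (h2.trans h1)

end Puzzle

/-! ### Membership in NP -/

theorem Layout.Valid.le_length {l : Layout} (hl : l.Valid) (hn : 0 < l.n) :
    l.p < l.x.length ∧ l.n < l.x.length ∧ l.n * l.h < l.x.length ∧ l.h < l.x.length ∧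
      l.w < l.x.length := by
  obtain ⟨hh, hlen, -⟩ := hl
  have h1 : l.n * (l.h * (l.w + 1) + 1) = l.n * l.h * l.w + l.n * l.h + l.n := by ring
  have h2 : l.h ≤ l.n * l.h := Nat.le_mul_of_pos_left _ hn
  have h3 : l.w ≤ l.n * l.h * l.w := Nat.le_mul_of_pos_left _ (Nat.mul_pos hn hh)
  rw [h1] at hlen
  refine ⟨?_, ?_, ?_, ?_, ?_⟩ <;> omega

/-- A certificate is characterized by the existence of a layout. The numbers of the layout are
bounded by the length of the instance word; if there are no full bins, this determines neither the
capacity nor the number of digits of a color, which are therefore chosen. -/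
theorem orderCertificate_iff (x : List Sym) (y : List Bool) : OrderCertificate x y ↔
    ∃ p < x.length + 1, ∃ n < x.length + 1, ∃ h < x.length + 1, ∃ w < x.length + 1,
      Layout.Valid ⟨x, y, p, n, h, w⟩ ∧ Layout.IsBalanced ⟨x, y, p, n, h, w⟩ ∧
        Layout.IsOrder ⟨x, y, p, n, h, w⟩ := by
  constructor
  · rintro ⟨I, bs, rfl, hy, hbal, hord⟩
    have hv := I.layout_valid y
    have ho := I.isOrder_iff.2 ⟨bs, hy, hord⟩
    rcases Nat.eq_zero_or_pos I.n with hn | hn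
    · obtain ⟨-, hlen, hnum, htop, hend, -⟩ := hv
      obtain ⟨hlast, hent, -⟩ := ho
      have h0 : (I.layout y).n = 0 := hn
      have hlen' : I.encode.length = (Nat.bits I.k).length + 1 := by
        rw [h0, Nat.zero_mul] at hlen; exact hlen
      rw [h0, Finset.sum_range_zero] at hent
      refine ⟨(Nat.bits I.k).length, by omega, 0, by omega, 1, by omega, 0, by omega,
        ⟨Nat.one_pos, by rw [hlen', Nat.zero_mul], hnum, htop, hend,
        fun b hb => absurd hb (Nat.not_lt_zero b)⟩, fun b hb => absurd hb (Nat.not_lt_zero b),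
        hlast, hent, fun s hs => ?_⟩
      have : s < (I.layout y).entries := hs
      omega
    · obtain ⟨h1, h2, -, h3, h4⟩ := hv.le_length hn
      exact ⟨(Nat.bits I.k).length, h1.trans (Nat.lt_succ_self _), I.n,
        h2.trans (Nat.lt_succ_self _), I.h, h3.trans (Nat.lt_succ_self _), Nat.clog 2 I.m,
        h4.trans (Nat.lt_succ_self _), hv, I.isBalanced_iff.2 hbal, ho⟩
  · rintro ⟨p, -, n, -, h, -, w, -, hv, hbal, hord⟩
    obtain ⟨I, hI⟩ := hv.exists_puzzle
    rw [hI] at hbal hord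
    obtain ⟨bs, hy, hbs⟩ := I.isOrder_iff.1 hord
    exact ⟨I, bs, congrArg Layout.x hI, hy, I.isBalanced_iff.1 hbal, hbs⟩

theorem polyTimeRelation_orderCertificate : PolyTimeRelation OrderCertificate :=
  ArithPred.polyTimeRelation
    (arithPred_exists_layout.congr fun a => (orderCertificate_iff a.1 a.2).symm)

theorem length_unaryWord_le {vs : List ℕ} {n : ℕ} (h : ∀ v ∈ vs, v < n) :
    (unaryWord vs).length ≤ vs.length * n := by
  induction vs with
  | nil => simp [unaryWord]
  | cons v vs ih =>
    have h1 := ih fun v hv => h v (List.mem_cons_of_mem _ hv)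
    have h2 := h v List.mem_cons_self
    have : (unaryWord (v :: vs)).length = v + 1 + (unaryWord vs).length := by
      simp [unaryWord]; omega
    rw [this, List.length_cons, Nat.succ_mul]
    omega

theorem Puzzle.length_encodeOrder_le (I : Puzzle) {bs : List I.Bin}
    (h : IsRemovalOrder I.init bs) : (I.encodeOrder bs).length ≤ I.encode.length ^ 2 := by
  obtain ⟨us, rfl⟩ := I.exists_map_inl_of_isRemovalOrder h
  have hlen := h.1
  rw [List.length_map, I.borderCount_init []] at hlen
  have hle : us.length ≤ I.n * I.h := by
    rw [hlen]
    refine (Finset.sum_le_sum fun b _ => Finset.sum_le_sum (g := fun _ => 1) fun i _ => ?_).trans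
      (by simp)
    unfold ind; split_ifs <;> omega
  rw [encodeOrder_map_inl]
  refine (length_unaryWord_le (n := I.n) (by simp)).trans ?_
  rw [List.length_map]
  rcases Nat.eq_zero_or_pos I.n with hn | hn
  · exact (mul_eq_zero_of_right _ hn).trans_le (Nat.zero_le _)
  · obtain ⟨-, h2, h3, -⟩ := (I.layout_valid []).le_length hn
    rw [sq]
    exact Nat.mul_le_mul (hle.trans h3.le) h2.le

/-- Removal orders certify every language whose yes-instances are the balanced instances that have
a removal order. -/
theorem isNPVerifier_orderCertificate {P : Puzzle → Prop}
    (hP : ∀ I, P I ↔ I.Balanced ∧ ∃ bs, IsRemovalOrder I.init bs) {L : Language Sym}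
    (hL : ∀ x, x ∈ L ↔ ∃ I : Puzzle, x = I.encode ∧ P I) : IsNPVerifier OrderCertificate L := by
  refine ⟨polyTimeRelation_orderCertificate, Polynomial.X ^ 2, fun x => ?_⟩
  rw [hL]
  constructor
  · rintro ⟨I, rfl, hI⟩
    obtain ⟨hb, bs, hbs⟩ := (hP I).1 hI
    refine ⟨I.encodeOrder bs, ?_, I, bs, rfl, rfl, hb, hbs⟩
    rw [Polynomial.eval_pow, Polynomial.eval_X]
    exact I.length_encodeOrder_le hbs
  · rintro ⟨y, -, I, bs, hx, -, hb, hbs⟩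
    exact ⟨I, hx, (hP I).2 ⟨hb, bs, hbs⟩⟩

theorem isNPVerifier_orderCertificate_BSP : IsNPVerifier OrderCertificate BSP :=
  isNPVerifier_orderCertificate Puzzle.ballSolvable_iff fun _ => Iff.rfl

theorem isNPVerifier_orderCertificate_WSP : IsNPVerifier OrderCertificate WSP :=
  isNPVerifier_orderCertificate Puzzle.waterSolvable_iff fun _ => Iff.rfl

end SortPuzzle

open SortPuzzle in
theorem mainTheorem3 :
    (InNP BSP ∧ InNP WSP) ∧
    (IsNPVerifier OrderCertificate BSP ∧ IsNPVerifier OrderCertificate WSP) ∧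
    (∀ I : Puzzle,
      (I.BallSolvable ↔ I.Balanced ∧ ∃ bs : List I.Bin, IsRemovalOrder I.init bs) ∧
      (I.WaterSolvable ↔ I.Balanced ∧ ∃ bs : List I.Bin, IsRemovalOrder I.init bs)) ∧
    (∃ (P : List Instr) (t : ℕ), ChecksTransitions P t) := by
  exact ⟨⟨⟨_, isNPVerifier_orderCertificate_BSP⟩, ⟨_, isNPVerifier_orderCertificate_WSP⟩⟩,
    ⟨isNPVerifier_orderCertificate_BSP, isNPVerifier_orderCertificate_WSP⟩,
    fun I => ⟨I.ballSolvable_iff, I.waterSolvable_iff⟩,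
    ⟨transitionProgram, 70, checksTransitions_transitionProgram⟩⟩
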